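/- **Names, terms, patterns.** Fix a countably infinite set of names $a,b,x,\dots$. Terms are $s,t ::= a \mid s\bullet t$ and patterns are $p,q ::= x \mid \ulcorner a\urcorner \mid p\bullet q$, where $x$ is a binding name and $\ulcorner a\urcorner$ is a name-match; $\ulcorner s\bullet t\urcorner$ stands for $\ulcorner s\urcorner\bullet\ulcorner t\urcorner$. The match $\{t/\!\!/p\}$ is the partial function with $\{t/\!\!/x\}=\{t/x\}$, $\{a/\!\!/\ulcorner a\urcorner\}=\emptyset$, $\{s\bullet t/\!\!/p\bullet q\}=\{s/\!\!/p\}\cup\{t/\!\!/q\}$, undefined otherwise; it extends componentwise to sequences of equal length (undefined for different lengths). **Languages.** For $\alpha\in\{A,S\}$, $\beta\in\{M,P\}$, $\gamma\in\{D,C\}$, $\delta\in\{NO,NM,I\}$, $\epsilon\in\{B,J\}$ the language $\mathcal L_{\alpha,\beta,\gamma,\delta,\epsilon}$ has the processes $$P,Q ::= 0 \mid \mathit{Out} \mid \mathit{In} \mid (\nu a)P \mid P|Q \mid \mathbf{if}\ s=t\ \mathbf{then}\ P\ \mathbf{else}\ Q \mid {*P} \mid \surd ,$$ taken up to $\alpha$-equivalence.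 Here $\mathit{Out}$ is $\overline s\langle t_1,\dots,t_n\rangle$ if $\alpha=A$ (asynchronous) and $\overline s\langle t_1,\dots,t_n\rangle.P$ if $\alpha=S$ (synchronous); $\mathit{In}$ is $(s_1(\tilde p_1)\,|\cdots|\,s_k(\tilde p_k))\rhd P$ with $k=1$ if $\epsilon=B$ (binary) and any $k\ge 1$ if $\epsilon=J$ (joining), all its binding names being distinct and bound in $P$. If $\beta=M$ (monadic) all sequences $\tilde t,\tilde p$ have length $1$; if $\beta=P$ (polyadic) the length is arbitrary. If $\gamma=D$ (dataspace-based) the channels $s$ are absent; if $\gamma=C$ (channel-based) they are present. If $\delta=NO$, channels and data are names and the patterns in inputs are binding names; if $\delta=NM$, channels and data are names and the patterns are binding names or name-matches; if $\delta=I$, channels and data are arbitrary terms and patterns are arbitrary. **Semantics.** $\equiv$ is the equivalence generated, under all operators other than input, by: $(|,0)$ is a commutative monoid; $\mathbf{if}\ s=t\ \mathbf{then}\ P\ \mathbf{else}\ Q$ is $\equiv P$ if $s=t$ and $\equiv Q$ if $s\ne t$; $(\nu a)0\equiv 0$; $(\nu a)(\nu b)P\equiv(\nu b)(\nu a)P$;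 $P|(\nu a)Q\equiv(\nu a)(P|Q)$ if $a\notin\mathrm{fn}(P)$; $*P\equiv P|{*P}$. Reduction $\to$ is the least relation closed under $\equiv$, parallel composition and restriction with $$\overline{s_1}\langle\tilde t_1\rangle.P_1|\cdots|\overline{s_k}\langle\tilde t_k\rangle.P_k\,|\,\bigl((s_1(\tilde p_1)|\cdots|s_k(\tilde p_k))\rhd Q\bigr)\ \to\ P_1|\cdots|P_k|\sigma Q,\qquad \sigma=\bigcup_i\{\tilde t_i/\!\!/\tilde p_i\},$$ where the $P_i$ are omitted if $\alpha=A$ and the $s_i$ are omitted if $\gamma=D$. $\Rightarrow$ is the reflexive transitive closure of $\to$; $P\to^\omega$ means that $P$ has an infinite reduction sequence; $P\Downarrow$ means $P\Rightarrow\;\equiv P''|\surd$ for some $P''$. For each language fix any reference equivalence $\asymp$: an equivalence relation on its processes that contains $\equiv$ and is reduction-sensitive (if $P\asymp Q$ and $P\to$ then $Q\to$). **Valid encodings.** A valid encoding of $\mathcal L_1$ into $\mathcal L_2$ is a map $[\![\cdot]\!]$ from $\mathcal L_1$-processes to $\mathcal L_2$-processes together with a map $\varphi$ from names to $k$-tuples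 of names, for some $k>0$, such that: 1. *(compositionality)* for every $k$-ary operator $\mathrm{op}$ of $\mathcal L_1$ and every set $N$ of names there is a $k$-ary context $C^N_{\mathrm{op}}$ of $\mathcal L_2$ (a process in which $k$ occurrences of $0$ are replaced by $k$ holes, each hole occurring once; holes may be below binders) with $[\![\mathrm{op}(S_1,\dots,S_k)]\!]=C^N_{\mathrm{op}}[[\![S_1]\!];\dots;[\![S_k]\!]]$ whenever $\mathrm{fn}(S_1,\dots,S_k)=N$; 2. *(name invariance)* for every $S$ and every finite-domain substitution $\sigma$ of names by names there is a substitution $\sigma'$ with $\varphi(\sigma(a))=\sigma'(\varphi(a))$ for all names $a$, and fixing every name that occurs in no $\varphi(a)$, such that $[\![\sigma S]\!]=\sigma'[\![S]\!]$ if $\sigma$ is injective and $[\![\sigma S]\!]\asymp_2\sigma'[\![S]\!]$ otherwise; 3. *(operational correspondence)* if $S\Rightarrow_1 S'$ then $[\![S]\!]\Rightarrow_2\asymp_2[\![S']\!]$; and if $[\![S]\!]\Rightarrow_2 T$ then there is $S'$ with $S\Rightarrow_1S'$ and $T\Rightarrow_2\asymp_2[\![S']\!]$; 4. *(divergence reflection)*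 $[\![S]\!]\to_2^\omega$ implies $S\to_1^\omega$; 5. *(success sensitiveness)* $S\Downarrow_1$ if and only if $[\![S]\!]\Downarrow_2$. **Statement.** Let $\alpha\in\{A,S\}$, $\beta\in\{M,P\}$, $\delta\in\{NO,NM,I\}$. If there exists no valid encoding from $\mathcal L_{\alpha,\beta,C,\delta,B}$ into $\mathcal L_{\alpha,\beta,D,\delta,B}$, then for both $\epsilon\in\{B,J\}$ there exists no valid encoding from $\mathcal L_{\alpha,\beta,C,\delta,\epsilon}$ into $\mathcal L_{\alpha,\beta,D,\delta,J}$. -/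

import Mathlib

namespace Coord

/-! ## Syntax

Processes are represented up to `α`-equivalence, in locally nameless style: free names are the
natural numbers, and a bound name is an index. The index `i` at a place that lies below `d` binding
positions refers to the innermost of them when `i = 0`; a restriction binds one position, an input
binds one position for each binding name in it, numbered from left to right. Thus `α`-equivalence of
processes is equality, and inputs automatically bind pairwise distinct names. -/

/-- An occurrence of a name: the free name `a`, or a reference to an enclosing binder. -/
inductive Name : Type
  | free (a : ℕ)
  | bound (i : ℕ)

/-- Terms `s, t ::= a | s • t`. -/
inductive Term : Type
  | name (v : Name)
  | comp (s t : Term)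

/-- Patterns `p, q ::= x | ⌜a⌝ | p • q`; the binding name `x` is anonymous. -/
inductive Pat : Type
  | bind
  | nameMatch (v : Name)
  | comp (p q : Pat)

/-- A single input `s(p₁, …, pₙ)`, or `(p₁, …, pₙ)` when the channel is `none`. -/
structure Inp : Type where
  chan : Option Term
  pats : List Pat

/-- Processes of all the languages together. -/
inductive Proc : Type
  /-- the null process -/
  | nil
  /-- the success process -/
  | ok
  /-- asynchronous output `s⟨t₁, …, tₙ⟩` -/
  | out (c : Option Term) (d : List Term)
  /-- synchronous output `s⟨t₁, …, tₙ⟩.P` -/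
  | outThen (c : Option Term) (d : List Term) (P : Proc)
  /-- the input `(I₁ | … | Iₖ) ▷ P`; for `k = 1` this is the binary input `I₁.P` -/
  | join (I : List Inp) (P : Proc)
  /-- restriction of one name in `P` -/
  | res (P : Proc)
  | par (P Q : Proc)
  /-- `if s = t then P else Q` -/
  | ite (s t : Term) (P Q : Proc)
  /-- replication `*P` -/
  | rep (P : Proc)

/-! ## Binders, free names, substitution -/

/-- The number of binding names. -/
def Pat.binders : Pat → ℕ
  | .bind => 1
  | .nameMatch _ => 0
  | .comp p q => p.binders + q.binders

def Inp.binders (i : Inp) : ℕ := (i.pats.map Pat.binders).sum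

/-- The number of binding names of a joined input. -/
def joinBinders (I : List Inp) : ℕ := (I.map Inp.binders).sum

/-- The pattern `⌜t⌝`, where `⌜s • t⌝ = ⌜s⌝ • ⌜t⌝`. -/
def Term.toPat : Term → Pat
  | .name v => .nameMatch v
  | .comp s t => .comp s.toPat t.toPat

/-- Replace every name occurrence `v` by the term `f v`. -/
def Term.subst (f : Name → Term) : Term → Term
  | .name v => f v
  | .comp s t => .comp (s.subst f) (t.subst f)

def Pat.subst (f : Name → Term) : Pat → Pat
  | .bind => .bind
  | .nameMatch v => (f v).toPat
  | .comp p q => .comp (p.subst f) (q.subst f)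

def Inp.subst (f : Name → Term) (i : Inp) : Inp :=
  ⟨i.chan.map (Term.subst f), i.pats.map (Pat.subst f)⟩

/-- Replace every name occurrence `v` below `d` binding positions by the term `f d v`. -/
def Proc.subst (f : ℕ → Name → Term) : ℕ → Proc → Proc
  | _, .nil => .nil
  | _, .ok => .ok
  | d, .out c t => .out (c.map (Term.subst (f d))) (t.map (Term.subst (f d)))
  | d, .outThen c t P =>
      .outThen (c.map (Term.subst (f d))) (t.map (Term.subst (f d))) (P.subst f d)
  | d, .join I P => .join (I.map (Inp.subst (f d))) (P.subst f (d + joinBinders I))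
  | d, .res P => .res (P.subst f (d + 1))
  | d, .par P Q => .par (P.subst f d) (Q.subst f d)
  | d, .ite s t P Q => .ite (s.subst (f d)) (t.subst (f d)) (P.subst f d) (Q.subst f d)
  | d, .rep P => .rep (P.subst f d)

/-- The (capture-avoiding) application of a substitution of free names by names. -/
def Proc.rename (σ : ℕ → ℕ) (P : Proc) : Proc :=
  P.subst (fun _ v => match v with
    | .free a => .name (.free (σ a))
    | .bound i => .name (.bound i)) 0

/-- Abstract the free names `xs` of a process: the `i`-th of them becomes the `i`-th position of a
binder that is about to be put around the process. -/
def Proc.close (xs : List ℕ) (P : Proc) : Proc :=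
  P.subst (fun d v => match v with
    | .free a => if a ∈ xs then .name (.bound (d + xs.idxOf a)) else .name (.free a)
    | .bound i => .name (.bound i)) 0

/-- The (capture-avoiding) instantiation of the outermost bound positions of the body of an input by
the terms `ts`. -/
def Proc.inst (ts : List Term) (P : Proc) : Proc :=
  P.subst (fun d v => match v with
    | .free a => .name (.free a)
    | .bound i => if i < d then .name (.bound i) else (ts[i - d]?).getD (.name (.bound i))) 0

/-- The restriction `(ν a) P` of a named free name. -/
def Proc.nu (a : ℕ) (P : Proc) : Proc := .res (P.close [a])

def Name.fn : Name → Set ℕ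
  | .free a => {a}
  | .bound _ => ∅

def Term.fn : Term → Set ℕ
  | .name v => v.fn
  | .comp s t => s.fn ∪ t.fn

def Pat.fn : Pat → Set ℕ
  | .bind => ∅
  | .nameMatch v => v.fn
  | .comp p q => p.fn ∪ q.fn

def Inp.fn (i : Inp) : Set ℕ := (⋃ s ∈ i.chan, s.fn) ∪ ⋃ p ∈ i.pats, p.fn

/-- The free names of a process. -/
def Proc.fn : Proc → Set ℕ
  | .nil => ∅
  | .ok => ∅
  | .out c d => (⋃ s ∈ c, s.fn) ∪ ⋃ t ∈ d, t.fn
  | .outThen c d P => (⋃ s ∈ c, s.fn) ∪ (⋃ t ∈ d, t.fn) ∪ P.fn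
  | .join I P => (⋃ i ∈ I, i.fn) ∪ P.fn
  | .res P => P.fn
  | .par P Q => P.fn ∪ Q.fn
  | .ite s t P Q => s.fn ∪ t.fn ∪ P.fn ∪ Q.fn
  | .rep P => P.fn

/-! `ClosedAt d`: every bound index refers to one of `d` positions outside or to a binder inside. -/

def Name.ClosedAt (d : ℕ) : Name → Prop
  | .free _ => True
  | .bound i => i < d

def Term.ClosedAt (d : ℕ) : Term → Prop
  | .name v => v.ClosedAt d
  | .comp s t => s.ClosedAt d ∧ t.ClosedAt d

def Pat.ClosedAt (d : ℕ) : Pat → Prop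
  | .bind => True
  | .nameMatch v => v.ClosedAt d
  | .comp p q => p.ClosedAt d ∧ q.ClosedAt d

def Inp.ClosedAt (d : ℕ) (i : Inp) : Prop :=
  (∀ s ∈ i.chan, s.ClosedAt d) ∧ ∀ p ∈ i.pats, p.ClosedAt d

def Proc.ClosedAt : ℕ → Proc → Prop
  | _, .nil => True
  | _, .ok => True
  | n, .out c d => (∀ s ∈ c, s.ClosedAt n) ∧ ∀ t ∈ d, t.ClosedAt n
  | n, .outThen c d P => (∀ s ∈ c, s.ClosedAt n) ∧ (∀ t ∈ d, t.ClosedAt n) ∧ P.ClosedAt n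
  | n, .join I P => (∀ i ∈ I, i.ClosedAt n) ∧ P.ClosedAt (n + joinBinders I)
  | n, .res P => P.ClosedAt (n + 1)
  | n, .par P Q => P.ClosedAt n ∧ Q.ClosedAt n
  | n, .ite s t P Q => s.ClosedAt n ∧ t.ClosedAt n ∧ P.ClosedAt n ∧ Q.ClosedAt n
  | n, .rep P => P.ClosedAt n

/-! ## The 48 languages -/

/-- Asynchronous or synchronous. -/
inductive Synchronism : Type
  | A
  | S

/-- Monadic or polyadic. -/
inductive Arity : Type
  | M
  | P

/-- Dataspace-based or channel-based. -/
inductive Medium : Type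
  | D
  | C

/-- No matching, name-matching, or intensional. -/
inductive Matching : Type
  | NO
  | NM
  | I

/-- Binary or joining. -/
inductive Coordination : Type
  | B
  | J

/-- The index `(α, β, γ, δ, ε)` of a language. -/
structure Lang : Type where
  sync : Synchronism
  arity : Arity
  medium : Medium
  matching : Matching
  coord : Coordination

/-- The terms that may be channels or data: names, or arbitrary terms in intensional languages. -/
def Lang.OkTerm (L : Lang) (t : Term) : Prop :=
  match L.matching with
  | .I => True
  | _ => ∃ v, t = .name v

def Lang.OkPat (L : Lang) (p : Pat) : Prop :=
  match L.matching with
  | .NO => p = .bind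
  | .NM => p = .bind ∨ ∃ v, p = .nameMatch v
  | .I => True

def Lang.OkChan (L : Lang) (c : Option Term) : Prop :=
  match L.medium with
  | .D => c = none
  | .C => ∃ s, c = some s ∧ L.OkTerm s

/-- The admissible lengths of data and of pattern sequences. -/
def Lang.OkLength (L : Lang) (n : ℕ) : Prop :=
  match L.arity with
  | .M => n = 1
  | .P => True

/-- `OUT` -/
def Lang.OkOut (L : Lang) (c : Option Term) (d : List Term) : Prop :=
  L.OkChan c ∧ L.OkLength d.length ∧ ∀ t ∈ d, L.OkTerm t

/-- `IN` -/
def Lang.OkInp (L : Lang) (i : Inp) : Prop :=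
  L.OkChan i.chan ∧ L.OkLength i.pats.length ∧ ∀ p ∈ i.pats, L.OkPat p

/-- A binary language has one input at a time, a joining one any positive number of them. -/
def Lang.OkJoin (L : Lang) (I : List Inp) : Prop :=
  (match L.coord with
  | .B => I.length = 1
  | .J => I ≠ []) ∧ ∀ i ∈ I, L.OkInp i

/-- The process is built by the productions of the language `L`. -/
def Lang.Admits (L : Lang) : Proc → Prop
  | .nil => True
  | .ok => True
  | .out c d => L.sync = .A ∧ L.OkOut c d
  | .outThen c d P => L.sync = .S ∧ L.OkOut c d ∧ L.Admits P
  | .join I P => L.OkJoin I ∧ L.Admits P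
  | .res P => L.Admits P
  | .par P Q => L.Admits P ∧ L.Admits Q
  | .ite _ _ P Q => L.Admits P ∧ L.Admits Q
  | .rep P => L.Admits P

/-- `P` is a process of the language `L`. -/
def Lang.Mem (L : Lang) (P : Proc) : Prop := P.ClosedAt 0 ∧ L.Admits P

/-! ## Semantics -/

/-- One use of an axiom of structural equivalence, possibly inside a process, but not below an input
prefix (there a bound name, distinct from all other names, still waits to be replaced by one of
them, so that the axioms for conditionals would not be sound). A process of which a named free name
is restricted has to be closed, that is, without dangling bound indices. -/
inductive StructStep : Proc → Proc → Prop
  | par_nil (P : Proc) : StructStep (.par P .nil) P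
  | par_comm (P Q : Proc) : StructStep (.par P Q) (.par Q P)
  | par_assoc (P Q R : Proc) : StructStep (.par P (.par Q R)) (.par (.par P Q) R)
  | ite_eq (s : Term) (P Q : Proc) : StructStep (.ite s s P Q) P
  | ite_ne (s t : Term) (P Q : Proc) : s ≠ t → StructStep (.ite s t P Q) Q
  | nu_nil (a : ℕ) : StructStep (.nu a .nil) .nil
  | nu_comm (a b : ℕ) (P : Proc) : P.ClosedAt 0 → StructStep (.nu a (.nu b P)) (.nu b (.nu a P))
  | par_nu (a : ℕ) (P Q : Proc) : P.ClosedAt 0 → Q.ClosedAt 0 → a ∉ P.fn →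
      StructStep (.par P (.nu a Q)) (.nu a (.par P Q))
  | rep (P : Proc) : StructStep (.rep P) (.par P (.rep P))
  | congr_par_left {P P' : Proc} (Q : Proc) : StructStep P P' → StructStep (.par P Q) (.par P' Q)
  | congr_par_right (P : Proc) {Q Q' : Proc} : StructStep Q Q' → StructStep (.par P Q) (.par P Q')
  | congr_nu (a : ℕ) {P P' : Proc} :
      P.ClosedAt 0 → P'.ClosedAt 0 → StructStep P P' → StructStep (.nu a P) (.nu a P')
  | congr_rep {P P' : Proc} : StructStep P P' → StructStep (.rep P) (.rep P')
  | congr_ite_left (s t : Term) {P P' : Proc} (Q : Proc) :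
      StructStep P P' → StructStep (.ite s t P Q) (.ite s t P' Q)
  | congr_ite_right (s t : Term) (P : Proc) {Q Q' : Proc} :
      StructStep Q Q' → StructStep (.ite s t P Q) (.ite s t P Q')
  | congr_outThen (c : Option Term) (d : List Term) {P P' : Proc} :
      StructStep P P' → StructStep (.outThen c d P) (.outThen c d P')

/-- Structural equivalence `≡` of processes of `L`: the equivalence generated by the axioms, all
processes involved being processes of `L`. -/
def StructEq (L : Lang) : Proc → Proc → Prop :=
  Relation.EqvGen fun P Q => L.Mem P ∧ L.Mem Q ∧ StructStep P Q

/-- `TermMatch t p σ`: the match of `t` with `p` is defined and is `σ`, given as the list of the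
terms for the binding names of `p` from left to right. -/
inductive TermMatch : Term → Pat → List Term → Prop
  | bind (t : Term) : TermMatch t .bind [t]
  | name (v : Name) : TermMatch (.name v) (.nameMatch v) []
  | comp {s t : Term} {p q : Pat} {σ τ : List Term} :
      TermMatch s p σ → TermMatch t q τ → TermMatch (.comp s t) (.comp p q) (σ ++ τ)

/-- The poly-match of a sequence of terms with a sequence of patterns. -/
inductive PolyMatch : List Term → List Pat → List Term → Prop
  | nil : PolyMatch [] [] []
  | cons {t : Term} {ts : List Term} {p : Pat} {ps : List Pat} {σ τ : List Term} :
      TermMatch t p σ → PolyMatch ts ps τ → PolyMatch (t :: ts) (p :: ps) (σ ++ τ)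

/-- `JoinMatch Os I Ps σ`: the outputs `Os` match the inputs `I` one by one, on equal channels (if
any), `Ps` are the continuations of the outputs (there are none in asynchronous languages), and `σ`
is the union of the substitutions. -/
inductive JoinMatch : List Proc → List Inp → List Proc → List Term → Prop
  | nil : JoinMatch [] [] [] []
  | out {c : Option Term} {d : List Term} {ps : List Pat} {Os : List Proc} {I : List Inp}
      {Ps : List Proc} {σ τ : List Term} :
      PolyMatch d ps σ → JoinMatch Os I Ps τ →
      JoinMatch (.out c d :: Os) (⟨c, ps⟩ :: I) Ps (σ ++ τ)
  | outThen {c : Option Term} {d : List Term} {P : Proc} {ps : List Pat} {Os : List Proc}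
      {I : List Inp} {Ps : List Proc} {σ τ : List Term} :
      PolyMatch d ps σ → JoinMatch Os I Ps τ →
      JoinMatch (.outThen c d P :: Os) (⟨c, ps⟩ :: I) (P :: Ps) (σ ++ τ)

/-- Parallel composition of a list of processes. -/
def parList (Ps : List Proc) : Proc := Ps.foldr .par .nil

/-- The reduction relation of `L`. -/
inductive Red (L : Lang) : Proc → Proc → Prop
  | interact {Os : List Proc} {I : List Inp} {Q : Proc} {Ps : List Proc} {σ : List Term} :
      L.Mem (.par (parList Os) (.join I Q)) → JoinMatch Os I Ps σ →
      Red L (.par (parList Os) (.join I Q)) (.par (parList Ps) (Q.inst σ))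
  | par {P P' : Proc} (Q : Proc) : L.Mem Q → Red L P P' → Red L (.par P Q) (.par P' Q)
  | nu (a : ℕ) {P P' : Proc} : Red L P P' → Red L (.nu a P) (.nu a P')
  | struct {P Q Q' P' : Proc} : StructEq L P Q → Red L Q Q' → StructEq L Q' P' → Red L P P'

/-- The reflexive transitive closure of reduction. -/
def Reds (L : Lang) : Proc → Proc → Prop := Relation.ReflTransGen (Red L)

/-- `P` has an infinite sequence of reductions. -/
def Diverges (L : Lang) (P : Proc) : Prop :=
  ∃ f : ℕ → Proc, f 0 = P ∧ ∀ n, Red L (f n) (f (n + 1))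

/-- `P` reduces in some number of steps to a process that is successful at top level. -/
def Succeeds (L : Lang) (P : Proc) : Prop :=
  ∃ Q R : Proc, Reds L P Q ∧ StructEq L Q (.par R .ok)

/-- `E` may serve as the reference behavioural equivalence of `L`: it is an equivalence relation on
the processes of `L`, it contains structural equivalence, and it is reduction-sensitive (a process
that can reduce is equivalent only to processes that can reduce). -/
structure IsReferenceEquivalence (L : Lang) (E : Proc → Proc → Prop) : Prop where
  refl : ∀ P, L.Mem P → E P P
  symm : ∀ P Q, L.Mem P → L.Mem Q → E P Q → E Q P
  trans : ∀ P Q R, L.Mem P → L.Mem Q → L.Mem R → E P Q → E Q R → E P R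
  of_structEq : ∀ P Q, L.Mem P → L.Mem Q → StructEq L P Q → E P Q
  reduction_sensitive : ∀ P Q, L.Mem P → L.Mem Q → E P Q → (∃ P', Red L P P') → ∃ Q', Red L Q Q'

/-! ## Contexts and operators -/

/-- Contexts with holes numbered by `Fin k`. Binders carry explicit names, which capture the free
names of the processes that are put into the holes. -/
inductive Ctx (k : ℕ) : Type
  | hole (i : Fin k)
  | nil
  | ok
  | out (c : Option Term) (d : List Term)
  | outThen (c : Option Term) (d : List Term) (K : Ctx k)
  /-- `xs` are the binding names of `I`, from left to right -/
  | join (I : List Inp) (xs : List ℕ) (K : Ctx k)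
  | res (a : ℕ) (K : Ctx k)
  | par (K K₂ : Ctx k)
  | ite (s t : Term) (K K₂ : Ctx k)
  | rep (K : Ctx k)

namespace Ctx

variable {k : ℕ}

/-- Put the processes `S` into the holes. -/
def fill (S : Fin k → Proc) : Ctx k → Proc
  | .hole i => S i
  | .nil => .nil
  | .ok => .ok
  | .out c d => .out c d
  | .outThen c d K => .outThen c d (K.fill S)
  | .join I xs K => .join I ((K.fill S).close xs)
  | .res a K => .nu a (K.fill S)
  | .par K K₂ => .par (K.fill S) (K₂.fill S)
  | .ite s t K K₂ => .ite s t (K.fill S) (K₂.fill S)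
  | .rep K => .rep (K.fill S)

/-- The number of occurrences of the hole `i`. -/
def occurrences (i : Fin k) : Ctx k → ℕ
  | .hole j => if i = j then 1 else 0
  | .nil => 0
  | .ok => 0
  | .out _ _ => 0
  | .outThen _ _ K => K.occurrences i
  | .join _ _ K => K.occurrences i
  | .res _ K => K.occurrences i
  | .par K K₂ => K.occurrences i + K₂.occurrences i
  | .ite _ _ K K₂ => K.occurrences i + K₂.occurrences i
  | .rep K => K.occurrences i

/-- All names are written as explicit names, and every input binds as many pairwise distinct names
as it has binding positions. -/
def WellFormed : Ctx k → Prop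
  | .hole _ => True
  | .nil => True
  | .ok => True
  | .out c d => (∀ s ∈ c, s.ClosedAt 0) ∧ ∀ t ∈ d, t.ClosedAt 0
  | .outThen c d K => (∀ s ∈ c, s.ClosedAt 0) ∧ (∀ t ∈ d, t.ClosedAt 0) ∧ K.WellFormed
  | .join I xs K =>
      (∀ i ∈ I, i.ClosedAt 0) ∧ xs.Nodup ∧ xs.length = joinBinders I ∧ K.WellFormed
  | .res _ K => K.WellFormed
  | .par K K₂ => K.WellFormed ∧ K₂.WellFormed
  | .ite s t K K₂ => s.ClosedAt 0 ∧ t.ClosedAt 0 ∧ K.WellFormed ∧ K₂.WellFormed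
  | .rep K => K.WellFormed

/-- A `k`-ary context of `L`: a process of `L` in which `k` occurrences of the null process are
replaced by the `k` holes, each hole occurring exactly once. -/
def IsContextOf (K : Ctx k) (L : Lang) : Prop :=
  K.WellFormed ∧ L.Mem (K.fill fun _ => .nil) ∧ ∀ i, K.occurrences i = 1

end Ctx

/-- The operators of the syntax, each written as the context that applies it to its holes. -/
inductive IsOperator : (k : ℕ) → Ctx k → Prop
  | nil : IsOperator 0 .nil
  | ok : IsOperator 0 .ok
  | out (c : Option Term) (d : List Term) : IsOperator 0 (.out c d)
  | outThen (c : Option Term) (d : List Term) : IsOperator 1 (.outThen c d (.hole 0))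
  | join (I : List Inp) (xs : List ℕ) : IsOperator 1 (.join I xs (.hole 0))
  | res (a : ℕ) : IsOperator 1 (.res a (.hole 0))
  | par : IsOperator 2 (.par (.hole 0) (.hole 1))
  | ite (s t : Term) : IsOperator 2 (.ite s t (.hole 0) (.hole 1))
  | rep : IsOperator 1 (.rep (.hole 0))

/-! ## Valid encodings -/

/-- A translation of processes together with a renaming policy, which maps every name to a tuple of
`k > 0` names. Only the values of the translation at processes of the source language matter. -/
structure Encoding : Type where
  tr : Proc → Proc
  k : ℕ
  k_pos : 0 < k
  policy : ℕ → Fin k → ℕ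

/-- Valid encodings of `L₁` into `L₂`, where `E` is the reference behavioural equivalence of `L₂`. -/
structure Encoding.IsValid (e : Encoding) (L₁ L₂ : Lang) (E : Proc → Proc → Prop) : Prop where
  maps : ∀ S, L₁.Mem S → L₂.Mem (e.tr S)
  compositional : ∀ (k : ℕ) (op : Ctx k), IsOperator k op → op.IsContextOf L₁ → ∀ N : Set ℕ,
    ∃ K : Ctx k, K.IsContextOf L₂ ∧ ∀ S : Fin k → Proc, (∀ i, L₁.Mem (S i)) →
      (⋃ i, (S i).fn) = N → e.tr (op.fill S) = K.fill fun i => e.tr (S i)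
  /-- `σ'` is the substitution that `σ` induces through the renaming policy. -/
  name_invariant : ∀ S, L₁.Mem S → ∀ σ : ℕ → ℕ, {a | σ a ≠ a}.Finite →
    ∃ σ' : ℕ → ℕ, (∀ a i, e.policy (σ a) i = σ' (e.policy a i)) ∧
      (∀ b, (∀ a i, e.policy a i ≠ b) → σ' b = b) ∧
      (Function.Injective σ → e.tr (S.rename σ) = (e.tr S).rename σ') ∧
      (¬ Function.Injective σ → E (e.tr (S.rename σ)) ((e.tr S).rename σ'))
  op_complete : ∀ S S', L₁.Mem S → Reds L₁ S S' → ∃ T, Reds L₂ (e.tr S) T ∧ E T (e.tr S')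
  op_sound : ∀ S T, L₁.Mem S → Reds L₂ (e.tr S) T →
    ∃ S', Reds L₁ S S' ∧ ∃ T', Reds L₂ T T' ∧ E T' (e.tr S')
  divergence_reflecting : ∀ S, L₁.Mem S → Diverges L₂ (e.tr S) → Diverges L₁ S
  success_sensitive : ∀ S, L₁.Mem S → (Succeeds L₁ S ↔ Succeeds L₂ (e.tr S))

end Coord

namespace Coord

/-! ## Substitution: composition, congruence, closedness -/

/-! The index of the language decides everything. Either channels are encodable in the binary
dataspace already, so that the hypothesis fails, or they are not encodable in a dataspace even with
joins, whatever the source.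

Encodings exist when matching is available and there is room for the channel: in polyadic languages
with matching the channel `s` becomes the first datum, and in the monadic intensional ones it is
composed with the datum. The receiver tests it by `⌜s⌝`, which binds nothing, so communications
correspond one to one. A homomorphic translation of prefixes that can be run backwards is a valid
encoding (`PrefixRel.Lawful.isValid_encoding`).

There is no encoding without matching, or with name matching in the monadic case (`Lang.Simple`).
There, whether a dataspace process can move is a matter of counting. An input takes any datum of its
length or one particular name, so a join can fire if and only if, for each length and each name, the
active outputs supply at least as much as the join demands (`Red.fires`, `Fires.exists_red`). Two
facts about a context `K[-,-]` follow. Its supply is an affine function of the supplies of the two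
holes. A join that fires in `K[A,B]` lies in `K` or in one hole, so it survives when the contents of
the other hole are exchanged for something with the same supply.

Now let `A | B` succeed while `A' | B` and `A | B'` are stuck without success, and let the
translations of `A` and `A'`, and of `B` and `B'`, have equal supplies. The last two compositions
have inert translations (`Encoding.IsValid.inert`), whereas that of `A | B` must fire or show
success; by the exchange argument one of the other two would do so too
(`Encoding.IsValid.false_of_similar`).

It remains to find such processes. Without matching only lengths are demanded, and renaming does not
change them: an output and an input on channel `0`, each against its image under the swap of `0` and
`1`, suffice. With monadic name matching, the outputs `0⟨2⟩ | 1⟨3⟩` are compared with `0⟨3⟩ | 1⟨2⟩`,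
and likewise for inputs. The substitutions induced by swapping `0, 1` and by swapping `2, 3` never
both move the same name, so the summed supplies agree (`Encoding.IsValid.supply_add`). A symmetric
arrangement gives both summands the same coefficient in the surrounding contexts
(`Encoding.IsValid.similar_pair`). -/

theorem Term.subst_subst (f g : Name → Term) (t : Term) :
    (t.subst f).subst g = t.subst fun v => (f v).subst g := by
  induction t with
  | name v => rfl
  | comp s t hs ht => simp [Term.subst, hs, ht]

theorem Term.toPat_subst (g : Name → Term) (t : Term) : t.toPat.subst g = (t.subst g).toPat := by
  induction t with
  | name v => rfl
  | comp s t hs ht => simp [Term.toPat, Pat.subst, Term.subst, hs, ht]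

@[simp] theorem Term.binders_toPat (t : Term) : t.toPat.binders = 0 := by
  induction t with
  | name v => rfl
  | comp s t hs ht => simp [Term.toPat, Pat.binders, hs, ht]

theorem Term.toPat_closedAt {n : ℕ} {t : Term} : t.toPat.ClosedAt n ↔ t.ClosedAt n := by
  induction t with
  | name v => rfl
  | comp s t hs ht => simp [Term.toPat, Pat.ClosedAt, Term.ClosedAt, hs, ht]

theorem Term.fn_toPat (t : Term) : t.toPat.fn = t.fn := by
  induction t with
  | name v => rfl
  | comp s t hs ht => simp [Term.toPat, Pat.fn, Term.fn, hs, ht]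

theorem Pat.subst_subst (f g : Name → Term) (p : Pat) :
    (p.subst f).subst g = p.subst fun v => (f v).subst g := by
  induction p with
  | bind => rfl
  | nameMatch v => simp [Pat.subst, Term.toPat_subst]
  | comp p q hp hq => simp [Pat.subst, hp, hq]

@[simp] theorem Pat.binders_subst (f : Name → Term) (p : Pat) :
    (p.subst f).binders = p.binders := by
  induction p with
  | bind => rfl
  | nameMatch v => simp [Pat.subst, Pat.binders]
  | comp p q hp hq => simp [Pat.subst, Pat.binders, hp, hq]

theorem Inp.subst_subst (f g : Name → Term) (i : Inp) :
    (i.subst f).subst g = i.subst fun v => (f v).subst g := by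
  have h1 : (Term.subst g ∘ Term.subst f) = Term.subst fun v => (f v).subst g :=
    funext fun t => Term.subst_subst f g t
  have h2 : (Pat.subst g ∘ Pat.subst f) = Pat.subst fun v => (f v).subst g :=
    funext fun t => Pat.subst_subst f g t
  simp [Inp.subst, h1, h2]

@[simp] theorem Inp.binders_subst (f : Name → Term) (i : Inp) :
    (i.subst f).binders = i.binders := by
  have h : Pat.binders ∘ Pat.subst f = Pat.binders := funext fun p => Pat.binders_subst f p
  simp [Inp.binders, Inp.subst, h]

@[simp] theorem joinBinders_map_subst (f : Name → Term) (I : List Inp) :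
    joinBinders (I.map (Inp.subst f)) = joinBinders I := by
  have h : Inp.binders ∘ Inp.subst f = Inp.binders := funext fun p => Inp.binders_subst f p
  simp [joinBinders, h]

/-- Fusion needs no shifting of indices: the substituted function is told the depth, and
substitution leaves the number of binding positions of every prefix unchanged. -/
theorem Proc.subst_subst (f g : ℕ → Name → Term) (P : Proc) (d : ℕ) :
    (P.subst f d).subst g d = P.subst (fun d v => (f d v).subst (g d)) d := by
  have h1 : ∀ d, (Term.subst (g d) ∘ Term.subst (f d)) = Term.subst fun v => (f d v).subst (g d) :=
    fun d => funext fun t => Term.subst_subst _ _ t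
  have h2 : ∀ d, (Inp.subst (g d) ∘ Inp.subst (f d)) = Inp.subst fun v => (f d v).subst (g d) :=
    fun d => funext fun t => Inp.subst_subst _ _ t
  induction P generalizing d with
  | nil => rfl
  | ok => rfl
  | out c t => simp [Proc.subst, h1]
  | outThen c t P ih => simp [Proc.subst, h1, ih]
  | join I P ih => simp [Proc.subst, h2, ih]
  | res P ih => simp [Proc.subst, ih]
  | par P Q ihP ihQ => simp [Proc.subst, ihP, ihQ]
  | ite s t P Q ihP ihQ => simp [Proc.subst, ihP, ihQ, Term.subst_subst]
  | rep P ih => simp [Proc.subst, ih]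

theorem Term.subst_congr {n : ℕ} {f g : Name → Term} {t : Term} (ht : t.ClosedAt n)
    (h : ∀ v : Name, v.ClosedAt n → v.fn ⊆ t.fn → f v = g v) : t.subst f = t.subst g := by
  induction t with
  | name v => exact h v ht subset_rfl
  | comp s t hs ht' =>
    simp only [Term.subst]
    rw [hs ht.1 fun v hv hf => h v hv (hf.trans Set.subset_union_left),
      ht' ht.2 fun v hv hf => h v hv (hf.trans Set.subset_union_right)]

theorem Pat.subst_congr {n : ℕ} {f g : Name → Term} {p : Pat} (hp : p.ClosedAt n)
    (h : ∀ v : Name, v.ClosedAt n → v.fn ⊆ p.fn → f v = g v) : p.subst f = p.subst g := by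
  induction p with
  | bind => rfl
  | nameMatch v => simp only [Pat.subst, h v hp subset_rfl]
  | comp s t hs ht' =>
    simp only [Pat.subst]
    rw [hs hp.1 fun v hv hf => h v hv (hf.trans Set.subset_union_left),
      ht' hp.2 fun v hv hf => h v hv (hf.trans Set.subset_union_right)]

theorem Inp.subst_congr {n : ℕ} {f g : Name → Term} {i : Inp} (hi : i.ClosedAt n)
    (h : ∀ v : Name, v.ClosedAt n → v.fn ⊆ i.fn → f v = g v) : i.subst f = i.subst g := by
  obtain ⟨c, ps⟩ := i
  simp only [Inp.subst, Inp.mk.injEq]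
  constructor
  · cases c with
    | none => rfl
    | some s =>
      simp only [Option.map_some]
      rw [Term.subst_congr (hi.1 s rfl) fun v hv hf => h v hv (hf.trans ?_)]
      intro x hx
      simp [Inp.fn, hx]
  · refine List.map_congr_left fun p hp => Pat.subst_congr (hi.2 p hp) fun v hv hf => h v hv ?_
    refine hf.trans fun x hx => Or.inr ?_
    simp only [Set.mem_iUnion]
    exact ⟨p, hp, hx⟩

/-- Agreement is asked only at names in scope that can occur, with `m` counting the binders crossed.
This restriction lets freshness of a name be exploited later, in `Proc.close_inst`. -/
theorem Proc.subst_congr {n d : ℕ} {f g : ℕ → Name → Term} {P : Proc} (hP : P.ClosedAt n)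
    (h : ∀ (m : ℕ) (v : Name), v.ClosedAt (n + m) → v.fn ⊆ P.fn → f (d + m) v = g (d + m) v) :
    P.subst f d = P.subst g d := by
  induction P generalizing n d with
  | nil => rfl
  | ok => rfl
  | out c t =>
    simp only [Proc.subst, Proc.out.injEq]
    constructor
    · cases c with
      | none => rfl
      | some s =>
        simp only [Option.map_some]
        refine congrArg some (Term.subst_congr (hP.1 s rfl) fun v hv hf => h 0 v hv (hf.trans ?_))
        intro x hx
        simp [Proc.fn, hx]
    · refine List.map_congr_left fun p hp => Term.subst_congr (hP.2 p hp) fun v hv hf => h 0 v hv ?_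
      refine hf.trans fun x hx => Or.inr ?_
      simp only [Set.mem_iUnion]
      exact ⟨p, hp, hx⟩
  | outThen c t P ih =>
    simp only [Proc.subst, Proc.outThen.injEq]
    refine ⟨?_, ?_, ih hP.2.2 fun m v hv hf => h m v hv (hf.trans Set.subset_union_right)⟩
    · cases c with
      | none => rfl
      | some s =>
        simp only [Option.map_some]
        refine congrArg some (Term.subst_congr (hP.1 s rfl) fun v hv hf => h 0 v hv (hf.trans ?_))
        intro x hx
        simp [Proc.fn, hx]
    · refine List.map_congr_left fun p hp =>
        Term.subst_congr (hP.2.1 p hp) fun v hv hf => h 0 v hv ?_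
      refine hf.trans fun x hx => Or.inl (Or.inr ?_)
      simp only [Set.mem_iUnion]
      exact ⟨p, hp, hx⟩
  | join I P ih =>
    simp only [Proc.subst, Proc.join.injEq]
    constructor
    · refine List.map_congr_left fun i hi => Inp.subst_congr (hP.1 i hi) fun v hv hf => h 0 v hv ?_
      refine hf.trans fun x hx => Or.inl ?_
      simp only [Set.mem_iUnion]
      exact ⟨i, hi, hx⟩
    · refine ih hP.2 fun m v hv hf => ?_
      rw [add_assoc] at hv ⊢
      exact h _ v hv (hf.trans Set.subset_union_right)
  | res P ih =>
    simp only [Proc.subst, Proc.res.injEq]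
    refine ih hP fun m v hv hf => ?_
    rw [add_assoc] at hv ⊢
    exact h _ v hv hf
  | par P Q ihP ihQ =>
    simp only [Proc.subst, Proc.par.injEq]
    exact ⟨ihP hP.1 fun m v hv hf => h m v hv (hf.trans Set.subset_union_left),
      ihQ hP.2 fun m v hv hf => h m v hv (hf.trans Set.subset_union_right)⟩
  | ite s t P Q ihP ihQ =>
    simp only [Proc.subst, Proc.ite.injEq]
    refine ⟨Term.subst_congr hP.1 fun v hv hf => h 0 v hv (hf.trans ?_),
      Term.subst_congr hP.2.1 fun v hv hf => h 0 v hv (hf.trans ?_),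
      ihP hP.2.2.1 fun m v hv hf => h m v hv (hf.trans ?_),
      ihQ hP.2.2.2 fun m v hv hf => h m v hv (hf.trans ?_)⟩ <;>
    · intro x hx
      simp [Proc.fn, hx]
  | rep P ih => simp only [Proc.subst, ih hP h]

theorem Term.subst_name (t : Term) : t.subst .name = t := by
  induction t with
  | name v => rfl
  | comp s t hs ht => simp [Term.subst, hs, ht]

theorem Pat.subst_name (p : Pat) : p.subst .name = p := by
  induction p with
  | bind => rfl
  | nameMatch v => rfl
  | comp s t hs ht => simp [Pat.subst, hs, ht]

theorem Inp.subst_name (i : Inp) : i.subst .name = i := by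
  obtain ⟨c, ps⟩ := i
  have h1 : Term.subst .name = id := funext Term.subst_name
  have h2 : Pat.subst .name = id := funext Pat.subst_name
  simp [Inp.subst, h1, h2]

theorem Proc.subst_name (P : Proc) (d : ℕ) : P.subst (fun _ => .name) d = P := by
  have h1 : Term.subst .name = id := funext Term.subst_name
  have h2 : Inp.subst .name = id := funext Inp.subst_name
  induction P generalizing d <;> simp_all [Proc.subst]

theorem Name.ClosedAt.mono {n m : ℕ} (h : n ≤ m) {v : Name} (hv : v.ClosedAt n) : v.ClosedAt m := by
  cases v with
  | free a => trivial
  | bound i => exact lt_of_lt_of_le hv h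

theorem Term.ClosedAt.mono {n m : ℕ} (h : n ≤ m) {t : Term} (ht : t.ClosedAt n) :
    t.ClosedAt m := by
  induction t with
  | name v => exact Name.ClosedAt.mono h ht
  | comp s t hs ht' => exact ⟨hs ht.1, ht' ht.2⟩

theorem Term.closedAt_subst {n k : ℕ} {f : Name → Term} {t : Term} (ht : t.ClosedAt n)
    (h : ∀ v : Name, v.ClosedAt n → (f v).ClosedAt k) : (t.subst f).ClosedAt k := by
  induction t with
  | name v => exact h v ht
  | comp s t hs ht' => exact ⟨hs ht.1, ht' ht.2⟩

theorem Pat.closedAt_subst {n k : ℕ} {f : Name → Term} {p : Pat} (hp : p.ClosedAt n)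
    (h : ∀ v : Name, v.ClosedAt n → (f v).ClosedAt k) : (p.subst f).ClosedAt k := by
  induction p with
  | bind => trivial
  | nameMatch v => exact Term.toPat_closedAt.2 (h v hp)
  | comp s t hs ht' => exact ⟨hs hp.1, ht' hp.2⟩

theorem Inp.closedAt_subst {n k : ℕ} {f : Name → Term} {i : Inp} (hi : i.ClosedAt n)
    (h : ∀ v : Name, v.ClosedAt n → (f v).ClosedAt k) : (i.subst f).ClosedAt k := by
  constructor
  · intro s hs
    simp only [Inp.subst, Option.mem_def, Option.map_eq_some_iff] at hs
    obtain ⟨s, hs, rfl⟩ := hs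
    exact Term.closedAt_subst (hi.1 s hs) h
  · intro s hs
    simp only [Inp.subst, List.mem_map] at hs
    obtain ⟨s, hs, rfl⟩ := hs
    exact Pat.closedAt_subst (hi.2 s hs) h

theorem chan_closedAt_subst {n k : ℕ} {f : Name → Term} {c : Option Term}
    (hc : ∀ s ∈ c, s.ClosedAt n) (h : ∀ v : Name, v.ClosedAt n → (f v).ClosedAt k) :
    ∀ s ∈ c.map (Term.subst f), s.ClosedAt k := by
  intro s hs
  simp only [Option.mem_def, Option.map_eq_some_iff] at hs
  obtain ⟨s, hs, rfl⟩ := hs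
  exact Term.closedAt_subst (hc s hs) h

theorem data_closedAt_subst {n k : ℕ} {f : Name → Term} {d : List Term}
    (hd : ∀ s ∈ d, s.ClosedAt n) (h : ∀ v : Name, v.ClosedAt n → (f v).ClosedAt k) :
    ∀ s ∈ d.map (Term.subst f), s.ClosedAt k := by
  intro s hs
  simp only [List.mem_map] at hs
  obtain ⟨s, hs, rfl⟩ := hs
  exact Term.closedAt_subst (hd s hs) h

theorem Proc.closedAt_subst {n k d : ℕ} {f : ℕ → Name → Term} {P : Proc} (hP : P.ClosedAt n)
    (h : ∀ (m : ℕ) (v : Name), v.ClosedAt (n + m) → (f (d + m) v).ClosedAt (k + m)) :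
    (P.subst f d).ClosedAt k := by
  have h0 := h 0
  simp only [add_zero] at h0
  induction P generalizing n d k with
  | nil => trivial
  | ok => trivial
  | out c t => exact ⟨chan_closedAt_subst hP.1 h0, data_closedAt_subst hP.2 h0⟩
  | outThen c t P ih =>
    exact ⟨chan_closedAt_subst hP.1 h0, data_closedAt_subst hP.2.1 h0, ih hP.2.2 h h0⟩
  | join I P ih =>
    refine ⟨?_, ?_⟩
    · intro i hi
      simp only [List.mem_map] at hi
      obtain ⟨i, hi, rfl⟩ := hi
      exact Inp.closedAt_subst (hP.1 i hi) h0
    · rw [joinBinders_map_subst]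
      refine ih hP.2 (fun m v hv => ?_) (fun v hv => h _ v hv)
      rw [add_assoc] at hv ⊢
      rw [add_assoc]
      exact h _ v hv
  | res P ih =>
    refine ih (n := n + 1) (k := k + 1) hP (fun m v hv => ?_) (fun v hv => h _ v hv)
    rw [add_assoc] at hv ⊢
    rw [add_assoc]
    exact h _ v hv
  | par P Q ihP ihQ => exact ⟨ihP hP.1 h h0, ihQ hP.2 h h0⟩
  | ite s t P Q ihP ihQ =>
    exact ⟨Term.closedAt_subst hP.1 h0, Term.closedAt_subst hP.2.1 h0, ihP hP.2.2.1 h h0,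
      ihQ hP.2.2.2 h h0⟩
  | rep P ih => exact ih hP h h0

theorem Proc.closedAt_close {P : Proc} (hP : P.ClosedAt 0) (xs : List ℕ) :
    (P.close xs).ClosedAt xs.length := by
  refine Proc.closedAt_subst hP fun m v hv => ?_
  cases v with
  | free a =>
    by_cases ha : a ∈ xs
    · have := List.idxOf_lt_length_of_mem ha
      simp only [ha, if_true, Term.ClosedAt, Name.ClosedAt]
      omega
    · simp [ha, Term.ClosedAt, Name.ClosedAt]
  | bound i =>
    simp only [Name.ClosedAt, Term.ClosedAt] at hv ⊢
    omega

theorem Proc.closedAt_nu {P : Proc} (hP : P.ClosedAt 0) (a : ℕ) : (Proc.nu a P).ClosedAt 0 :=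
  Proc.closedAt_close hP [a]

/-- `Proc.inst` puts its terms below binders without shifting them, so the terms themselves must
have no dangling indices. -/
theorem Proc.closedAt_inst {ts : List Term} {P : Proc} (hP : P.ClosedAt ts.length)
    (hts : ∀ t ∈ ts, t.ClosedAt 0) : (P.inst ts).ClosedAt 0 := by
  refine Proc.closedAt_subst hP fun m v hv => ?_
  cases v with
  | free a => trivial
  | bound i =>
    simp only [Name.ClosedAt, zero_add] at hv ⊢
    by_cases hi : i < m
    · simp [hi, Term.ClosedAt, Name.ClosedAt]
    · have h : i - m < ts.length := by omega
      simp only [hi, if_false, h, List.getElem?_eq_getElem, Option.getD_some]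
      exact Term.ClosedAt.mono (Nat.zero_le _) (hts _ (List.getElem_mem h))

/-! ## Membership in a language -/

theorem Lang.OkTerm.subst {L : Lang} {f : Name → Term} (hf : ∀ v, L.OkTerm (f v)) {t : Term}
    (ht : L.OkTerm t) : L.OkTerm (t.subst f) := by
  cases hm : L.matching with
  | I => simp [Lang.OkTerm, hm]
  | NO | NM =>
    simp only [Lang.OkTerm, hm] at ht
    obtain ⟨v, rfl⟩ := ht
    exact hf v

theorem Lang.OkPat.subst {L : Lang} {f : Name → Term} (hf : ∀ v, L.OkTerm (f v)) {p : Pat}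
    (hp : L.OkPat p) : L.OkPat (p.subst f) := by
  cases hm : L.matching with
  | I => simp [Lang.OkPat, hm]
  | NO =>
    simp only [Lang.OkPat, hm] at hp ⊢
    rw [hp]
    rfl
  | NM =>
    simp only [Lang.OkPat, Lang.OkTerm, hm] at hp hf ⊢
    rcases hp with rfl | ⟨v, rfl⟩
    · exact Or.inl rfl
    · obtain ⟨w, hw⟩ := hf v
      exact Or.inr ⟨w, by rw [Pat.subst, hw, Term.toPat]⟩

theorem Lang.OkChan.subst {L : Lang} {f : Name → Term} (hf : ∀ v, L.OkTerm (f v))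
    {c : Option Term} (hc : L.OkChan c) : L.OkChan (c.map (Term.subst f)) := by
  cases hm : L.medium with
  | D =>
    simp only [Lang.OkChan, hm] at hc ⊢
    simp [hc]
  | C =>
    simp only [Lang.OkChan, hm] at hc ⊢
    obtain ⟨s, rfl, hs⟩ := hc
    exact ⟨_, rfl, hs.subst hf⟩

theorem Lang.OkOut.subst {L : Lang} {f : Name → Term} (hf : ∀ v, L.OkTerm (f v))
    {c : Option Term} {d : List Term} (h : L.OkOut c d) :
    L.OkOut (c.map (Term.subst f)) (d.map (Term.subst f)) := by
  refine ⟨h.1.subst hf, by simpa using h.2.1, fun t ht => ?_⟩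
  simp only [List.mem_map] at ht
  obtain ⟨t, ht, rfl⟩ := ht
  exact (h.2.2 t ht).subst hf

theorem Lang.OkInp.subst {L : Lang} {f : Name → Term} (hf : ∀ v, L.OkTerm (f v))
    {i : Inp} (h : L.OkInp i) : L.OkInp (i.subst f) := by
  refine ⟨h.1.subst hf, by simpa [Inp.subst] using h.2.1, fun t ht => ?_⟩
  simp only [Inp.subst, List.mem_map] at ht
  obtain ⟨t, ht, rfl⟩ := ht
  exact (h.2.2 t ht).subst hf

theorem Lang.OkJoin.subst {L : Lang} {f : Name → Term} (hf : ∀ v, L.OkTerm (f v))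
    {I : List Inp} (h : L.OkJoin I) : L.OkJoin (I.map (Inp.subst f)) := by
  refine ⟨?_, fun t ht => ?_⟩
  · cases hm : L.coord <;> simpa [Lang.OkJoin, hm] using h.1
  · simp only [List.mem_map] at ht
    obtain ⟨t, ht, rfl⟩ := ht
    exact (h.2 t ht).subst hf

theorem Lang.Admits.subst {L : Lang} {f : ℕ → Name → Term} (hf : ∀ d v, L.OkTerm (f d v))
    {P : Proc} (h : L.Admits P) (d : ℕ) : L.Admits (P.subst f d) := by
  induction P generalizing d with
  | nil => trivial
  | ok => trivial
  | out c t => exact ⟨h.1, h.2.subst (hf d)⟩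
  | outThen c t P ih => exact ⟨h.1, h.2.1.subst (hf d), ih h.2.2 d⟩
  | join I P ih => exact ⟨h.1.subst (hf d), ih h.2 _⟩
  | res P ih => exact ih (show L.Admits P from h) _
  | par P Q ihP ihQ => exact ⟨ihP h.1 d, ihQ h.2 d⟩
  | ite s t P Q ihP ihQ => exact ⟨ihP h.1 d, ihQ h.2 d⟩
  | rep P ih => exact ih (show L.Admits P from h) d

theorem Lang.okTerm_name (L : Lang) (v : Name) : L.OkTerm (.name v) := by
  cases hm : L.matching <;> simp [Lang.OkTerm, hm]

theorem Lang.Admits.close {L : Lang} {P : Proc} (h : L.Admits P) (xs : List ℕ) :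
    L.Admits (P.close xs) := by
  refine h.subst (fun d v => ?_) 0
  cases v with
  | free a =>
    by_cases ha : a ∈ xs
    · simp [ha, L.okTerm_name]
    · simpa [ha] using L.okTerm_name _
  | bound i => exact L.okTerm_name _

theorem Lang.Admits.inst {L : Lang} {P : Proc} (h : L.Admits P) {ts : List Term}
    (hts : ∀ t ∈ ts, L.OkTerm t) : L.Admits (P.inst ts) := by
  refine h.subst (fun d v => ?_) 0
  cases v with
  | free a => exact L.okTerm_name _
  | bound i =>
    by_cases hi : i < d
    · simpa [hi] using L.okTerm_name _
    · simp only [hi, if_false]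
      by_cases h : i - d < ts.length
      · simpa [h] using hts _ (List.getElem_mem h)
      · simpa [h] using L.okTerm_name _

theorem Lang.Mem.nu {L : Lang} {P : Proc} (h : L.Mem P) (a : ℕ) : L.Mem (.nu a P) :=
  ⟨Proc.closedAt_nu h.1 a, h.2.close [a]⟩

theorem Lang.mem_nil (L : Lang) : L.Mem .nil := ⟨trivial, trivial⟩

theorem Lang.mem_ok (L : Lang) : L.Mem .ok := ⟨trivial, trivial⟩

theorem Lang.mem_par {L : Lang} {P Q : Proc} : L.Mem (.par P Q) ↔ L.Mem P ∧ L.Mem Q := by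
  simp only [Lang.Mem, Proc.ClosedAt, Lang.Admits]
  tauto

theorem Lang.Mem.par {L : Lang} {P Q : Proc} (hP : L.Mem P) (hQ : L.Mem Q) : L.Mem (.par P Q) :=
  Lang.mem_par.2 ⟨hP, hQ⟩

theorem Lang.mem_parList {L : Lang} {Ps : List Proc} : L.Mem (parList Ps) ↔ ∀ P ∈ Ps, L.Mem P := by
  induction Ps with
  | nil => simpa [parList] using L.mem_nil
  | cons P Ps ih =>
    have : parList (P :: Ps) = .par P (parList Ps) := rfl
    simp [this, Lang.mem_par, ih]

/-! ## Reduction stays inside the language -/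

theorem TermMatch.length_eq {t : Term} {p : Pat} {σ : List Term} (h : TermMatch t p σ) :
    σ.length = p.binders := by
  induction h <;> simp_all [Pat.binders]

theorem TermMatch.closedAt {t : Term} {p : Pat} {σ : List Term} (h : TermMatch t p σ) {n : ℕ}
    (ht : t.ClosedAt n) : ∀ u ∈ σ, u.ClosedAt n := by
  induction h with
  | bind t => simpa using ht
  | name v => simp
  | comp _ _ ih₁ ih₂ =>
    intro u hu
    rcases List.mem_append.1 hu with hu | hu
    · exact ih₁ ht.1 u hu
    · exact ih₂ ht.2 u hu

theorem TermMatch.okTerm {L : Lang} {t : Term} {p : Pat} {σ : List Term} (h : TermMatch t p σ)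
    (ht : L.OkTerm t) : ∀ u ∈ σ, L.OkTerm u := by
  cases hm : L.matching with
  | I => simp [Lang.OkTerm, hm]
  | NO | NM =>
    simp only [Lang.OkTerm, hm] at ht ⊢
    obtain ⟨v, rfl⟩ := ht
    cases h <;> simp

theorem PolyMatch.length_eq {ts : List Term} {ps : List Pat} {σ : List Term}
    (h : PolyMatch ts ps σ) : σ.length = (ps.map Pat.binders).sum := by
  induction h with
  | nil => rfl
  | cons h _ ih => simp [h.length_eq, ih]

theorem PolyMatch.closedAt {ts : List Term} {ps : List Pat} {σ : List Term}
    (h : PolyMatch ts ps σ) {n : ℕ} (ht : ∀ t ∈ ts, t.ClosedAt n) : ∀ u ∈ σ, u.ClosedAt n := by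
  induction h with
  | nil => simp
  | cons h _ ih =>
    intro u hu
    rcases List.mem_append.1 hu with hu | hu
    · exact h.closedAt (ht _ (by simp)) u hu
    · exact ih (fun t h => ht t (by simp [h])) u hu

theorem PolyMatch.okTerm {L : Lang} {ts : List Term} {ps : List Pat} {σ : List Term}
    (h : PolyMatch ts ps σ) (ht : ∀ t ∈ ts, L.OkTerm t) : ∀ u ∈ σ, L.OkTerm u := by
  induction h with
  | nil => simp
  | cons h _ ih =>
    intro u hu
    rcases List.mem_append.1 hu with hu | hu
    · exact h.okTerm (ht _ (by simp)) u hu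
    · exact ih (fun t h => ht t (by simp [h])) u hu

theorem JoinMatch.length_eq {Os : List Proc} {I : List Inp} {Ps : List Proc} {σ : List Term}
    (h : JoinMatch Os I Ps σ) : σ.length = joinBinders I := by
  induction h with
  | nil => rfl
  | out h _ ih => simp_all [joinBinders, Inp.binders, h.length_eq]
  | outThen h _ ih => simp_all [joinBinders, Inp.binders, h.length_eq]

theorem JoinMatch.mem {L : Lang} {Os : List Proc} {I : List Inp} {Ps : List Proc} {σ : List Term}
    (h : JoinMatch Os I Ps σ) (hO : ∀ O ∈ Os, L.Mem O) :
    (∀ P ∈ Ps, L.Mem P) ∧ ∀ u ∈ σ, u.ClosedAt 0 ∧ L.OkTerm u := by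
  induction h with
  | nil => simp
  | out h _ ih =>
    obtain ⟨ih₁, ih₂⟩ := ih fun O h => hO O (by simp [h])
    have hO := hO _ List.mem_cons_self
    refine ⟨ih₁, fun u hu => ?_⟩
    rcases List.mem_append.1 hu with hu | hu
    · exact ⟨h.closedAt hO.1.2 u hu, h.okTerm hO.2.2.2.2 u hu⟩
    · exact ih₂ u hu
  | outThen h _ ih =>
    obtain ⟨ih₁, ih₂⟩ := ih fun O h => hO O (by simp [h])
    have hO := hO _ List.mem_cons_self
    refine ⟨fun P hP => ?_, fun u hu => ?_⟩
    · rcases List.mem_cons.1 hP with rfl | hP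
      · exact ⟨hO.1.2.2, hO.2.2.2⟩
      · exact ih₁ P hP
    · rcases List.mem_append.1 hu with hu | hu
      · exact ⟨h.closedAt hO.1.2.1 u hu, h.okTerm hO.2.2.1.2.2 u hu⟩
      · exact ih₂ u hu

theorem StructEq.mem_iff {L : Lang} {P Q : Proc} (h : StructEq L P Q) : L.Mem P ↔ L.Mem Q := by
  induction h with
  | rel _ _ h => exact ⟨fun _ => h.2.1, fun _ => h.1⟩
  | refl => rfl
  | symm _ _ _ ih => exact ih.symm
  | trans _ _ _ _ _ ih₁ ih₂ => exact ih₁.trans ih₂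

theorem Red.mem {L : Lang} {P P' : Proc} (h : Red L P P') : L.Mem P ∧ L.Mem P' := by
  induction h with
  | interact hm h =>
    refine ⟨hm, ?_⟩
    obtain ⟨hO, hJ⟩ := Lang.mem_par.1 hm
    obtain ⟨h₁, h₂⟩ := h.mem (Lang.mem_parList.1 hO)
    refine Lang.mem_par.2 ⟨Lang.mem_parList.2 h₁, ?_, hJ.2.2.inst fun t ht => (h₂ t ht).2⟩
    refine Proc.closedAt_inst ?_ fun t ht => (h₂ t ht).1
    have := hJ.1.2
    -- The match yields exactly one term per binding position of the join, so instantiation leaves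
    -- no index dangling.
    rwa [zero_add, ← h.length_eq] at this
  | par Q hQ _ ih => exact ⟨ih.1.par hQ, ih.2.par hQ⟩
  | nu a _ ih => exact ⟨ih.1.nu a, ih.2.nu a⟩
  | struct h₁ _ h₂ ih => exact ⟨h₁.mem_iff.2 ih.1, h₂.mem_iff.1 ih.2⟩

theorem Reds.mem {L : Lang} {P P' : Proc} (h : Reds L P P') (hP : L.Mem P) : L.Mem P' := by
  induction h with
  | refl => exact hP
  | tail _ h _ => exact h.mem.2

end Coord

namespace Coord

/-! ## Renamings -/

/-- Weakening of a name below one more binder. -/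
def Name.succ : Name → Name
  | .free a => .free a
  | .bound i => .bound (i + 1)

/-- `r d` is how a renaming acts on names below `d` binding positions. -/
structure IsRenaming (r : ℕ → Name → Name) : Prop where
  zero : ∀ d, r (d + 1) (.bound 0) = .bound 0
  succ : ∀ d v, r (d + 1) v.succ = (r d v).succ

/-- Apply a renaming below `d` binding positions. -/
def Proc.ren (r : ℕ → Name → Name) (d : ℕ) (P : Proc) : Proc :=
  P.subst (fun d v => .name (r d v)) d

/-- Renaming free names and abstracting them are both instances of `IsRenaming`, so that invariance
statements need only one induction for the two. -/
def renameMap (σ : ℕ → ℕ) (_ : ℕ) : Name → Name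
  | .free a => .free (σ a)
  | .bound i => .bound i

def closeMap (xs : List ℕ) (d : ℕ) : Name → Name
  | .free b => if b ∈ xs then .bound (d + xs.idxOf b) else .free b
  | .bound i => .bound i

theorem Proc.rename_eq_ren (σ : ℕ → ℕ) (P : Proc) : P.rename σ = P.ren (renameMap σ) 0 := by
  unfold Proc.rename Proc.ren
  congr 1
  funext d v
  cases v <;> rfl

theorem Proc.close_eq_ren (xs : List ℕ) (P : Proc) : P.close xs = P.ren (closeMap xs) 0 := by
  unfold Proc.close Proc.ren
  congr 1
  funext d v
  cases v with
  | free a => by_cases h : a ∈ xs <;> simp [closeMap, h]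
  | bound i => rfl

theorem isRenaming_renameMap (σ : ℕ → ℕ) : IsRenaming (renameMap σ) :=
  ⟨fun _ => rfl, fun _ v => by cases v <;> rfl⟩

theorem isRenaming_closeMap (xs : List ℕ) : IsRenaming (closeMap xs) := by
  refine ⟨fun _ => rfl, fun d v => ?_⟩
  cases v with
  | free a =>
    by_cases h : a ∈ xs <;> simp [closeMap, Name.succ, h]
    omega
  | bound i => rfl

theorem injOn_renameMap {σ : ℕ → ℕ} (hσ : Function.Injective σ) (d : ℕ) :
    Set.InjOn (renameMap σ d) {v | v.ClosedAt d} := by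
  intro v _ w _ h
  cases v <;> cases w <;> simp_all [renameMap]
  exact hσ h

/-- Abstracted names receive indices from `d` upwards, while the indices already in scope are below
`d`; hence the restriction to names closed at `d`. -/
theorem injOn_closeMap (xs : List ℕ) (d : ℕ) :
    Set.InjOn (closeMap xs d) {v | v.ClosedAt d} := by
  intro v hv w hw h
  cases v with
  | free a =>
    cases w with
    | free b =>
      by_cases ha : a ∈ xs <;> by_cases hb : b ∈ xs <;> simp [closeMap, ha, hb] at h
      · rw [List.idxOf_inj ha] at h
        rw [h]
      · rw [h]
    | bound i =>
      simp only [Set.mem_ofPred_eq, Name.ClosedAt] at hw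
      by_cases ha : a ∈ xs <;> simp [closeMap, ha] at h
      omega
  | bound i =>
    cases w with
    | free b =>
      simp only [Set.mem_ofPred_eq, Name.ClosedAt] at hv
      by_cases ha : b ∈ xs <;> simp [closeMap, ha] at h
      omega
    | bound j => simpa [closeMap] using h

theorem Name.closedAt_succ {d : ℕ} {v : Name} : v.succ.ClosedAt (d + 1) ↔ v.ClosedAt d := by
  cases v <;> simp [Name.succ, Name.ClosedAt]

theorem Name.succ_injective : Function.Injective Name.succ := by
  intro v w h
  cases v <;> cases w <;> simp_all [Name.succ]

theorem Name.eq_zero_or_succ (v : Name) : v = .bound 0 ∨ ∃ w : Name, v = w.succ := by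
  cases v with
  | free a => exact Or.inr ⟨.free a, rfl⟩
  | bound i =>
    cases i with
    | zero => exact Or.inl rfl
    | succ i => exact Or.inr ⟨.bound i, rfl⟩

theorem Name.succ_ne_zero (v : Name) : v.succ ≠ .bound 0 := by
  cases v <;> simp [Name.succ]

theorem IsRenaming.injOn_succ {r : ℕ → Name → Name} (hr : IsRenaming r) {d : ℕ}
    (h : Set.InjOn (r d) {v | v.ClosedAt d}) : Set.InjOn (r (d + 1)) {v | v.ClosedAt (d + 1)} := by
  intro v hv w hw e
  rcases v.eq_zero_or_succ with rfl | ⟨v, rfl⟩ <;> rcases w.eq_zero_or_succ with rfl | ⟨w, rfl⟩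
  · rfl
  · rw [hr.zero, hr.succ] at e
    exact absurd e.symm (Name.succ_ne_zero _)
  · rw [hr.zero, hr.succ] at e
    exact absurd e (Name.succ_ne_zero _)
  · rw [hr.succ, hr.succ] at e
    rw [h (Name.closedAt_succ.1 hv) (Name.closedAt_succ.1 hw) (Name.succ_injective e)]

/-- This is what keeps conditionals unaffected by renaming: an injective renaming neither creates
nor destroys equalities of terms. -/
theorem Term.subst_name_inj {d : ℕ} {r : Name → Name} (hr : Set.InjOn r {v | v.ClosedAt d})
    {s t : Term} (hs : s.ClosedAt d) (ht : t.ClosedAt d) :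
    s.subst (fun v => .name (r v)) = t.subst (fun v => .name (r v)) ↔ s = t := by
  refine ⟨fun h => ?_, fun h => h ▸ rfl⟩
  induction s generalizing t with
  | name v =>
    cases t with
    | name w => exact congrArg Term.name (hr hs ht (by simpa [Term.subst] using h))
    | comp t₁ t₂ => simp [Term.subst] at h
  | comp s₁ s₂ ih₁ ih₂ =>
    cases t with
    | name w => simp [Term.subst] at h
    | comp t₁ t₂ =>
      simp only [Term.subst, Term.comp.injEq] at h
      rw [ih₁ hs.1 ht.1 h.1, ih₂ hs.2 ht.2 h.2]

/-! ## Opening a restriction -/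

/-- A measure for induction. Opening a restriction gives a process that is no longer a subterm, but
whose size is still smaller than that of the restriction. -/
def Proc.size : Proc → ℕ
  | .nil | .ok | .out _ _ => 1
  | .outThen _ _ P | .join _ P | .res P | .rep P => P.size + 1
  | .par P Q | .ite _ _ P Q => P.size + Q.size + 1

@[simp] theorem Proc.size_subst (f : ℕ → Name → Term) (d : ℕ) (P : Proc) :
    (P.subst f d).size = P.size := by
  induction P generalizing d <;> simp_all [Proc.subst, Proc.size]

/-- Since `a` is fresh, closing catches exactly the occurrences that the instantiation has put in.
Every anonymous restriction can thus be read as one of a named fresh name. -/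
theorem Proc.close_inst {P : Proc} (hP : P.ClosedAt 1) {a : ℕ} (ha : a ∉ P.fn) :
    (P.inst [.name (.free a)]).close [a] = P := by
  unfold Proc.close Proc.inst
  rw [Proc.subst_subst]
  conv_rhs => rw [← Proc.subst_name P 0]
  refine Proc.subst_congr hP fun m v hv hf => ?_
  cases v with
  | free b =>
    have : b ≠ a := fun h => ha (hf (by simp [Name.fn, h]))
    simp [Term.subst, this]
  | bound i =>
    by_cases hi : i < m
    · simp [Term.subst, hi]
    · simp only [Name.ClosedAt] at hv
      obtain rfl : i = m := by omega
      simp [Term.subst]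

theorem Term.fn_finite (t : Term) : t.fn.Finite := by
  induction t with
  | name v => cases v <;> simp [Term.fn, Name.fn]
  | comp s t hs ht => exact hs.union ht

theorem Pat.fn_finite (t : Pat) : t.fn.Finite := by
  induction t with
  | bind => simp [Pat.fn]
  | nameMatch v => cases v <;> simp [Pat.fn, Name.fn]
  | comp s t hs ht => exact hs.union ht

theorem finite_fn_chan (c : Option Term) : (⋃ s ∈ c, s.fn).Finite := by
  cases c with
  | none => simp
  | some s => simpa using s.fn_finite

theorem finite_biUnion_list {α : Type*} (l : List α) {f : α → Set ℕ} (hf : ∀ x, (f x).Finite) :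
    (⋃ x ∈ l, f x).Finite :=
  l.finite_toSet.biUnion fun x _ => hf x

theorem Inp.fn_finite (i : Inp) : i.fn.Finite :=
  (finite_fn_chan _).union (finite_biUnion_list _ Pat.fn_finite)

theorem Proc.fn_finite (P : Proc) : P.fn.Finite := by
  induction P with
  | nil | ok => exact Set.finite_empty
  | out c d => exact (finite_fn_chan _).union (finite_biUnion_list _ Term.fn_finite)
  | outThen c d P ih =>
    exact ((finite_fn_chan _).union (finite_biUnion_list _ Term.fn_finite)).union ih
  | join I P ih => exact (finite_biUnion_list _ Inp.fn_finite).union ih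
  | res P ih => exact ih
  | rep P ih => exact ih
  | par P Q ihP ihQ => exact ihP.union ihQ
  | ite s t P Q ihP ihQ => exact ((s.fn_finite.union t.fn_finite).union ihP).union ihQ

/-- A restriction of a process of `L` restricts a fresh name of a process of `L`. -/
theorem Lang.Mem.exists_nu {L : Lang} {P : Proc} (h : L.Mem (.res P)) {F : Set ℕ}
    (hF : F.Finite) : ∃ a P', a ∉ F ∧ .res P = Proc.nu a P' ∧ L.Mem P' ∧ P'.size = P.size := by
  obtain ⟨a, ha⟩ := (hF.union P.fn_finite).exists_notMem
  refine ⟨a, P.inst [.name (.free a)], fun h => ha (Or.inl h), ?_, ⟨?_, ?_⟩, Proc.size_subst _ _ _⟩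
  · rw [Proc.nu, Proc.close_inst h.1 fun h => ha (Or.inr h)]
  · exact Proc.closedAt_inst h.1 (by simp [Term.ClosedAt, Name.ClosedAt])
  · refine Lang.Admits.inst (show L.Admits P from h.2) ?_
    simpa using L.okTerm_name _

/-! ## Structural equivalence as a congruence -/

section

variable {L : Lang} {P P' Q Q' R S : Proc}

theorem StructEq.of_step (hP : L.Mem P) (hQ : L.Mem Q) (h : StructStep P Q) : StructEq L P Q :=
  .rel _ _ ⟨hP, hQ, h⟩

theorem StructEq.refl (L : Lang) (P : Proc) : StructEq L P P := Relation.EqvGen.refl P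

theorem StructEq.symm (h : StructEq L P Q) : StructEq L Q P := Relation.EqvGen.symm _ _ h

theorem StructEq.trans (h : StructEq L P Q) (h' : StructEq L Q R) : StructEq L P R :=
  Relation.EqvGen.trans _ _ _ h h'

/-- The single source of the congruence rules below: an operation that respects membership and
single steps respects the generated equivalence. -/
theorem StructEq.map {L L' : Lang} {P Q : Proc} (F : Proc → Proc)
    (hmem : ∀ P, L.Mem P → L'.Mem (F P))
    (hstep : ∀ P Q, L.Mem P → L.Mem Q → StructStep P Q → StructStep (F P) (F Q))
    (h : StructEq L P Q) : StructEq L' (F P) (F Q) := by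
  induction h with
  | rel P Q h => exact .of_step (hmem _ h.1) (hmem _ h.2.1) (hstep _ _ h.1 h.2.1 h.2.2)
  | refl => exact .refl _ _
  | symm _ _ _ ih => exact ih.symm
  | trans _ _ _ _ _ ih₁ ih₂ => exact ih₁.trans ih₂

theorem StructEq.par_left (h : StructEq L P P') (hQ : L.Mem Q) :
    StructEq L (.par P Q) (.par P' Q) :=
  h.map (fun P => .par P Q) (fun _ h => h.par hQ) fun _ _ _ _ h => .congr_par_left _ h

theorem StructEq.par_right (hQ : L.Mem Q) (h : StructEq L P P') :
    StructEq L (.par Q P) (.par Q P') :=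
  h.map (fun P => .par Q P) (fun _ h => hQ.par h) fun _ _ _ _ h => .congr_par_right _ h

theorem StructEq.par (h : StructEq L P P') (h' : StructEq L Q Q') (hP : L.Mem P) (hQ : L.Mem Q) :
    StructEq L (.par P Q) (.par P' Q') :=
  (h.par_left hQ).trans (h'.par_right (h.mem_iff.1 hP))

theorem StructEq.nu (h : StructEq L P P') (a : ℕ) : StructEq L (.nu a P) (.nu a P') :=
  h.map (Proc.nu a) (fun _ h => h.nu a) fun _ _ hP hQ h => .congr_nu a hP.1 hQ.1 h

theorem StructEq.rep (h : StructEq L P P') : StructEq L (.rep P) (.rep P') :=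
  h.map Proc.rep (fun _ h => h) fun _ _ _ _ h => .congr_rep h

theorem StructEq.par_nil (hP : L.Mem P) : StructEq L (.par P .nil) P :=
  .of_step (hP.par L.mem_nil) hP (.par_nil P)

theorem StructEq.par_comm (hP : L.Mem P) (hQ : L.Mem Q) : StructEq L (.par P Q) (.par Q P) :=
  .of_step (hP.par hQ) (hQ.par hP) (.par_comm P Q)

theorem StructEq.nil_par (hP : L.Mem P) : StructEq L (.par .nil P) P :=
  (StructEq.par_comm L.mem_nil hP).trans (.par_nil hP)

theorem StructEq.par_assoc (hP : L.Mem P) (hQ : L.Mem Q) (hR : L.Mem R) :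
    StructEq L (.par (.par P Q) R) (.par P (.par Q R)) :=
  (StructEq.of_step (hP.par (hQ.par hR)) ((hP.par hQ).par hR) (.par_assoc P Q R)).symm

theorem StructEq.par_left_comm (hP : L.Mem P) (hQ : L.Mem Q) (hR : L.Mem R) :
    StructEq L (.par P (.par Q R)) (.par Q (.par P R)) :=
  ((StructEq.par_assoc hP hQ hR).symm.trans ((StructEq.par_comm hP hQ).par_left hR)).trans
    (.par_assoc hQ hP hR)

theorem StructEq.par_par_par_comm (hP : L.Mem P) (hQ : L.Mem Q) (hR : L.Mem R) (hS : L.Mem S) :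
    StructEq L (.par (.par P Q) (.par R S)) (.par (.par P R) (.par Q S)) :=
  ((StructEq.par_assoc hP hQ (hR.par hS)).trans
    ((StructEq.par_left_comm hQ hR hS).par_right hP)).trans
    (StructEq.par_assoc hP hR (hQ.par hS)).symm

theorem StructEq.ite_eq (s : Term) (h : L.Mem (.ite s s P Q)) : StructEq L (.ite s s P Q) P :=
  .of_step h ⟨h.1.2.2.1, h.2.1⟩ (.ite_eq s P Q)

theorem StructEq.ite_ne {s t : Term} (hst : s ≠ t) (h : L.Mem (.ite s t P Q)) :
    StructEq L (.ite s t P Q) Q :=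
  .of_step h ⟨h.1.2.2.2, h.2.2⟩ (.ite_ne s t P Q hst)

theorem StructEq.rep_unfold (h : L.Mem P) : StructEq L (.rep P) (.par P (.rep P)) :=
  .of_step h (h.par h) (.rep P)

/-- Restriction of a list of names. -/
def nus (as : List ℕ) (P : Proc) : Proc := as.foldr Proc.nu P

theorem Lang.Mem.nus (h : L.Mem P) (as : List ℕ) : L.Mem (nus as P) := by
  induction as with
  | nil => exact h
  | cons a as ih => exact ih.nu a

theorem StructEq.nus (h : StructEq L P Q) (as : List ℕ) :
    StructEq L (nus as P) (nus as Q) := by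
  induction as with
  | nil => exact h
  | cons a as ih => exact ih.nu a

theorem StructEq.par_nus (hP : L.Mem P) (hQ : L.Mem Q) {as : List ℕ} (has : ∀ a ∈ as, a ∉ P.fn) :
    StructEq L (.par P (Coord.nus as Q)) (Coord.nus as (.par P Q)) := by
  induction as with
  | nil => exact .refl _ _
  | cons a as ih =>
    have hQ' := hQ.nus as
    refine StructEq.trans ?_ ((ih fun b hb => has b (by simp [hb])).nu a)
    exact .of_step (hP.par (hQ'.nu a)) ((hP.par hQ').nu a)
      (.par_nu a P _ hP.1 hQ'.1 (has a (by simp)))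

theorem StructEq.nus_par (hP : L.Mem P) (hQ : L.Mem Q) {as : List ℕ} (has : ∀ a ∈ as, a ∉ Q.fn) :
    StructEq L (.par (Coord.nus as P) Q) (Coord.nus as (.par P Q)) :=
  ((StructEq.par_comm (hP.nus as) hQ).trans (.par_nus hQ hP has)).trans
    ((StructEq.par_comm hQ hP).nus as)

theorem nus_append (as bs : List ℕ) (P : Proc) : nus (as ++ bs) P = nus as (nus bs P) := by
  simp [nus]

theorem Red.nus (h : Red L P P') (as : List ℕ) : Red L (nus as P) (nus as P') := by
  induction as with
  | nil => exact h
  | cons a as ih => exact ih.nu a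

theorem Red.of_structEq (h : StructEq L P Q) (h' : Red L Q Q') : Red L P Q' :=
  .struct h h' (.refl _ _)

end

end Coord

namespace Coord

/-! ## Supply and demand

What the active outputs of a process offer to a join, and what a join asks for: only success, the
lengths of the outputs and the single names that they carry matter. -/

inductive Obs : Type
  | ok
  | len (k : ℕ)
  | name (v : Name)

def Obs.succ : Obs → Obs
  | .ok => .ok
  | .len k => .len k
  | .name v => .name v.succ

def Obs.map (r : Name → Name) : Obs → Obs
  | .ok => .ok
  | .len k => .len k
  | .name v => .name (r v)

def Obs.ClosedAt (d : ℕ) : Obs → Prop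
  | .name v => v.ClosedAt d
  | _ => True

open Classical in
/-- What an output of the data `d` offers. -/
noncomputable def outSupply (κ : Obs) (d : List Term) : ℕ∞ :=
  match κ with
  | .ok => 0
  | .len k => if d.length = k then 1 else 0
  | .name v => if d = [.name v] then 1 else 0

open Classical in
/-- The number of active occurrences of the observable `κ`. -/
noncomputable def supply : Obs → Proc → ℕ∞
  | _, .nil => 0
  | .ok, .ok => 1
  | _, .ok => 0
  | κ, .out _ d => outSupply κ d
  | κ, .outThen _ d _ => outSupply κ d
  | _, .join _ _ => 0
  | κ, .res P => supply κ.succ P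
  | κ, .par P Q => supply κ P + supply κ Q
  | κ, .ite s t P Q => if s = t then supply κ P else supply κ Q
  | κ, .rep P => ⊤ * supply κ P

open Classical in
/-- The number of the inputs of a join that need the observable `κ`. -/
noncomputable def demand (κ : Obs) (I : List Inp) : ℕ :=
  match κ with
  | .ok => 0
  | .len k => I.countP fun i => i.pats.length = k
  | .name v => I.countP fun i => i.pats = [.nameMatch v]

/-- The environment `e` below a restriction that offers `x` on the restricted name. -/
def envRes (e : Obs → ℕ∞) (x : ℕ∞) : Obs → ℕ∞
  | .ok => e .ok
  | .len k => e (.len k)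
  | .name (.free a) => e (.name (.free a))
  | .name (.bound 0) => x
  | .name (.bound (i + 1)) => e (.name (.bound i))

@[simp] theorem envRes_succ (e : Obs → ℕ∞) (x : ℕ∞) (κ : Obs) : envRes e x κ.succ = e κ := by
  rcases κ with _ | k | (a | i) <;> rfl

@[simp] theorem envRes_zero (e : Obs → ℕ∞) (x : ℕ∞) : envRes e x (.name (.bound 0)) = x := rfl

theorem Obs.eq_zero_or_succ (κ : Obs) : κ = .name (.bound 0) ∨ ∃ κ' : Obs, κ = κ'.succ := by
  rcases κ with _ | k | (a | _ | i)
  · exact Or.inr ⟨.ok, rfl⟩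
  · exact Or.inr ⟨.len k, rfl⟩
  · exact Or.inr ⟨.name (.free a), rfl⟩
  · exact Or.inl rfl
  · exact Or.inr ⟨.name (.bound i), rfl⟩

theorem Obs.closedAt_succ {d : ℕ} {κ : Obs} : κ.succ.ClosedAt (d + 1) ↔ κ.ClosedAt d := by
  rcases κ with _ | k | v
  · rfl
  · rfl
  · exact Name.closedAt_succ

open Classical in
/-- In an environment with the supply `e`, some active join finds what it needs. -/
def FiresIn : Proc → (Obs → ℕ∞) → Prop
  | .join I _, e => ∀ κ, demand κ I ≤ e κ
  | .res P, e => FiresIn P (envRes e (supply (.name (.bound 0)) P))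
  | .par P Q, e => FiresIn P e ∨ FiresIn Q e
  | .ite s t P Q, e => if s = t then FiresIn P e else FiresIn Q e
  | .rep P, e => FiresIn P e
  | _, _ => False

/-- Some active join finds what it needs among the active outputs. -/
def Fires (P : Proc) : Prop := FiresIn P fun κ => supply κ P

/-! ## Renaming -/

theorem data_subst_eq_singleton {d : ℕ} {r : Name → Name} (hr : Set.InjOn r {v | v.ClosedAt d})
    {ts : List Term} (hts : ∀ t ∈ ts, t.ClosedAt d) {v : Name} (hv : v.ClosedAt d) :
    ts.map (Term.subst fun v => .name (r v)) = [.name (r v)] ↔ ts = [.name v] := by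
  refine ⟨fun h => ?_, fun h => by rw [h]; rfl⟩
  rcases ts with _ | ⟨t, _ | ⟨u, ts⟩⟩
  · simp at h
  · have h' : t.subst (fun v => .name (r v)) = (Term.name v).subst fun v => .name (r v) := by
      simpa [Term.subst] using h
    rw [(Term.subst_name_inj hr (hts t (by simp)) (t := .name v) hv).1 h']
  · simp at h

theorem outSupply_subst {d : ℕ} {r : Name → Name} (hr : Set.InjOn r {v | v.ClosedAt d})
    {ts : List Term} (hts : ∀ t ∈ ts, t.ClosedAt d) {κ : Obs} (hκ : κ.ClosedAt d) :
    outSupply (κ.map r) (ts.map (Term.subst fun v => .name (r v))) = outSupply κ ts := by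
  rcases κ with _ | k | v
  · rfl
  · simp [outSupply, Obs.map]
  · have := data_subst_eq_singleton hr hts (v := v) hκ
    by_cases h : ts = [.name v] <;> simp only [outSupply, Obs.map, h, this, if_true, if_false]
    exact if_pos (this.2 h)

theorem Obs.map_succ {r : ℕ → Name → Name} (hr : IsRenaming r) (d : ℕ) (κ : Obs) :
    κ.succ.map (r (d + 1)) = (κ.map (r d)).succ := by
  rcases κ with _ | k | v
  · rfl
  · rfl
  · simp [Obs.map, Obs.succ, hr.succ]

/-- Injectivity on the names in scope enters twice: distinct data are not identified, and
conditionals take the same branch. -/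
theorem supply_ren {r : ℕ → Name → Name} (hr : IsRenaming r) {d : ℕ}
    (hi : Set.InjOn (r d) {v | v.ClosedAt d}) {P : Proc} (hP : P.ClosedAt d) {κ : Obs}
    (hκ : κ.ClosedAt d) : supply (κ.map (r d)) (P.ren r d) = supply κ P := by
  induction P generalizing d κ with
  | nil => simp [Proc.ren, Proc.subst, supply]
  | ok => rcases κ with _ | k | v <;> simp [Proc.ren, Proc.subst, supply, Obs.map]
  | out c ts => simpa [Proc.ren, Proc.subst, supply] using outSupply_subst hi hP.2 hκ
  | outThen c ts P ih => simpa [Proc.ren, Proc.subst, supply] using outSupply_subst hi hP.2.1 hκ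
  | join I P ih => simp [Proc.ren, Proc.subst, supply]
  | res P ih =>
    have := ih (hr.injOn_succ hi) hP (Obs.closedAt_succ.2 hκ)
    rw [Obs.map_succ hr] at this
    simpa [Proc.ren, Proc.subst, supply] using this
  | par P Q ihP ihQ =>
    simpa [Proc.ren, Proc.subst, supply] using
      congrArg₂ (· + ·) (ihP hi hP.1 hκ) (ihQ hi hP.2 hκ)
  | ite s t P Q ihP ihQ =>
    have hst := Term.subst_name_inj hi hP.1 hP.2.1
    by_cases h : s = t
    · simpa [Proc.ren, Proc.subst, supply, hst, h] using ihP hi hP.2.2.1 hκ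
    · simpa [Proc.ren, Proc.subst, supply, hst, h] using ihQ hi hP.2.2.2 hκ
  | rep P ih => simpa [Proc.ren, Proc.subst, supply] using congrArg (⊤ * ·) (ih hi hP hκ)

/-- Only the names that occur are supplied. -/
theorem name_of_outSupply_ne_zero {d : ℕ} {ts : List Term} (hts : ∀ t ∈ ts, t.ClosedAt d) {v : Name}
    (h : outSupply (.name v) ts ≠ 0) : v.ClosedAt d ∧ v.fn ⊆ ⋃ t ∈ ts, t.fn := by
  have h' : ts = [.name v] := by
    by_contra h'
    simp [outSupply, h'] at h
  subst h'
  exact ⟨hts (.name v) (by simp), by simp [Term.fn]⟩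

theorem name_of_supply_ne_zero {d : ℕ} {P : Proc} (hP : P.ClosedAt d) {v : Name}
    (h : supply (.name v) P ≠ 0) : v.ClosedAt d ∧ v.fn ⊆ P.fn := by
  induction P generalizing d v with
  | nil => simp [supply] at h
  | ok => simp [supply] at h
  | out c ts =>
    obtain ⟨h₁, h₂⟩ := name_of_outSupply_ne_zero hP.2 h
    exact ⟨h₁, h₂.trans fun x hx => Or.inr hx⟩
  | outThen c ts P ih =>
    obtain ⟨h₁, h₂⟩ := name_of_outSupply_ne_zero hP.2.1 h
    exact ⟨h₁, h₂.trans fun x hx => Or.inl (Or.inr hx)⟩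
  | join I P ih => simp [supply] at h
  | res P ih =>
    obtain ⟨h₁, h₂⟩ := ih hP (v := v.succ) h
    refine ⟨Name.closedAt_succ.1 h₁, ?_⟩
    rcases v with a | i <;> exact h₂
  | par P Q ihP ihQ =>
    by_cases h' : supply (.name v) P = 0
    · obtain ⟨h₁, h₂⟩ := ihQ hP.2 (v := v) (by simpa [supply, h'] using h)
      exact ⟨h₁, h₂.trans Set.subset_union_right⟩
    · obtain ⟨h₁, h₂⟩ := ihP hP.1 h'
      exact ⟨h₁, h₂.trans Set.subset_union_left⟩
  | ite s t P Q ihP ihQ =>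
    by_cases h' : s = t
    · obtain ⟨h₁, h₂⟩ := ihP hP.2.2.1 (v := v) (by simpa [supply, h'] using h)
      exact ⟨h₁, h₂.trans fun x hx => Or.inl (Or.inr hx)⟩
    · obtain ⟨h₁, h₂⟩ := ihQ hP.2.2.2 (v := v) (by simpa [supply, h'] using h)
      exact ⟨h₁, h₂.trans fun x hx => Or.inr hx⟩
  | rep P ih =>
    refine ih hP fun h' => h ?_
    simp [supply, h']

theorem name_of_demand_ne_zero {d : ℕ} {I : List Inp} (hI : ∀ i ∈ I, i.ClosedAt d) {v : Name}
    (h : demand (.name v) I ≠ 0) : v.ClosedAt d ∧ v.fn ⊆ ⋃ i ∈ I, i.fn := by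
  obtain ⟨i, hi, hv⟩ := List.countP_pos_iff.1 (Nat.pos_of_ne_zero h)
  simp only [decide_eq_true_eq] at hv
  refine ⟨(hI i hi).2 (.nameMatch v) (by simp [hv]), fun x hx => ?_⟩
  simp only [Set.mem_iUnion]
  exact ⟨i, hi, Or.inr (by simpa [hv, Pat.fn] using hx)⟩

theorem Lang.OkJoin.demand_name {L : Lang} (hL : L.matching = .NO) {I : List Inp}
    (hI : L.OkJoin I) (v : Name) : demand (.name v) I = 0 := by
  refine List.countP_eq_zero.2 fun i hi => ?_
  simp only [decide_eq_true_eq]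
  intro hv
  have := (hI.2 i hi).2.2 (.nameMatch v) (by simp [hv])
  simp [Lang.OkPat, hL] at this

/-- The observables that may matter to the joins in a process with the free names `F`, where `m`
means that names matter at all. -/
def Obs.Relevant (m : Prop) (F : Set ℕ) (d : ℕ) : Obs → Prop
  | .ok => False
  | .len _ => True
  | .name v => m ∧ v.ClosedAt d ∧ v.fn ⊆ F

/-- The environment is only ever compared with the demand of an active join, and this demand
vanishes off the relevant observables. Names need no attention at all when the language has no
matching; otherwise only names in scope that occur do. -/
theorem FiresIn.mono {L : Lang} {m : Prop} {d : ℕ} {P : Proc} (hP : P.ClosedAt d)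
    (hL : m ∨ L.matching = .NO ∧ L.Admits P)
    {e e' : Obs → ℕ∞} (he : ∀ κ, κ.Relevant m P.fn d → e κ ≤ e' κ) (h : FiresIn P e) :
    FiresIn P e' := by
  induction P generalizing d e e' with
  | nil => exact h
  | ok => exact h
  | out c ts => exact h
  | outThen c ts P ih => exact h
  | join I P ih =>
    intro κ
    by_cases h0 : demand κ I = 0
    · simp [h0]
    · refine (h κ).trans (he κ ?_)
      rcases κ with _ | k | v
      · simp [demand] at h0
      · trivial
      · refine ⟨hL.resolve_right fun hm => h0 (hm.2.1.demand_name hm.1 v), ?_⟩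
        obtain ⟨h₁, h₂⟩ := name_of_demand_ne_zero hP.1 h0
        exact ⟨h₁, h₂.trans Set.subset_union_left⟩
  | res P ih =>
    refine ih (show P.ClosedAt (d + 1) from hP) hL (fun κ hκ => ?_) h
    rcases κ.eq_zero_or_succ with rfl | ⟨κ, rfl⟩
    · simp
    · rw [envRes_succ, envRes_succ]
      refine he κ ?_
      rcases κ with _ | k | v
      · exact hκ
      · trivial
      · refine ⟨hκ.1, Name.closedAt_succ.1 hκ.2.1, ?_⟩
        have := hκ.2.2
        rcases v with a | i <;> exact this
  | par P Q ihP ihQ =>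
    refine h.imp (fun h => ihP hP.1 (hL.imp_right fun h => ⟨h.1, h.2.1⟩) (fun κ hκ => he κ ?_) h)
      (fun h => ihQ hP.2 (hL.imp_right fun h => ⟨h.1, h.2.2⟩) (fun κ hκ => he κ ?_) h) <;>
    rcases κ with _ | k | v
    · exact hκ
    · trivial
    · exact ⟨hκ.1, hκ.2.1, hκ.2.2.trans Set.subset_union_left⟩
    · exact hκ
    · trivial
    · exact ⟨hκ.1, hκ.2.1, hκ.2.2.trans Set.subset_union_right⟩
  | ite s t P Q ihP ihQ =>
    by_cases hst : s = t
    · simp only [FiresIn, hst, if_true] at h ⊢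
      refine ihP hP.2.2.1 (hL.imp_right fun h => ⟨h.1, h.2.1⟩) (fun κ hκ => he κ ?_) h
      rcases κ with _ | k | v
      · exact hκ
      · trivial
      · exact ⟨hκ.1, hκ.2.1, hκ.2.2.trans fun x hx => Or.inl (Or.inr hx)⟩
    · simp only [FiresIn, hst, if_false] at h ⊢
      refine ihQ hP.2.2.2 (hL.imp_right fun h => ⟨h.1, h.2.2⟩) (fun κ hκ => he κ ?_) h
      rcases κ with _ | k | v
      · exact hκ
      · trivial
      · exact ⟨hκ.1, hκ.2.1, hκ.2.2.trans Set.subset_union_right⟩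
  | rep P ih => exact ih (show P.ClosedAt d from hP) hL he h

open Classical in
theorem demand_subst {d : ℕ} {r : Name → Name} (hr : Set.InjOn r {v | v.ClosedAt d})
    {I : List Inp} (hI : ∀ i ∈ I, i.ClosedAt d) {κ : Obs} (hκ : κ.ClosedAt d) :
    demand (κ.map r) (I.map (Inp.subst fun v => .name (r v))) = demand κ I := by
  rcases κ with _ | k | v
  · rfl
  · simp [demand, Obs.map, List.countP_map, Function.comp_def, Inp.subst]
  · simp only [demand, Obs.map, List.countP_map]
    refine List.countP_congr fun i hi => ?_
    have hi := (hI i hi).2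
    obtain ⟨c, ps⟩ := i
    simp only [Function.comp, Inp.subst, decide_eq_true_eq]
    refine ⟨fun h => ?_, fun h => by subst h; simp [Pat.subst, Term.toPat]⟩
    rcases ps with _ | ⟨p, _ | ⟨q, ps⟩⟩
    · simp at h
    · rcases p with _ | w | _
      · simp [Pat.subst] at h
      · replace h := of_decide_eq_true h
        simp only [List.map_cons, Pat.subst, Term.toPat, List.map_nil, List.cons.injEq,
          Pat.nameMatch.injEq, and_true] at h
        rw [hr (hi (.nameMatch w) (by simp)) hκ h]
      · simp [Pat.subst] at h
    · simp at h

open Classical in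
theorem demand_subst_ne_zero {r : Name → Name} {I : List Inp} {κ : Obs}
    (h : demand κ (I.map (Inp.subst fun v => .name (r v))) ≠ 0) :
    ∃ κ' : Obs, κ = κ'.map r ∧ demand κ' I ≠ 0 := by
  rcases κ with _ | k | v
  · simp [demand] at h
  · refine ⟨.len k, rfl, ?_⟩
    simpa [demand, List.countP_map, Function.comp_def, Inp.subst] using h
  · obtain ⟨i, hi, hv⟩ := List.countP_pos_iff.1 (Nat.pos_of_ne_zero h)
    simp only [List.mem_map] at hi
    obtain ⟨⟨c, ps⟩, hi, rfl⟩ := hi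
    simp only [Inp.subst] at hv
    rcases ps with _ | ⟨p, _ | ⟨q, ps⟩⟩
    · simp at hv
    · rcases p with _ | w | _
      · simp [Pat.subst] at hv
      · replace hv := of_decide_eq_true hv
        simp only [List.map_cons, Pat.subst, Term.toPat, List.map_nil, List.cons.injEq,
          Pat.nameMatch.injEq, and_true] at hv
        refine ⟨.name w, by rw [← hv]; rfl, ?_⟩
        exact (List.countP_pos_iff.2 ⟨_, hi, by simp⟩).ne'
      · simp [Pat.subst] at hv
    · simp at hv

/-- Demands are transported along with the names. Outside the image of `r` a renamed join demands
nothing, so it does not matter what the environment offers there. -/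
theorem firesIn_ren {r : ℕ → Name → Name} (hr : IsRenaming r) {d : ℕ}
    (hi : Set.InjOn (r d) {v | v.ClosedAt d}) {P : Proc} (hP : P.ClosedAt d) {e : Obs → ℕ∞} :
    FiresIn (P.ren r d) e ↔ FiresIn P fun κ => e (κ.map (r d)) := by
  induction P generalizing d e with
  | nil | ok | out | outThen => rfl
  | join I P ih =>
    change (∀ κ, (demand κ (I.map (Inp.subst fun v => .name (r d v))) : ℕ∞) ≤ e κ) ↔
      ∀ κ, (demand κ I : ℕ∞) ≤ e (κ.map (r d))
    have hcl : ∀ κ : Obs, demand κ I ≠ 0 → κ.ClosedAt d := by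
      intro κ hκ
      rcases κ with _ | k | v
      · trivial
      · trivial
      · exact (name_of_demand_ne_zero hP.1 hκ).1
    constructor
    · intro h κ
      by_cases h0 : demand κ I = 0
      · simp [h0]
      · rw [← demand_subst hi hP.1 (hcl κ h0)]
        exact h _
    · intro h κ
      by_cases h0 : demand κ (I.map (Inp.subst fun v => .name (r d v))) = 0
      · simp [h0]
      · obtain ⟨κ, rfl, h1⟩ := demand_subst_ne_zero h0
        rw [demand_subst hi hP.1 (hcl κ h1)]
        exact h κ
  | res P ih =>
    have hs := supply_ren hr (hr.injOn_succ hi) (show P.ClosedAt (d + 1) from hP)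
      (κ := .name (.bound 0)) (Nat.succ_pos d)
    rw [show Obs.map (r (d + 1)) (.name (.bound 0)) = .name (.bound 0) by
      simp [Obs.map, hr.zero]] at hs
    change FiresIn (P.ren r (d + 1)) (envRes e (supply (.name (.bound 0)) (P.ren r (d + 1)))) ↔
      FiresIn P (envRes (fun κ => e (κ.map (r d))) (supply (.name (.bound 0)) P))
    rw [ih (hr.injOn_succ hi) hP, hs]
    apply iff_of_eq
    congr 1
    funext κ
    rcases κ.eq_zero_or_succ with rfl | ⟨κ, rfl⟩
    · simp [Obs.map, hr.zero]
    · rw [Obs.map_succ hr, envRes_succ, envRes_succ]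
  | par P Q ihP ihQ => exact or_congr (ihP hi hP.1) (ihQ hi hP.2)
  | ite s t P Q ihP ihQ =>
    have hst := Term.subst_name_inj hi hP.1 hP.2.1
    have ihP := ihP hi hP.2.2.1 (e := e)
    have ihQ := ihQ hi hP.2.2.2 (e := e)
    by_cases h : s = t
    · simpa only [Proc.ren, Proc.subst, FiresIn, if_pos (hst.2 h), if_pos h] using ihP
    · simpa only [Proc.ren, Proc.subst, FiresIn, if_neg (mt hst.1 h), if_neg h] using ihQ
  | rep P ih => exact ih hi (show P.ClosedAt d from hP)

/-! ## Restriction of a free name -/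

/-- The environment `e` with the offer `x` on the free name `a`. -/
def envSet (e : Obs → ℕ∞) (a : ℕ) (x : ℕ∞) : Obs → ℕ∞
  | .ok => e .ok
  | .len k => e (.len k)
  | .name (.free b) => if b = a then x else e (.name (.free b))
  | .name (.bound i) => e (.name (.bound i))

theorem supply_nu_ok {P : Proc} (hP : P.ClosedAt 0) (a : ℕ) :
    supply .ok (.nu a P) = supply .ok P := by
  have := supply_ren (isRenaming_closeMap [a]) (injOn_closeMap [a] 0) hP (κ := .ok) trivial
  rwa [← Proc.close_eq_ren] at this

theorem supply_nu_len {P : Proc} (hP : P.ClosedAt 0) (a k : ℕ) :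
    supply (.len k) (.nu a P) = supply (.len k) P := by
  have := supply_ren (isRenaming_closeMap [a]) (injOn_closeMap [a] 0) hP (κ := .len k) trivial
  rwa [← Proc.close_eq_ren] at this

theorem closeMap_singleton_self (a d : ℕ) : closeMap [a] d (.free a) = .bound d := by
  simp [closeMap]

theorem closeMap_singleton_ne {a b : ℕ} (h : b ≠ a) (d : ℕ) :
    closeMap [a] d (.free b) = .free b := by
  simp [closeMap, h]

theorem supply_close_zero {P : Proc} (hP : P.ClosedAt 0) (a : ℕ) :
    supply (.name (.bound 0)) (P.close [a]) = supply (.name (.free a)) P := by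
  have := supply_ren (isRenaming_closeMap [a]) (injOn_closeMap [a] 0) hP
    (κ := .name (.free a)) trivial
  rwa [← Proc.close_eq_ren, Obs.map, closeMap_singleton_self] at this

theorem Term.notMem_fn_subst {a : ℕ} {f : Name → Term} (hf : ∀ v, a ∉ (f v).fn) (t : Term) :
    a ∉ (t.subst f).fn := by
  induction t with
  | name v => exact hf v
  | comp s t hs ht => exact fun h => h.elim hs ht

theorem Pat.notMem_fn_subst {a : ℕ} {f : Name → Term} (hf : ∀ v, a ∉ (f v).fn) (p : Pat) :
    a ∉ (p.subst f).fn := by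
  induction p with
  | bind => simp [Pat.subst, Pat.fn]
  | nameMatch v => simpa [Pat.subst, Term.fn_toPat] using hf v
  | comp s t hs ht => exact fun h => h.elim hs ht

theorem notMem_fn_chan_subst {a : ℕ} {f : Name → Term} (hf : ∀ v, a ∉ (f v).fn)
    (c : Option Term) : a ∉ ⋃ s ∈ c.map (Term.subst f), s.fn := by
  cases c with
  | none => simp
  | some s => simpa using Term.notMem_fn_subst hf s

theorem notMem_fn_data_subst {a : ℕ} {f : Name → Term} (hf : ∀ v, a ∉ (f v).fn)
    (d : List Term) : a ∉ ⋃ s ∈ d.map (Term.subst f), s.fn := by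
  simpa using fun t _ => Term.notMem_fn_subst hf t

theorem Inp.notMem_fn_subst {a : ℕ} {f : Name → Term} (hf : ∀ v, a ∉ (f v).fn) (i : Inp) :
    a ∉ (i.subst f).fn := by
  refine fun h => h.elim (notMem_fn_chan_subst hf i.chan) ?_
  simpa [Inp.subst] using fun t _ => Pat.notMem_fn_subst hf t

theorem Proc.notMem_fn_subst {a : ℕ} {f : ℕ → Name → Term} (hf : ∀ d v, a ∉ (f d v).fn)
    (P : Proc) (d : ℕ) : a ∉ (P.subst f d).fn := by
  induction P generalizing d with
  | nil | ok => exact id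
  | out c t =>
    exact fun h => h.elim (notMem_fn_chan_subst (hf d) c) (notMem_fn_data_subst (hf d) t)
  | outThen c t P ih =>
    exact fun h => h.elim (fun h => h.elim (notMem_fn_chan_subst (hf d) c)
      (notMem_fn_data_subst (hf d) t)) (ih d)
  | join I P ih =>
    refine fun h => h.elim ?_ (ih _)
    simpa using fun i _ => Inp.notMem_fn_subst (hf d) i
  | res P ih => exact ih _
  | par P Q ihP ihQ => exact fun h => h.elim (ihP d) (ihQ d)
  | ite s t P Q ihP ihQ =>
    rintro (((h | h) | h) | h)
    · exact Term.notMem_fn_subst (hf d) s h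
    · exact Term.notMem_fn_subst (hf d) t h
    · exact ihP d h
    · exact ihQ d h
  | rep P ih => exact ih _

theorem Proc.notMem_fn_nu (a : ℕ) (P : Proc) : a ∉ (Proc.nu a P).fn := by
  refine Proc.notMem_fn_subst (fun d v => ?_) P 0
  cases v with
  | free b => by_cases h : b = a <;> simp [Term.fn, Name.fn, h, Ne.symm]
  | bound i => simp [Term.fn, Name.fn]

theorem supply_nu {P : Proc} (hP : P.ClosedAt 0) (a b : ℕ) :
    supply (.name (.free b)) (.nu a P) = if b = a then 0 else supply (.name (.free b)) P := by
  by_cases h : b = a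
  · subst h
    rw [if_pos rfl]
    by_contra h0
    have := (name_of_supply_ne_zero (Proc.closedAt_nu hP b) h0).2
    exact Proc.notMem_fn_nu b P (this (by simp [Name.fn]))
  · have := supply_ren (isRenaming_closeMap [a]) (injOn_closeMap [a] 0) hP
      (κ := .name (.free b)) trivial
    rw [← Proc.close_eq_ren, Obs.map, closeMap_singleton_ne h] at this
    rwa [if_neg h]

/-- A restricted name can be served from inside `P` only, everything else by the environment;
opening the binder moves the private slot from index `0` to the free name `a`. -/
theorem firesIn_nu {P : Proc} (hP : P.ClosedAt 0) (a : ℕ) (e : Obs → ℕ∞) :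
    FiresIn (.nu a P) e ↔ FiresIn P (envSet e a (supply (.name (.free a)) P)) := by
  change FiresIn (P.close [a]) (envRes e (supply (.name (.bound 0)) (P.close [a]))) ↔ _
  rw [supply_close_zero hP, Proc.close_eq_ren,
    firesIn_ren (isRenaming_closeMap [a]) (injOn_closeMap [a] 0) hP]
  have key : ∀ κ : Obs, κ.ClosedAt 0 →
      envRes e (supply (.name (.free a)) P) (κ.map (closeMap [a] 0)) =
        envSet e a (supply (.name (.free a)) P) κ := by
    intro κ hκ
    rcases κ with _ | k | (b | i)
    · rfl
    · rfl
    · by_cases h : b = a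
      · subst h
        simp [Obs.map, closeMap_singleton_self, envSet]
      · simp [Obs.map, closeMap_singleton_ne h, envSet, h, envRes]
    · exact absurd hκ (Nat.not_lt_zero i)
  have hcl : ∀ κ : Obs, κ.Relevant True P.fn 0 → κ.ClosedAt 0 := by
    intro κ hκ
    rcases κ with _ | k | v
    · exact hκ.elim
    · trivial
    · exact hκ.2.1
  -- Names are declared relevant here, so the language plays no role and an arbitrary one is named.
  exact ⟨FiresIn.mono (L := ⟨.A, .M, .D, .NO, .B⟩) hP (.inl trivial) fun κ hκ => (key κ (hcl κ hκ)).le,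
    FiresIn.mono (L := ⟨.A, .M, .D, .NO, .B⟩) hP (.inl trivial) fun κ hκ => (key κ (hcl κ hκ)).ge⟩

end Coord

namespace Coord

/-! ## Supply and demand under structural equivalence -/

theorem supply_nu_congr {P Q : Proc} (hP : P.ClosedAt 0) (hQ : Q.ClosedAt 0)
    (h : ∀ κ : Obs, κ.ClosedAt 0 → supply κ P = supply κ Q) (a : ℕ) {κ : Obs}
    (hκ : κ.ClosedAt 0) : supply κ (.nu a P) = supply κ (.nu a Q) := by
  rcases κ with _ | k | (b | i)
  · rw [supply_nu_ok hP, supply_nu_ok hQ, h _ hκ]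
  · rw [supply_nu_len hP, supply_nu_len hQ, h _ hκ]
  · rw [supply_nu hP, supply_nu hQ, h _ hκ]
  · exact absurd hκ (Nat.not_lt_zero i)

theorem StructStep.supply_eq {P Q : Proc} (h : StructStep P Q) :
    ∀ κ : Obs, κ.ClosedAt 0 → supply κ P = supply κ Q := by
  induction h with
  | par_nil P => intro κ _; simp [supply]
  | par_comm P Q => intro κ _; simp [supply, add_comm]
  | par_assoc P Q R => intro κ _; simp [supply, add_assoc]
  | ite_eq s P Q => intro κ _; simp [supply]
  | ite_ne s t P Q h => intro κ _; simp [supply, h]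
  | nu_nil a => intro κ _; simp [supply, Proc.nu, Proc.close, Proc.subst]
  | nu_comm a b P hP =>
    have ha := Proc.closedAt_nu hP a
    have hb := Proc.closedAt_nu hP b
    intro κ hκ
    rcases κ with _ | k | (c | i)
    · simp only [supply_nu_ok, hP, ha, hb]
    · simp only [supply_nu_len, hP, ha, hb]
    · simp only [supply_nu, hP, ha, hb]
      split_ifs <;> rfl
    · exact absurd hκ (Nat.not_lt_zero i)
  | par_nu a P Q hP hQ ha =>
    have hPQ : (Proc.par P Q).ClosedAt 0 := ⟨hP, hQ⟩
    intro κ hκ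
    rcases κ with _ | k | (c | i)
    · simp only [supply_nu_ok, supply, hQ, hPQ]
    · simp only [supply_nu_len, supply, hQ, hPQ]
    · simp only [supply_nu, supply, hQ, hPQ]
      -- On the right the restricted name is hidden; on the left `P` does not offer it either,
      -- because it is not free in `P`.
      by_cases h : c = a
      · subst h
        by_contra h0
        refine ha ((name_of_supply_ne_zero (v := .free c) hP fun h => h0 ?_).2 (by simp [Name.fn]))
        simp [h]
      · simp [h]
    · exact absurd hκ (Nat.not_lt_zero i)
  | rep P =>
    intro κ _
    simp only [supply]
    -- One unfolded copy is absorbed, since `1 + ⊤ = ⊤`; this is the reason for counting in `ℕ∞`.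
    rw [← one_add_mul, add_top]
  | congr_par_left Q _ ih => intro κ hκ; simp [supply, ih κ hκ]
  | congr_par_right P _ ih => intro κ hκ; simp [supply, ih κ hκ]
  | congr_nu a hP hQ _ ih => exact fun κ hκ => supply_nu_congr hP hQ ih a hκ
  | congr_rep _ ih => intro κ hκ; simp [supply, ih κ hκ]
  | congr_ite_left s t Q _ ih => intro κ hκ; simp [supply, ih κ hκ]
  | congr_ite_right s t P _ ih => intro κ hκ; simp [supply, ih κ hκ]
  | congr_outThen c d _ _ => intro κ hκ; rcases κ with _ | k | v <;> rfl

theorem StructEq.supply_eq {L : Lang} {P Q : Proc} (h : StructEq L P Q) {κ : Obs}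
    (hκ : κ.ClosedAt 0) : supply κ P = supply κ Q := by
  induction h with
  | rel _ _ h => exact h.2.2.supply_eq κ hκ
  | refl => rfl
  | symm _ _ _ ih => exact ih.symm
  | trans _ _ _ _ _ ih₁ ih₂ => exact ih₁.trans ih₂

/-- An environment matters only on the observables without dangling names, and, when names in
patterns are absent, not on names. -/
theorem FiresIn.mono_closed {P : Proc} (hP : P.ClosedAt 0) {e e' : Obs → ℕ∞}
    (he : ∀ κ : Obs, κ.ClosedAt 0 → e κ ≤ e' κ) (h : FiresIn P e) : FiresIn P e' := by
  refine FiresIn.mono (L := ⟨.A, .M, .D, .NO, .B⟩) (m := True) hP (.inl trivial) (fun κ hκ => ?_) h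
  rcases κ with _ | k | v
  · exact he _ trivial
  · exact he _ trivial
  · exact he _ hκ.2.1

theorem envSet_comm {e : Obs → ℕ∞} {a b : ℕ} (h : a ≠ b) (x y : ℕ∞) :
    envSet (envSet e a x) b y = envSet (envSet e b y) a x := by
  funext κ
  rcases κ with _ | k | (c | i) <;> simp only [envSet]
  split_ifs <;> simp_all

theorem firesIn_envSet {P : Proc} (hP : P.ClosedAt 0) {a : ℕ} (ha : a ∉ P.fn) (e : Obs → ℕ∞)
    (x : ℕ∞) : FiresIn P (envSet e a x) ↔ FiresIn P e := by
  have key : ∀ κ : Obs, κ.Relevant True P.fn 0 → envSet e a x κ = e κ := by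
    intro κ hκ
    rcases κ with _ | k | (b | i)
    · rfl
    · rfl
    · have : b ≠ a := fun h => ha (hκ.2.2 (by simp [Name.fn, h]))
      simp [envSet, this]
    · rfl
  exact ⟨FiresIn.mono (L := ⟨.A, .M, .D, .NO, .B⟩) hP (.inl trivial) fun κ hκ => (key κ hκ).le,
    FiresIn.mono (L := ⟨.A, .M, .D, .NO, .B⟩) hP (.inl trivial) fun κ hκ => (key κ hκ).ge⟩

/-- The environment is held fixed on both sides but is arbitrary, because a restriction alters it on
the way down. -/
theorem StructStep.firesIn_iff {P Q : Proc} (h : StructStep P Q) :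
    ∀ e, FiresIn P e ↔ FiresIn Q e := by
  induction h with
  | par_nil P => intro e; simp [FiresIn]
  | par_comm P Q => intro e; simp [FiresIn, or_comm]
  | par_assoc P Q R => intro e; simp [FiresIn, or_assoc]
  | ite_eq s P Q => intro e; simp [FiresIn]
  | ite_ne s t P Q h => intro e; simp [FiresIn, h]
  | nu_nil a => intro e; simp [FiresIn, Proc.nu, Proc.close, Proc.subst]
  | nu_comm a b P hP =>
    intro e
    by_cases hab : a = b
    · rw [hab]
    · have ha := Proc.closedAt_nu hP a
      have hb := Proc.closedAt_nu hP b
      simp only [firesIn_nu, supply_nu, hP, ha, hb, hab, Ne.symm hab, if_false]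
      rw [envSet_comm hab]
  | par_nu a P Q hP hQ ha =>
    intro e
    have hPQ : (Proc.par P Q).ClosedAt 0 := ⟨hP, hQ⟩
    have h0 : supply (.name (.free a)) P = 0 := by
      by_contra h0
      exact ha ((name_of_supply_ne_zero hP h0).2 (by simp [Name.fn]))
    rw [firesIn_nu hPQ]
    simp only [FiresIn, supply, h0, zero_add]
    rw [firesIn_nu hQ, firesIn_envSet hP ha]
  | rep P => intro e; simp [FiresIn]
  | congr_par_left Q _ ih => intro e; simp [FiresIn, ih e]
  | congr_par_right P _ ih => intro e; simp [FiresIn, ih e]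
  | congr_nu a hP hQ h ih =>
    intro e
    rw [firesIn_nu hP, firesIn_nu hQ, ih, h.supply_eq (.name (.free a)) trivial]
  | congr_rep _ ih => intro e; simp [FiresIn, ih e]
  | congr_ite_left s t Q _ ih => intro e; simp [FiresIn, ih e]
  | congr_ite_right s t P _ ih => intro e; simp [FiresIn, ih e]
  | congr_outThen c d _ _ => intro e; rfl

/-- In `Fires` a process occurs both as the seeker and as its own environment; one invariance result
handles each role. -/
theorem StructEq.fires_iff {L : Lang} {P Q : Proc} (h : StructEq L P Q) : Fires P ↔ Fires Q := by
  induction h with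
  | rel P Q h =>
    have hs := h.2.2.supply_eq
    exact ⟨fun h' => FiresIn.mono_closed h.2.1.1 (fun κ hκ => (hs κ hκ).le)
        ((h.2.2.firesIn_iff _).1 h'),
      fun h' => FiresIn.mono_closed h.1.1 (fun κ hκ => (hs κ hκ).ge) ((h.2.2.firesIn_iff _).2 h')⟩
  | refl => rfl
  | symm _ _ _ ih => exact ih.symm
  | trans _ _ _ _ _ ih₁ ih₂ => exact ih₁.trans ih₂

theorem Fires.par {P : Proc} (hP : P.ClosedAt 0) (h : Fires P) (Q : Proc) : Fires (.par P Q) :=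
  Or.inl (FiresIn.mono_closed hP (fun κ _ => by simp [supply]) h)

theorem Fires.nu {P : Proc} (hP : P.ClosedAt 0) (h : Fires P) (a : ℕ) : Fires (.nu a P) := by
  refine (firesIn_nu hP a _).2 (FiresIn.mono_closed hP (fun κ hκ => ?_) h)
  rcases κ with _ | k | (b | i)
  · exact (supply_nu_ok hP a).ge
  · exact (supply_nu_len hP a k).ge
  · by_cases hb : b = a <;> simp [envSet, supply_nu hP, hb]
  · exact absurd hκ (Nat.not_lt_zero i)

/-! ### Every reduction comes from a join whose demand is covered -/

theorem PolyMatch.data_length {ts : List Term} {ps : List Pat} {σ : List Term}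
    (h : PolyMatch ts ps σ) : ts.length = ps.length := by
  induction h with
  | nil => rfl
  | cons _ _ ih => simp [ih]

theorem PolyMatch.eq_of_nameMatch {ts : List Term} {v : Name} {σ : List Term}
    (h : PolyMatch ts [.nameMatch v] σ) : ts = [.name v] := by
  cases h with
  | cons h h' =>
    cases h
    cases h'
    rfl

/-- A datum matched by an input has the length of its patterns, and is the matched name when there
is a single name-match; so each output covers what its input adds to the demand. -/
theorem demand_cons_le {c : Option Term} {d : List Term} {ps : List Pat} {σ : List Term}
    (h : PolyMatch d ps σ) {κ : Obs} {I : List Inp} {x : ℕ∞} (hI : (demand κ I : ℕ∞) ≤ x) :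
    (demand κ (⟨c, ps⟩ :: I) : ℕ∞) ≤ outSupply κ d + x := by
  rcases κ with _ | k | v
  · simp [demand]
  · simp only [demand, List.countP_cons, outSupply, decide_eq_true_eq, h.data_length] at hI ⊢
    split_ifs
    · rw [add_comm]; push_cast; exact add_le_add_right hI _
    · simpa using hI
  · simp only [demand, List.countP_cons, outSupply, decide_eq_true_eq] at hI ⊢
    by_cases hps : ps = [.nameMatch v]
    · subst hps
      rw [h.eq_of_nameMatch]
      simp only [if_true]
      rw [add_comm]; push_cast; exact add_le_add_right hI _
    · simp only [hps]
      exact hI.trans le_add_self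

theorem JoinMatch.demand_le {Os : List Proc} {I : List Inp} {Ps : List Proc} {σ : List Term}
    (h : JoinMatch Os I Ps σ) (κ : Obs) : (demand κ I : ℕ∞) ≤ supply κ (parList Os) := by
  induction h with
  | nil => rcases κ with _ | k | v <;> simp [demand]
  | out h _ ih =>
    change _ ≤ supply κ (.par (.out _ _) (parList _))
    refine (demand_cons_le h ih).trans (le_of_eq ?_)
    rcases κ with _ | k | v <;> rfl
  | outThen h _ ih =>
    change _ ≤ supply κ (.par (.outThen _ _ _) (parList _))
    refine (demand_cons_le h ih).trans (le_of_eq ?_)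
    rcases κ with _ | k | v <;> rfl

/-- Covering the demand is necessary for a reduction in every language. The converse,
`Fires.exists_red`, needs inputs for which the counts say everything. -/
theorem Red.fires {L : Lang} {P P' : Proc} (h : Red L P P') : Fires P := by
  induction h with
  | interact hm h =>
    exact Or.inr fun κ => (h.demand_le κ).trans (by simp [supply])
  | par Q _ h ih => exact ih.par h.mem.1.1 Q
  | nu a h ih => exact ih.nu h.mem.1.1 a
  | struct h _ _ ih => exact h.fires_iff.2 ih

end Coord

namespace Coord

/-! ## A process that fires reduces -/

/-- The processes that offer something: success and outputs. -/
def Proc.IsOffer : Proc → Prop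
  | .ok | .out _ _ | .outThen _ _ _ => True
  | _ => False

/-- Walk down to an active offer of `κ` and bring it to the top: decide conditionals, unfold each
replication once, open restrictions with names outside `F`, and extrude their scopes over what
stands in parallel. -/
theorem exists_offer {L : Lang} {κ : Obs} (hκ : κ.ClosedAt 0) {R : Proc} (hR : L.Mem R)
    (h : supply κ R ≠ 0) {F : Set ℕ} (hF : F.Finite) (hκF : ∀ a, κ = .name (.free a) → a ∈ F) :
    ∃ as O R', (∀ a ∈ as, a ∉ F) ∧ StructEq L R (nus as (.par O R')) ∧ L.Mem O ∧ L.Mem R' ∧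
      O.IsOffer ∧ supply κ O ≠ 0 := by
  induction hn : R.size using Nat.strong_induction_on generalizing R F with
  | _ n ih =>
  have offer : R.IsOffer → ∃ as O R', (∀ a ∈ as, a ∉ F) ∧
      StructEq L R (nus as (.par O R')) ∧ L.Mem O ∧ L.Mem R' ∧ O.IsOffer ∧ supply κ O ≠ 0 :=
    fun hO => ⟨[], R, .nil, by simp, (StructEq.par_nil hR).symm, hR, L.mem_nil, hO, h⟩
  cases R with
  | nil => simp [supply] at h
  | ok => exact offer trivial
  | out c d => exact offer trivial
  | outThen c d P => exact offer trivial
  | join I P => simp [supply] at h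
  | res P =>
    obtain ⟨a, P', ha, hP', hm, hs⟩ := hR.exists_nu hF
    rw [hP'] at h ⊢
    have h' : supply κ P' ≠ 0 := by
      rcases κ with _ | k | (b | i)
      · rwa [supply_nu_ok hm.1] at h
      · rwa [supply_nu_len hm.1] at h
      · rw [supply_nu hm.1] at h
        exact fun h0 => h (by simp [h0])
      · exact absurd hκ (Nat.not_lt_zero i)
    simp only [Proc.size] at hn
    obtain ⟨as, O, R', has, hst, h₁, h₂, h₃, h₄⟩ := ih P'.size (by omega) hm h' hF hκF rfl
    exact ⟨a :: as, O, R', by simpa using ⟨ha, has⟩, hst.nu a, h₁, h₂, h₃, h₄⟩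
  | par P Q =>
    obtain ⟨hP, hQ⟩ := Lang.mem_par.1 hR
    simp only [Proc.size] at hn
    by_cases h0 : supply κ P = 0
    · have h' : supply κ Q ≠ 0 := by simpa [supply, h0] using h
      obtain ⟨as, O, R', has, hst, h₁, h₂, h₃, h₄⟩ := ih Q.size (by omega) hQ h'
        (hF.union P.fn_finite) (fun a ha => Or.inl (hκF a ha)) rfl
      refine ⟨as, O, .par P R', fun a ha => fun h => has a ha (Or.inl h), ?_, h₁, hP.par h₂, h₃, h₄⟩
      refine (hst.par_right hP).trans ((StructEq.par_nus hP (h₁.par h₂) fun a ha h =>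
        has a ha (Or.inr h)).trans ?_)
      exact (StructEq.par_left_comm hP h₁ h₂).nus as
    · obtain ⟨as, O, R', has, hst, h₁, h₂, h₃, h₄⟩ := ih P.size (by omega) hP h0
        (hF.union Q.fn_finite) (fun a ha => Or.inl (hκF a ha)) rfl
      refine ⟨as, O, .par R' Q, fun a ha => fun h => has a ha (Or.inl h), ?_, h₁, h₂.par hQ, h₃, h₄⟩
      refine (hst.par_left hQ).trans ((StructEq.nus_par (h₁.par h₂) hQ fun a ha h =>
        has a ha (Or.inr h)).trans ?_)
      exact (StructEq.par_assoc h₁ h₂ hQ).nus as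
  | ite s t P Q =>
    simp only [Proc.size] at hn
    by_cases hst : s = t
    · subst hst
      have hP : L.Mem P := ⟨hR.1.2.2.1, hR.2.1⟩
      obtain ⟨as, O, R', has, hst, h'⟩ := ih P.size (by omega) hP (by simpa [supply] using h)
        hF hκF rfl
      exact ⟨as, O, R', has, (StructEq.ite_eq s hR).trans hst, h'⟩
    · have hQ : L.Mem Q := ⟨hR.1.2.2.2, hR.2.2⟩
      obtain ⟨as, O, R', has, hst', h'⟩ := ih Q.size (by omega) hQ (by simpa [supply, hst] using h)
        hF hκF rfl
      exact ⟨as, O, R', has, (StructEq.ite_ne hst hR).trans hst', h'⟩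
  | rep P =>
    have hP : L.Mem P := hR
    simp only [Proc.size] at hn
    have h' : supply κ P ≠ 0 := fun h0 => h (by simp [supply, h0])
    obtain ⟨as, O, R', has, hst, h₁, h₂, h₃, h₄⟩ := ih P.size (by omega) hP h'
      (hF.union P.rep.fn_finite) (fun a ha => Or.inl (hκF a ha)) rfl
    refine ⟨as, O, .par R' (.rep P), fun a ha => fun h => has a ha (Or.inl h), ?_, h₁, h₂.par hR,
      h₃, h₄⟩
    refine (StructEq.rep_unfold hP).trans ((hst.par_left hR).trans
      ((StructEq.nus_par (h₁.par h₂) hR fun a ha h => has a ha (Or.inr h)).trans ?_))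
    exact (StructEq.par_assoc h₁ h₂ hR).nus as

theorem supply_nus {P : Proc} {L : Lang} (hP : L.Mem P) {as : List ℕ} {κ : Obs} (hκ : κ.ClosedAt 0)
    (has : ∀ a ∈ as, κ ≠ .name (.free a)) : supply κ (nus as P) = supply κ P := by
  induction as with
  | nil => rfl
  | cons a as ih =>
    have hm := hP.nus as
    rw [← ih fun b hb => has b (by simp [hb])]
    change supply κ (.nu a (nus as P)) = _
    rcases κ with _ | k | (b | i)
    · rw [supply_nu_ok hm.1]
    · rw [supply_nu_len hm.1]
    · rw [supply_nu hm.1, if_neg]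
      rintro rfl
      exact has b (by simp) rfl
    · exact absurd hκ (Nat.not_lt_zero i)

open Classical in
/-- The environment `e`, except that `R` supplies the names `as`. -/
noncomputable def envMix (as : List ℕ) (R : Proc) (e : Obs → ℕ∞) (κ : Obs) : ℕ∞ :=
  if ∃ a ∈ as, κ = .name (.free a) then supply κ R else e κ

/-- The analogue of `exists_offer` for a join that fires. Names whose restriction is passed on the
way can be offered only by the residual process, which explains `envMix`. -/
theorem exists_firing_join {L : Lang} {R : Proc} (hR : L.Mem R) {e : Obs → ℕ∞} (h : FiresIn R e)
    {F : Set ℕ} (hF : F.Finite) :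
    ∃ as I Q R', (∀ a ∈ as, a ∉ F) ∧ StructEq L R (nus as (.par (.join I Q) R')) ∧
      L.Mem (.join I Q) ∧ L.Mem R' ∧ ∀ κ : Obs, κ.ClosedAt 0 → demand κ I ≤ envMix as R' e κ := by
  induction hn : R.size using Nat.strong_induction_on generalizing R F e with
  | _ n ih =>
  have extend : ∀ {as : List ℕ} {P Q : Proc} {κ : Obs}, κ.ClosedAt 0 →
      envMix as P e κ ≤ envMix as (.par P Q) e κ := by
    intro as P Q κ _
    unfold envMix
    split_ifs
    · simp [supply]
    · exact le_rfl
  have extend' : ∀ {as : List ℕ} {P Q : Proc} {κ : Obs}, κ.ClosedAt 0 →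
      envMix as P e κ ≤ envMix as (.par Q P) e κ := by
    intro as P Q κ _
    unfold envMix
    split_ifs
    · simp [supply]
    · exact le_rfl
  cases R with
  | nil => exact h.elim
  | ok => exact h.elim
  | out c d => exact h.elim
  | outThen c d P => exact h.elim
  | join I P =>
    exact ⟨[], I, P, .nil, by simp, (StructEq.par_nil hR).symm, hR, L.mem_nil,
      fun κ _ => by simpa [envMix] using h κ⟩
  | res P =>
    obtain ⟨a, P', ha, hP', hm, hs⟩ := hR.exists_nu hF
    rw [hP'] at h ⊢
    rw [firesIn_nu hm.1] at h
    simp only [Proc.size] at hn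
    obtain ⟨as, I, Q, R', has, hst, h₁, h₂, h₃⟩ := ih P'.size (by omega) hm h
      (hF.union (Set.finite_singleton a)) rfl
    refine ⟨a :: as, I, Q, R', ?_, hst.nu a, h₁, h₂, fun κ hκ => (h₃ κ hκ).trans (le_of_eq ?_)⟩
    · intro b hb
      rcases List.mem_cons.1 hb with rfl | hb
      · exact ha
      · exact fun h => has b hb (Or.inl h)
    · have haa : a ∉ as := fun h => has a h (Or.inr rfl)
      rcases κ with _ | k | (b | i)
      · simp [envMix, envSet]
      · simp [envMix, envSet]
      · by_cases hb : b ∈ as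
        · simp [envMix, hb]
        · by_cases hba : b = a
          · subst hba
            -- For the name just opened, the offer of the whole body equals that of the residual:
            -- the join offers nothing, and the inner restrictions hide other names.
            simp only [envMix, envSet, Obs.name.injEq, Name.free.injEq]
            simp [haa]
            rw [hst.supply_eq (κ := .name (.free b)) trivial, supply_nus (h₁.par h₂) hκ]
            · simp [supply]
            · rintro c hc h
              simp only [Obs.name.injEq, Name.free.injEq] at h
              exact haa (h ▸ hc)
          · simp [envMix, envSet, hb, hba]
      · exact absurd hκ (Nat.not_lt_zero i)
  | par P Q =>
    obtain ⟨hP, hQ⟩ := Lang.mem_par.1 hR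
    simp only [Proc.size] at hn
    rcases h with h | h
    · obtain ⟨as, I, Q', R', has, hst, h₁, h₂, h₃⟩ := ih P.size (by omega) hP h
        (hF.union Q.fn_finite) rfl
      refine ⟨as, I, Q', .par R' Q, fun a ha => fun h => has a ha (Or.inl h), ?_, h₁, h₂.par hQ,
        fun κ hκ => (h₃ κ hκ).trans (extend hκ)⟩
      refine (hst.par_left hQ).trans ((StructEq.nus_par (h₁.par h₂) hQ fun a ha h =>
        has a ha (Or.inr h)).trans ?_)
      exact (StructEq.par_assoc h₁ h₂ hQ).nus as
    · obtain ⟨as, I, Q', R', has, hst, h₁, h₂, h₃⟩ := ih Q.size (by omega) hQ h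
        (hF.union P.fn_finite) rfl
      refine ⟨as, I, Q', .par P R', fun a ha => fun h => has a ha (Or.inl h), ?_, h₁, hP.par h₂,
        fun κ hκ => (h₃ κ hκ).trans (extend' hκ)⟩
      refine (hst.par_right hP).trans ((StructEq.par_nus hP (h₁.par h₂) fun a ha h =>
        has a ha (Or.inr h)).trans ?_)
      exact (StructEq.par_left_comm hP h₁ h₂).nus as
  | ite s t P Q =>
    simp only [Proc.size] at hn
    by_cases hst : s = t
    · subst hst
      have hP : L.Mem P := ⟨hR.1.2.2.1, hR.2.1⟩
      obtain ⟨as, I, Q', R', has, hst, h'⟩ := ih P.size (by omega) hP (by simpa [FiresIn] using h)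
        hF rfl
      exact ⟨as, I, Q', R', has, (StructEq.ite_eq s hR).trans hst, h'⟩
    · have hQ : L.Mem Q := ⟨hR.1.2.2.2, hR.2.2⟩
      obtain ⟨as, I, Q', R', has, hst', h'⟩ := ih Q.size (by omega) hQ
        (by simpa [FiresIn, hst] using h) hF rfl
      exact ⟨as, I, Q', R', has, (StructEq.ite_ne hst hR).trans hst', h'⟩
  | rep P =>
    have hP : L.Mem P := hR
    simp only [Proc.size] at hn
    obtain ⟨as, I, Q', R', has, hst, h₁, h₂, h₃⟩ := ih P.size (by omega) hP h
      (hF.union P.rep.fn_finite) rfl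
    refine ⟨as, I, Q', .par R' (.rep P), fun a ha => fun h => has a ha (Or.inl h), ?_, h₁, h₂.par hR,
      fun κ hκ => (h₃ κ hκ).trans (extend hκ)⟩
    refine (StructEq.rep_unfold hP).trans ((hst.par_left hR).trans
      ((StructEq.nus_par (h₁.par h₂) hR fun a ha h => has a ha (Or.inr h)).trans ?_))
    exact (StructEq.par_assoc h₁ h₂ hR).nus as

/-! ### Serving the inputs of a join -/

theorem exists_polyMatch_of_binds {ts : List Term} {ps : List Pat} (h : ∀ p ∈ ps, p = .bind)
    (hl : ts.length = ps.length) : ∃ σ, PolyMatch ts ps σ := by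
  induction ps generalizing ts with
  | nil =>
    obtain rfl := List.length_eq_zero_iff.1 hl
    exact ⟨_, .nil⟩
  | cons p ps ih =>
    obtain ⟨t, ts, rfl⟩ := List.exists_cons_of_length_eq_add_one hl
    obtain ⟨σ, hσ⟩ := ih (fun p hp => h p (by simp [hp])) (by simpa using hl)
    obtain rfl := h p (by simp)
    exact ⟨_, .cons (.bind t) hσ⟩

/-- `O` is an output that the input `i` can receive in a dataspace. -/
def Receives (i : Inp) (O : Proc) : Prop :=
  i.chan = none ∧ ∃ d σ, PolyMatch d i.pats σ ∧ (O = .out none d ∨ ∃ P, O = .outThen none d P)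

theorem JoinMatch.of_receives {Os : List Proc} {I : List Inp}
    (h : List.Forall₂ (fun O i => Receives i O) Os I) : ∃ Ps σ, JoinMatch Os I Ps σ := by
  induction h with
  | nil => exact ⟨_, _, .nil⟩
  | @cons O i _ _ h _ ih =>
    obtain ⟨Ps, τ, ih⟩ := ih
    obtain ⟨c, ps⟩ := i
    obtain ⟨hc, d, σ, hm, rfl | ⟨P, rfl⟩⟩ := h
    · obtain rfl : c = none := hc
      exact ⟨_, _, .out hm ih⟩
    · obtain rfl : c = none := hc
      exact ⟨_, _, .outThen hm ih⟩

theorem StructEq.parList_perm {L : Lang} {Ps Qs : List Proc} (h : Ps.Perm Qs)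
    (hm : ∀ P ∈ Ps, L.Mem P) : StructEq L (parList Ps) (parList Qs) := by
  induction h with
  | nil => exact .refl _ _
  | cons P _ ih => exact (ih fun P hP => hm P (by simp [hP])).par_right (hm P (by simp))
  | swap P Q Ps =>
    exact .par_left_comm (hm Q (by simp)) (hm P (by simp))
      (Lang.mem_parList.2 fun P hP => hm P (by simp [hP]))
  | trans h₁ _ ih₁ ih₂ => exact (ih₁ hm).trans (ih₂ fun P hP => hm P (h₁.mem_iff.2 hP))

/-- A dataspace-based language whose inputs either only bind or match one single name. -/
structure Lang.Simple (L : Lang) : Prop where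
  medium : L.medium = .D
  inputs : L.matching = .NO ∨ L.matching = .NM ∧ L.arity = .M

def Inp.Binds (i : Inp) : Prop := ∀ p ∈ i.pats, p = .bind

theorem Lang.Simple.inp {L : Lang} (hL : L.Simple) {i : Inp} (hi : L.OkInp i) :
    i.Binds ∨ ∃ v, i.pats = [.nameMatch v] := by
  rcases hL.inputs with h | ⟨h, h'⟩
  · exact Or.inl fun p hp => by simpa [Lang.OkPat, h] using hi.2.2 p hp
  · have hl : i.pats.length = 1 := by simpa [Lang.OkLength, h'] using hi.2.1
    obtain ⟨p, hp⟩ := List.length_eq_one_iff.1 hl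
    have := hi.2.2 p (by simp [hp])
    simp only [Lang.OkPat, h] at this
    rcases this with rfl | ⟨v, rfl⟩
    · exact Or.inl fun q hq => by simpa [hp] using hq
    · exact Or.inr ⟨v, hp⟩

theorem outSupply_ne_top (κ : Obs) (d : List Term) : outSupply κ d ≠ ⊤ := by
  rcases κ with _ | k | v
  · simp [outSupply]
  · by_cases h : d.length = k <;> simp [outSupply, h]
  · by_cases h : d = [.name v] <;> simp [outSupply, h]

/-- The data of an offer of a dataspace-based language, other than success. -/
theorem Proc.IsOffer.exists_data {L : Lang} (hL : L.medium = .D) {O : Proc} (h : O.IsOffer)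
    (hm : L.Mem O) {κ : Obs} (hκ : κ ≠ .ok) (hs : supply κ O ≠ 0) :
    ∃ d, (O = .out none d ∨ ∃ P, O = .outThen none d P) ∧ ∀ κ, supply κ O = outSupply κ d := by
  cases O with
  | ok =>
    rcases κ with _ | k | v
    · exact absurd rfl hκ
    · simp [supply] at hs
    · simp [supply] at hs
  | out c d =>
    obtain rfl : c = none := by simpa [Lang.OkChan, hL] using hm.2.2.1
    exact ⟨d, Or.inl rfl, fun κ => by rcases κ with _ | k | v <;> rfl⟩
  | outThen c d P =>
    obtain rfl : c = none := by simpa [Lang.OkChan, hL] using hm.2.2.1.1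
    exact ⟨d, Or.inr ⟨P, rfl⟩, fun κ => by rcases κ with _ | k | v <;> rfl⟩
  | _ => exact h.elim

/-- A greedy assignment succeeds when the inputs that insist on a name come first, as `hs` demands.
Such an input takes an output of exactly its name. Once a binding input is reached, no name is
demanded any more, and any output of the right length will do. At each step supply and remaining
demand drop by the same amount wherever demand is left. -/
theorem exists_offers {L : Lang} (hL : L.Simple) {I : List Inp} (hI : ∀ i ∈ I, L.OkInp i)
    (hcl : ∀ i ∈ I, i.ClosedAt 0) (hs : I.Pairwise fun i j => i.Binds → j.Binds) {R : Proc}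
    (hR : L.Mem R) (h : ∀ κ : Obs, κ.ClosedAt 0 → (demand κ I : ℕ∞) ≤ supply κ R)
    {F : Set ℕ} (hF : F.Finite) :
    ∃ as Os R', (∀ a ∈ as, a ∉ F) ∧ StructEq L R (nus as (.par (parList Os) R')) ∧
      (∀ O ∈ Os, L.Mem O) ∧ L.Mem R' ∧ List.Forall₂ (fun O i => Receives i O) Os I := by
  induction I generalizing R F with
  | nil =>
    exact ⟨[], [], R, by simp, (StructEq.nil_par hR).symm, by simp, hR, .nil⟩
  | cons i I ih =>
    have hi := hI i (by simp)
    have hc : i.chan = none := by simpa [Lang.OkChan, hL.medium] using hi.1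
    have hfin : (⋃ i ∈ I, i.fn).Finite := finite_biUnion_list _ Inp.fn_finite
    have hG := hF.union (hfin.union i.fn_finite)
    obtain ⟨hs₁, hs₂⟩ := List.pairwise_cons.1 hs
    suffices ∃ as O R', (∀ a ∈ as, a ∉ F) ∧ StructEq L R (nus as (.par O R')) ∧ L.Mem O ∧
        L.Mem R' ∧ Receives i O ∧ ∀ κ : Obs, κ.ClosedAt 0 → (demand κ I : ℕ∞) ≤ supply κ R' by
      obtain ⟨as, O, R₁, has, hst, hO, hR₁, hr, hd⟩ := this
      obtain ⟨bs, Os, R₂, hbs, hst', hOs, hR₂, hrs⟩ := ih (fun i h => hI i (by simp [h]))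
        (fun i h => hcl i (by simp [h])) hs₂ hR₁ hd (hF.union O.fn_finite)
      have hOs' := Lang.mem_parList.2 hOs
      refine ⟨as ++ bs, O :: Os, R₂, ?_, ?_, by simpa using ⟨hO, hOs⟩, hR₂, .cons hr hrs⟩
      · intro a ha
        rcases List.mem_append.1 ha with ha | ha
        · exact has a ha
        · exact fun h => hbs a ha (Or.inl h)
      · rw [nus_append]
        refine hst.trans (StructEq.nus ?_ as)
        refine (hst'.par_right hO).trans ((StructEq.par_nus hO (hOs'.par hR₂) fun b hb h =>
          hbs b hb (Or.inr h)).trans ?_)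
        exact (StructEq.par_assoc hO hOs' hR₂).symm.nus bs
    -- The step common to both kinds of input: `κ₀` is the observable by which an output for `i` is
    -- looked up, the length for a binding input and the name for a matching one.
    have main : ∀ κ₀ : Obs, κ₀.ClosedAt 0 → κ₀ ≠ .ok → demand κ₀ [i] ≠ 0 →
        (∀ d, outSupply κ₀ d ≠ 0 → (∃ σ, PolyMatch d i.pats σ) ∧
          ∀ κ : Obs, κ.ClosedAt 0 → demand κ I ≠ 0 → (demand κ [i] : ℕ∞) = outSupply κ d) →
        ∃ as O R', (∀ a ∈ as, a ∉ F) ∧ StructEq L R (nus as (.par O R')) ∧ L.Mem O ∧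
          L.Mem R' ∧ Receives i O ∧ ∀ κ : Obs, κ.ClosedAt 0 → (demand κ I : ℕ∞) ≤ supply κ R' := by
      intro κ₀ hκ₀ hok hdem hd
      have hadd : ∀ κ, demand κ (i :: I) = demand κ [i] + demand κ I := by
        intro κ
        rcases κ with _ | k | v
        · rfl
        · simp only [demand, List.countP_cons, List.countP_nil]; omega
        · simp only [demand, List.countP_cons, List.countP_nil]; omega
      have hne : supply κ₀ R ≠ 0 := by
        intro h0
        have := h κ₀ hκ₀
        rw [h0, hadd] at this
        simp at this
        omega
      obtain ⟨as, O, R', has, hst, hO, hR', hof, hsO⟩ := exists_offer hκ₀ hR hne hG (by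
        rintro a rfl
        have := (name_of_demand_ne_zero (d := 0) (fun j hj => hcl j (by simp_all)) hdem).2
        exact Or.inr (Or.inr (by simpa [Name.fn] using this)))
      obtain ⟨d, hOd, hsd⟩ := hof.exists_data hL.medium hO hok hsO
      obtain ⟨⟨σ, hσ⟩, hd⟩ := hd d (by rwa [← hsd])
      refine ⟨as, O, R', fun a ha h => has a ha (Or.inl h), hst, hO, hR', ⟨hc, d, σ, hσ, hOd⟩,
        fun κ hκ => ?_⟩
      by_cases h0 : demand κ I = 0
      · simp [h0]
      -- The opened names were chosen away from those of the remaining inputs, so the restrictions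
      -- hide nothing that is still demanded.
      have hfresh : ∀ a ∈ as, κ ≠ .name (.free a) := by
        rintro a ha rfl
        have := (name_of_demand_ne_zero (d := 0) (fun j hj => hcl j (by simp [hj])) h0).2
        exact has a ha (Or.inr (Or.inl (this (by simp [Name.fn]))))
      have := h κ hκ
      rw [hst.supply_eq hκ, supply_nus (hO.par hR') hκ hfresh, hadd] at this
      simp only [supply, hsd, Nat.cast_add, hd κ hκ h0] at this
      -- A single output offers a finite amount, which can be cancelled even if the total supply is
      -- infinite.
      exact (ENat.add_le_add_iff_left (outSupply_ne_top κ d)).1 this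
    rcases hL.inp hi with hb | ⟨v, hv⟩
    · refine main (.len i.pats.length) trivial (by simp) (by simp [demand]) fun d hd => ?_
      have hl : d.length = i.pats.length := by
        by_contra hl
        simp [outSupply, hl] at hd
      refine ⟨exists_polyMatch_of_binds hb hl, fun κ _ hκI => ?_⟩
      rcases κ with _ | k | v
      · simp [demand] at hκI
      · simp only [demand, List.countP_cons, List.countP_nil, outSupply, hl]
        by_cases hk : i.pats.length = k <;> simp [hk]
      · obtain ⟨j, hj, hv⟩ := List.countP_pos_iff.1 (Nat.pos_of_ne_zero hκI)
        have := hs₁ j hj hb (.nameMatch v) (by simp_all)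
        simp at this
    · have hvc : v.ClosedAt 0 := (hcl i (by simp)).2 (.nameMatch v) (by simp [hv])
      refine main (.name v) hvc (by simp) (by simp [demand, hv]) fun d hd => ?_
      have hl : d = [.name v] := by
        by_contra hl
        simp [outSupply, hl] at hd
      subst hl
      refine ⟨⟨[], by rw [hv]; exact .cons (σ := []) (τ := []) (.name v) .nil⟩, fun κ _ hκI => ?_⟩
      rcases κ with _ | k | w
      · simp [demand] at hκI
      · simp only [demand, List.countP_cons, List.countP_nil, outSupply, hv]
        by_cases hk : 1 = k <;> simp [hk]
      · simp only [demand, List.countP_cons, List.countP_nil, outSupply, hv]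
        by_cases hk : v = w <;> simp [hk, hv]

theorem demand_perm {I I' : List Inp} (h : I.Perm I') (κ : Obs) : demand κ I = demand κ I' := by
  rcases κ with _ | k | v
  · rfl
  · exact h.countP_eq _
  · exact h.countP_eq _

/-- For simple languages the counting condition is also sufficient: isolate a join that fires, then
collect outputs for its inputs from the residual process. -/
theorem Fires.exists_red {L : Lang} (hL : L.Simple) {R : Proc} (hR : L.Mem R) (h : Fires R) :
    ∃ R', Red L R R' := by
  classical
  obtain ⟨as, I, Q, R₁, -, hst, hJ, hR₁, hd⟩ := exists_firing_join hR h Set.finite_empty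
  have hd' : ∀ κ : Obs, κ.ClosedAt 0 → (demand κ I : ℕ∞) ≤ supply κ R₁ := by
    intro κ hκ
    -- Restricted names are served by the residual by construction; for the rest the offer of `R` is
    -- that of the residual, as the join itself offers nothing.
    refine (hd κ hκ).trans ?_
    unfold envMix
    split_ifs with hex
    · exact le_rfl
    · push Not at hex
      change supply κ R ≤ _
      rw [hst.supply_eq hκ, supply_nus (hJ.par hR₁) hκ hex]
      simp [supply]
  -- The greedy assignment wants the inputs with a name-match in front of the binding ones.
  have hperm : (I.filter (fun i => ¬ i.Binds) ++ I.filter (fun i => i.Binds)).Perm I := by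
    have := List.filter_append_perm (fun i : Inp => decide (¬ i.Binds)) I
    simpa using this
  set I' := I.filter (fun i => ¬ i.Binds) ++ I.filter (fun i => i.Binds) with hI'
  have hsort : I'.Pairwise fun i j => i.Binds → j.Binds := by
    rw [hI', List.pairwise_append]
    refine ⟨List.pairwise_of_forall_mem_list fun i hi j _ h => ?_,
      List.pairwise_of_forall_mem_list fun i _ j hj _ => ?_, fun i _ j hj _ => ?_⟩
    · simp at hi
      exact absurd h hi.2
    · simp at hj
      exact hj.2
    · simp at hj
      exact hj.2
  obtain ⟨bs, Os, R₂, hbs, hst', hOs, hR₂, hrs⟩ := exists_offers hL (I := I')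
    (fun i hi => hJ.2.1.2 i (hperm.mem_iff.1 hi)) (fun i hi => hJ.1.1 i (hperm.mem_iff.1 hi)) hsort
    hR₁ (fun κ hκ => by rw [demand_perm hperm]; exact hd' κ hκ) (Proc.fn_finite (.join I Q))
  -- The chosen outputs are put back into the original order of the inputs, since `JoinMatch` pairs
  -- them position by position.
  obtain ⟨Os', hOs', hrs'⟩ : ∃ Os', Os.Perm Os' ∧ List.Forall₂ (fun O i => Receives i O) Os' I := by
    have := List.forall₂_comp_perm_eq_perm_comp_forall₂ (r := fun O i => Receives i O)
    have h2 : Relation.Comp (List.Forall₂ fun O i => Receives i O) List.Perm Os I := ⟨I', hrs, hperm⟩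
    rw [this] at h2
    exact h2
  obtain ⟨Ps, σ, hm⟩ := JoinMatch.of_receives hrs'
  have hm₁ := Lang.mem_parList.2 hOs
  have hm₂ := hst.trans (StructEq.nus ((hst'.par_right hJ).trans ((StructEq.par_nus hJ
    (hm₁.par hR₂) fun b hb => hbs b hb).trans (StructEq.nus ((StructEq.par_assoc hJ hm₁ hR₂).symm.trans
    ((((StructEq.par_comm hJ hm₁).trans ((StructEq.parList_perm hOs' hOs).par_left hJ)).par_left
      hR₂))) bs))) as)
  have hmem : L.Mem (.par (parList Os') (.join I Q)) :=
    (Lang.mem_parList.2 fun O hO => hOs O (hOs'.mem_iff.2 hO)).par hJ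
  exact ⟨_, (((Red.interact hmem hm).par R₂ hR₂).nus bs |>.nus as).of_structEq hm₂⟩

theorem exists_structEq_ok {L : Lang} {R : Proc} (hR : L.Mem R) (h : supply .ok R ≠ 0) :
    ∃ R', StructEq L R (.par R' .ok) := by
  obtain ⟨as, O, R', -, hst, hO, hR', hof, hs⟩ := exists_offer (κ := .ok) trivial hR h
    Set.finite_empty (by simp)
  obtain rfl : O = .ok := by
    cases O <;> simp [supply, outSupply, Proc.IsOffer] at hs hof ⊢
  refine ⟨nus as R', hst.trans ?_⟩
  exact (StructEq.par_nus hO hR' fun a _ h => h).symm.trans (.par_comm hO (hR'.nus as))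

end Coord

namespace Coord

/-! ## Predicates on the active prefixes of a process -/

open Classical in
/-- `φ j` holds of every active prefix, and of the prefixes that it guards if it is an output, where
`j` is the number of the restrictions around it. -/
def Live : (ℕ → Proc → Prop) → Proc → Prop
  | _, .nil => True
  | φ, .ok => φ 0 .ok
  | φ, .out c d => φ 0 (.out c d)
  | φ, .outThen c d P => φ 0 (.outThen c d P) ∧ Live φ P
  | φ, .join I P => φ 0 (.join I P)
  | φ, .res P => Live (fun j => φ (j + 1)) P
  | φ, .par P Q => Live φ P ∧ Live φ Q
  | φ, .ite s t P Q => if s = t then Live φ P else Live φ Q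
  | φ, .rep P => Live φ P

theorem live_ren {r : ℕ → Name → Name} (hr : IsRenaming r) {d : ℕ}
    (hi : Set.InjOn (r d) {v | v.ClosedAt d}) {P : Proc} (hP : P.ClosedAt d)
    (φ : ℕ → Proc → Prop) : Live φ (P.ren r d) ↔ Live (fun j X => φ j (X.ren r (d + j))) P := by
  induction P generalizing d φ with
  | nil | ok | out | join => rfl
  | outThen c t P ih => exact and_congr Iff.rfl (ih hi hP.2.2 φ)
  | res P ih =>
    refine (ih (hr.injOn_succ hi) (show P.ClosedAt (d + 1) from hP) fun j => φ (j + 1)).trans ?_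
    simp only [Live, add_assoc, add_comm 1]
  | par P Q ihP ihQ => exact and_congr (ihP hi hP.1 φ) (ihQ hi hP.2 φ)
  | ite s t P Q ihP ihQ =>
    have hst := Term.subst_name_inj hi hP.1 hP.2.1
    have ihP := ihP hi hP.2.2.1 φ
    have ihQ := ihQ hi hP.2.2.2 φ
    by_cases h : s = t
    · simpa only [Proc.ren, Proc.subst, Live, if_pos (hst.2 h), if_pos h] using ihP
    · simpa only [Proc.ren, Proc.subst, Live, if_neg (mt hst.1 h), if_neg h] using ihQ
  | rep P ih => exact ih hi (show P.ClosedAt d from hP) φ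

theorem live_congr {n : ℕ} {P : Proc} (hP : P.ClosedAt n) {φ ψ : ℕ → Proc → Prop}
    (h : ∀ j X, X.ClosedAt (n + j) → X.fn ⊆ P.fn → (φ j X ↔ ψ j X)) : Live φ P ↔ Live ψ P := by
  induction P generalizing n φ ψ with
  | nil => rfl
  | ok => exact h 0 _ hP subset_rfl
  | out c t => exact h 0 _ hP subset_rfl
  | join I P => exact h 0 _ hP subset_rfl
  | outThen c t P ih =>
    exact and_congr (h 0 _ hP subset_rfl)
      (ih hP.2.2 fun j X hX hf => h j X hX (hf.trans fun x hx => Or.inr hx))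
  | res P ih =>
    refine ih (show P.ClosedAt (n + 1) from hP) fun j X hX hf => h (j + 1) X ?_ hf
    rwa [add_assoc, add_comm 1] at hX
  | par P Q ihP ihQ =>
    exact and_congr (ihP hP.1 fun j X hX hf => h j X hX (hf.trans fun x hx => Or.inl hx))
      (ihQ hP.2 fun j X hX hf => h j X hX (hf.trans fun x hx => Or.inr hx))
  | ite s t P Q ihP ihQ =>
    have ihP := ihP hP.2.2.1 fun j X hX hf => h j X hX (hf.trans fun x hx => Or.inl (Or.inr hx))
    have ihQ := ihQ hP.2.2.2 fun j X hX hf => h j X hX (hf.trans fun x hx => Or.inr hx)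
    by_cases h : s = t
    · simpa only [Live, if_pos h] using ihP
    · simpa only [Live, if_neg h] using ihQ
  | rep P ih => exact ih (show P.ClosedAt n from hP) h

/-- A family of predicates on prefixes, indexed by sets of names that may not occur in them. -/
structure IsPrefixFamily (Φ : Set ℕ → Proc → Prop) : Prop where
  close : ∀ A a j X, X.ClosedAt j → (Φ A (X.ren (closeMap [a]) j) ↔ Φ (insert a A) X)
  fresh : ∀ A a X, a ∉ X.fn → (Φ (insert a A) X ↔ Φ A X)

namespace IsPrefixFamily

variable {Φ : Set ℕ → Proc → Prop}

theorem live_nu (hΦ : IsPrefixFamily Φ) {P : Proc} (hP : P.ClosedAt 0) (a : ℕ) (A : Set ℕ) :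
    Live (fun _ => Φ A) (.nu a P) ↔ Live (fun _ => Φ (insert a A)) P := by
  change Live (fun _ => Φ A) (P.close [a]) ↔ _
  rw [Proc.close_eq_ren, live_ren (isRenaming_closeMap [a]) (injOn_closeMap [a] 0) hP]
  exact live_congr hP fun j X hX _ => hΦ.close A a _ X hX

theorem live_fresh (hΦ : IsPrefixFamily Φ) {P : Proc} (hP : P.ClosedAt 0) {a : ℕ}
    (ha : a ∉ P.fn) (A : Set ℕ) :
    Live (fun _ => Φ (insert a A)) P ↔ Live (fun _ => Φ A) P :=
  live_congr hP fun _ X _ hf => hΦ.fresh A a X fun h => ha (hf h)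

/-- The set `A` collects the names whose restriction has been opened. Structural equivalence may
rewrite below an output but not below an input, so `hout` asks only that the predicate ignore
continuations of outputs. -/
theorem live_iff_of_structStep (hΦ : IsPrefixFamily Φ)
    (hout : ∀ A c d P P', Φ A (.outThen c d P) ↔ Φ A (.outThen c d P')) {P Q : Proc}
    (h : StructStep P Q) : ∀ A, Live (fun _ => Φ A) P ↔ Live (fun _ => Φ A) Q := by
  induction h with
  | par_nil P => intro A; simp [Live]
  | par_comm P Q => intro A; simp [Live, and_comm]
  | par_assoc P Q R => intro A; simp [Live, and_assoc]
  | ite_eq s P Q => intro A; simp [Live]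
  | ite_ne s t P Q h => intro A; simp [Live, h]
  | nu_nil a => intro A; simp [Live, Proc.nu, Proc.close, Proc.subst]
  | nu_comm a b P hP =>
    intro A
    rw [hΦ.live_nu (Proc.closedAt_nu hP b), hΦ.live_nu hP, hΦ.live_nu (Proc.closedAt_nu hP a),
      hΦ.live_nu hP, Set.insert_comm]
  | par_nu a P Q hP hQ ha =>
    intro A
    rw [hΦ.live_nu (P := .par P Q) ⟨hP, hQ⟩]
    simp only [Live]
    rw [hΦ.live_nu hQ, hΦ.live_fresh hP ha]
  | rep P => intro A; simp [Live]
  | congr_par_left Q _ ih => intro A; simp [Live, ih A]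
  | congr_par_right P _ ih => intro A; simp [Live, ih A]
  | congr_nu a hP hQ h ih =>
    intro A
    rw [hΦ.live_nu hP, hΦ.live_nu hQ, ih]
  | congr_rep _ ih => intro A; simp [Live, ih A]
  | congr_ite_left s t Q _ ih => intro A; simp [Live, ih A]
  | congr_ite_right s t P _ ih => intro A; simp [Live, ih A]
  | congr_outThen c d _ ih => intro A; exact and_congr (hout A c d _ _) (ih A)

theorem live_iff_of_structEq (hΦ : IsPrefixFamily Φ)
    (hout : ∀ A c d P P', Φ A (.outThen c d P) ↔ Φ A (.outThen c d P')) {L : Lang} {P Q : Proc}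
    (h : StructEq L P Q) (A : Set ℕ) : Live (fun _ => Φ A) P ↔ Live (fun _ => Φ A) Q := by
  induction h with
  | rel _ _ h => exact hΦ.live_iff_of_structStep hout h.2.2 A
  | refl => rfl
  | symm _ _ _ ih => exact ih.symm
  | trans _ _ _ _ _ ih₁ ih₂ => exact ih₁.trans ih₂

end IsPrefixFamily

/-! ## Processes without matching prefixes -/

/-- The pattern that binds, or matches one free name. -/
def patOf : Option ℕ → Pat
  | none => .bind
  | some y => .nameMatch (.free y)

/-- Prefixes of the channel-based languages: monadic outputs allowed by `w` and inputs allowed by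
`u`, on free names not in `A`. -/
def MonadicPrefix (w : ℕ → ℕ → Prop) (u : ℕ → Option ℕ → Prop) (A : Set ℕ) : Proc → Prop
  | .out c d | .outThen c d _ => ∃ x y, w x y ∧ x ∉ A ∧ y ∉ A ∧ c = some (.name (.free x)) ∧
      d = [.name (.free y)]
  | .join I _ => ∃ x p, u x p ∧ x ∉ A ∧ (∀ y, p = some y → y ∉ A) ∧
      I = [⟨some (.name (.free x)), [patOf p]⟩]
  | _ => False

theorem closeMap_singleton_eq_free {a d x : ℕ} {v : Name} :
    closeMap [a] d v = .free x ↔ v = .free x ∧ x ≠ a := by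
  cases v with
  | free b =>
    by_cases h : b = a
    · subst h
      simp only [closeMap_singleton_self, Name.free.injEq, reduceCtorEq, false_iff, not_and]
      rintro rfl
      simp
    · simp only [closeMap_singleton_ne h, Name.free.injEq]
      refine ⟨?_, fun h => h.1⟩
      rintro rfl
      exact ⟨rfl, h⟩
  | bound i => simp [closeMap]

theorem Term.subst_closeMap_eq_free {a d x : ℕ} {t : Term} :
    t.subst (fun v => .name (closeMap [a] d v)) = .name (.free x) ↔
      t = .name (.free x) ∧ x ≠ a := by
  cases t with
  | name v => simp [Term.subst, closeMap_singleton_eq_free]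
  | comp s t => simp [Term.subst]

theorem Pat.subst_closeMap_eq_patOf {a d : ℕ} {p : Pat} {o : Option ℕ} :
    p.subst (fun v => .name (closeMap [a] d v)) = patOf o ↔
      p = patOf o ∧ ∀ y, o = some y → y ≠ a := by
  cases p with
  | bind => cases o <;> simp [Pat.subst, patOf]
  | nameMatch v => cases o <;> simp [Pat.subst, patOf, Term.toPat, closeMap_singleton_eq_free]
  | comp s t => cases o <;> simp [Pat.subst, patOf]

/-- Closing turns `a` into an index, and the predicate speaks of free names only; a closed prefix
qualifies precisely when the original one does and avoids `a`. -/
theorem isPrefixFamily_monadicPrefix (w : ℕ → ℕ → Prop) (u : ℕ → Option ℕ → Prop) :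
    IsPrefixFamily (MonadicPrefix w u) := by
  have hd : ∀ {a j y : ℕ} {d : List Term},
      d.map (Term.subst fun v => .name (closeMap [a] j v)) = [.name (.free y)] ↔
        d = [.name (.free y)] ∧ y ≠ a := by
    intro a j y d
    rcases d with _ | ⟨t, _ | ⟨t', d⟩⟩ <;> simp [Term.subst_closeMap_eq_free]
  have hc : ∀ {a j x : ℕ} {c : Option Term},
      c.map (Term.subst fun v => .name (closeMap [a] j v)) = some (.name (.free x)) ↔
        c = some (.name (.free x)) ∧ x ≠ a := by
    intro a j x c
    cases c <;> simp [Term.subst_closeMap_eq_free]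
  have hI : ∀ {a j x : ℕ} {p : Option ℕ} {I : List Inp},
      I.map (Inp.subst fun v => .name (closeMap [a] j v)) =
        [⟨some (.name (.free x)), [patOf p]⟩] ↔
        I = [⟨some (.name (.free x)), [patOf p]⟩] ∧ x ≠ a ∧ ∀ y, p = some y → y ≠ a := by
    intro a j x p I
    rcases I with _ | ⟨⟨c, ps⟩, _ | ⟨i', I⟩⟩
    · simp
    · rcases ps with _ | ⟨q, _ | ⟨q', ps⟩⟩
      · simp [Inp.subst]
      · simp only [Inp.subst, List.map_cons, List.map_nil, List.cons.injEq, Inp.mk.injEq, hc,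
          Pat.subst_closeMap_eq_patOf, and_true]
        tauto
      · simp [Inp.subst]
    · simp
  constructor
  · intro A a j X _
    cases X with
    | out c d | outThen c d P =>
      simp only [Proc.ren, Proc.subst, MonadicPrefix, hd, hc, Set.mem_insert_iff, not_or]
      exact exists_congr fun x => exists_congr fun y => by tauto
    | join I P =>
      simp only [Proc.ren, Proc.subst, MonadicPrefix, hI, Set.mem_insert_iff, not_or]
      refine exists_congr fun x => exists_congr fun p => ?_
      constructor
      · rintro ⟨h₁, h₂, h₃, h₄, h₅, h₆⟩
        exact ⟨h₁, ⟨h₅, h₂⟩, fun y hy => ⟨h₆ y hy, h₃ y hy⟩, h₄⟩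
      · rintro ⟨h₁, ⟨h₅, h₂⟩, h₃, h₄⟩
        exact ⟨h₁, h₂, fun y hy => (h₃ y hy).2, h₄, h₅, fun y hy => (h₃ y hy).1⟩
    | _ => rfl
  · intro A a X ha
    cases X with
    | out c d | outThen c d P =>
      simp only [MonadicPrefix, Set.mem_insert_iff, not_or]
      refine exists_congr fun x => exists_congr fun y => ?_
      refine ⟨by tauto, ?_⟩
      rintro ⟨h₁, h₂, h₃, rfl, rfl⟩
      simp [Proc.fn, Term.fn, Name.fn] at ha
      exact ⟨h₁, ⟨by tauto, h₂⟩, ⟨by tauto, h₃⟩, rfl, rfl⟩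
    | join I P =>
      simp only [MonadicPrefix, Set.mem_insert_iff, not_or]
      refine exists_congr fun x => exists_congr fun p => ?_
      refine ⟨fun ⟨h₁, h₂, h₃, h₄⟩ => ⟨h₁, h₂.2, fun y hy => (h₃ y hy).2, h₄⟩, ?_⟩
      rintro ⟨h₁, h₂, h₃, rfl⟩
      simp [Proc.fn, Inp.fn, Term.fn, Name.fn] at ha
      refine ⟨h₁, ⟨fun h => ha.1.1 h.symm, h₂⟩, fun y hy => ⟨?_, h₃ y hy⟩, rfl⟩
      subst hy
      simp [patOf, Pat.fn, Name.fn] at ha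
      exact fun h => ha.1.2 h.symm
    | _ => rfl

theorem TermMatch.patOf_eq {y : ℕ} {p : Option ℕ} {σ : List Term}
    (h : TermMatch (.name (.free y)) (patOf p) σ) : p = none ∨ p = some y := by
  cases p with
  | none => exact Or.inl rfl
  | some z =>
    cases h
    exact Or.inr rfl

/-- A process does nothing, if none of its prefixes match. -/
theorem not_red_of_live {L : Lang} {w : ℕ → ℕ → Prop} {u : ℕ → Option ℕ → Prop}
    (hwu : ∀ x y, w x y → ¬ u x none ∧ ¬ u x (some y)) {P P' : Proc} (h : Red L P P') (A : Set ℕ) :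
    ¬ Live (fun _ => MonadicPrefix w u A) P := by
  have hΦ := isPrefixFamily_monadicPrefix w u
  induction h generalizing A with
  | interact hm h =>
    rintro ⟨hO, x, p, hu, -, -, rfl⟩
    have contra : ∀ (y : ℕ) (σ : List Term), w x y →
        ¬ PolyMatch [.name (.free y)] [patOf p] σ := by
      intro y σ hw hp
      cases hp with
      | cons h _ =>
        rcases h.patOf_eq with rfl | rfl
        · exact (hwu x y hw).1 hu
        · exact (hwu x y hw).2 hu
    cases h with
    | out hp _ =>
      obtain ⟨x', y, hw, -, -, hx, rfl⟩ := hO.1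
      simp only [Option.some.injEq, Term.name.injEq, Name.free.injEq] at hx
      subst hx
      exact contra y _ hw hp
    | outThen hp _ =>
      obtain ⟨x', y, hw, -, -, hx, rfl⟩ := hO.1.1
      simp only [Option.some.injEq, Term.name.injEq, Name.free.injEq] at hx
      subst hx
      exact contra y _ hw hp
  | par Q _ h ih => exact fun h => ih A h.1
  | nu a h ih => exact fun h' => ih _ ((hΦ.live_nu h.mem.1.1 a A).1 h')
  | struct h _ _ ih =>
    exact fun h' => ih A ((hΦ.live_iff_of_structEq (fun _ _ _ _ _ => Iff.rfl) h A).1 h')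

/-- The process neither reduces nor succeeds. -/
def Inert (L : Lang) (P : Proc) : Prop := (∀ P', ¬ Red L P P') ∧ ¬ Succeeds L P

/-- Without reductions, success would have to be visible at once up to structural equivalence, but
`MonadicPrefix` excludes an active success. -/
theorem inert_of_live {L : Lang} {w : ℕ → ℕ → Prop} {u : ℕ → Option ℕ → Prop}
    (hwu : ∀ x y, w x y → ¬ u x none ∧ ¬ u x (some y)) {P : Proc}
    (h : Live (fun _ => MonadicPrefix w u ∅) P) : Inert L P := by
  have hr : ∀ P', ¬ Red L P P' := fun P' h' => not_red_of_live hwu h' ∅ h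
  refine ⟨hr, ?_⟩
  rintro ⟨Q, R, hPQ, hQ⟩
  rcases Relation.ReflTransGen.cases_head hPQ with rfl | ⟨P', h', -⟩
  · exact (((isPrefixFamily_monadicPrefix w u).live_iff_of_structEq (fun _ _ _ _ _ => Iff.rfl)
      hQ ∅).1 h).2
  · exact hr P' h'

end Coord

namespace Coord

/-! ## Languages and renaming, backwards -/

theorem Lang.OkTerm.of_subst {L : Lang} {r : Name → Name} {t : Term}
    (h : L.OkTerm (t.subst fun v => .name (r v))) : L.OkTerm t := by
  cases hm : L.matching with
  | I => simp [Lang.OkTerm, hm]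
  | NO | NM =>
    simp only [Lang.OkTerm, hm] at h ⊢
    cases t with
    | name v => exact ⟨v, rfl⟩
    | comp s t => simp [Term.subst] at h

theorem Lang.OkPat.of_subst {L : Lang} {r : Name → Name} {p : Pat}
    (h : L.OkPat (p.subst fun v => .name (r v))) : L.OkPat p := by
  cases hm : L.matching <;> simp only [Lang.OkPat, hm] at h ⊢ <;>
    cases p <;> simp_all [Pat.subst, Term.toPat]

theorem Lang.OkChan.of_subst {L : Lang} {r : Name → Name} {c : Option Term}
    (h : L.OkChan (c.map (Term.subst fun v => .name (r v)))) : L.OkChan c := by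
  cases hm : L.medium with
  | D => simpa [Lang.OkChan, hm] using h
  | C =>
    simp only [Lang.OkChan, hm] at h ⊢
    obtain ⟨s, hs, ht⟩ := h
    obtain ⟨s, rfl, rfl⟩ := Option.map_eq_some_iff.1 hs
    exact ⟨s, rfl, ht.of_subst⟩

theorem Lang.OkOut.of_subst {L : Lang} {r : Name → Name} {c : Option Term} {d : List Term}
    (h : L.OkOut (c.map (Term.subst fun v => .name (r v)))
      (d.map (Term.subst fun v => .name (r v)))) : L.OkOut c d :=
  ⟨h.1.of_subst, by simpa using h.2.1,
    fun t ht => (h.2.2 _ (List.mem_map_of_mem ht)).of_subst⟩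

theorem Lang.OkInp.of_subst {L : Lang} {r : Name → Name} {i : Inp}
    (h : L.OkInp (i.subst fun v => .name (r v))) : L.OkInp i :=
  ⟨h.1.of_subst, by simpa [Inp.subst] using h.2.1,
    fun t ht => (h.2.2 _ (List.mem_map_of_mem ht)).of_subst⟩

theorem Lang.OkJoin.of_subst {L : Lang} {r : Name → Name} {I : List Inp}
    (h : L.OkJoin (I.map (Inp.subst fun v => .name (r v)))) : L.OkJoin I := by
  refine ⟨?_, fun i hi => (h.2 _ (List.mem_map_of_mem hi)).of_subst⟩
  cases hm : L.coord <;> simpa [Lang.OkJoin, hm] using h.1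

/-- A context is known to belong to a language only through its filling by `0`, whose binders have
already closed their names. Going backwards through the closing recovers membership of the parts. -/
theorem Lang.Admits.of_ren {L : Lang} {r : ℕ → Name → Name} {d : ℕ} {P : Proc}
    (h : L.Admits (P.ren r d)) : L.Admits P := by
  induction P generalizing d with
  | nil | ok => trivial
  | out c t => exact ⟨h.1, h.2.of_subst⟩
  | outThen c t P ih => exact ⟨h.1, h.2.1.of_subst, ih h.2.2⟩
  | join I P ih => exact ⟨h.1.of_subst, ih h.2⟩
  | res P ih => exact ih (d := d + 1) h
  | par P Q ihP ihQ => exact ⟨ihP h.1, ihQ h.2⟩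
  | ite s t P Q ihP ihQ => exact ⟨ihP h.1, ihQ h.2⟩
  | rep P ih => exact ih (d := d) h

theorem Lang.Admits.of_close {L : Lang} {xs : List ℕ} {P : Proc} (h : L.Admits (P.close xs)) :
    L.Admits P := by
  rw [Proc.close_eq_ren] at h
  exact h.of_ren

/-! ## Supply and demand in contexts -/

namespace Ctx

theorem closedAt_fill {k : ℕ} {K : Ctx k} (hK : K.WellFormed) {S : Fin k → Proc}
    (hS : ∀ i, (S i).ClosedAt 0) : (K.fill S).ClosedAt 0 := by
  induction K with
  | hole i => exact hS i
  | nil | ok => trivial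
  | out c d => exact hK
  | outThen c d K ih => exact ⟨hK.1, hK.2.1, ih hK.2.2⟩
  | join I xs K ih =>
    refine ⟨hK.1, ?_⟩
    rw [zero_add, ← hK.2.2.1]
    exact Proc.closedAt_close (ih hK.2.2.2) xs
  | res a K ih => exact Proc.closedAt_nu (ih hK) a
  | par K K₂ ih ih₂ => exact ⟨ih hK.1, ih₂ hK.2⟩
  | ite s t K K₂ ih ih₂ => exact ⟨hK.1, hK.2.1, ih hK.2.2.1, ih₂ hK.2.2.2⟩
  | rep K ih => exact ih hK

theorem admits_fill {L : Lang} {k : ℕ} {K : Ctx k} (hK : L.Admits (K.fill fun _ => .nil))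
    {S : Fin k → Proc} (hS : ∀ i, L.Admits (S i)) : L.Admits (K.fill S) := by
  induction K with
  | hole i => exact hS i
  | nil | ok | out => exact hK
  | outThen c d K ih => exact ⟨hK.1, hK.2.1, ih hK.2.2⟩
  | join I xs K ih => exact ⟨hK.1, (ih hK.2.of_close).close xs⟩
  | res a K ih => exact (ih (Lang.Admits.of_close (xs := [a]) hK)).close [a]
  | par K K₂ ih ih₂ => exact ⟨ih hK.1, ih₂ hK.2⟩
  | ite s t K K₂ ih ih₂ => exact ⟨ih hK.1, ih₂ hK.2⟩
  | rep K ih => exact ih hK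

/-- In a context with two holes, the supply is an affine function of the supplies of the holes. -/
theorem exists_supply_fill {K : Ctx 2} (hK : K.WellFormed) {κ : Obs} (hκ : κ.ClosedAt 0) :
    ∃ c p q : ℕ∞, ∀ S : Fin 2 → Proc, (∀ i, (S i).ClosedAt 0) →
      supply κ (K.fill S) = c + p * supply κ (S 0) + q * supply κ (S 1) := by
  induction K with
  | hole i =>
    fin_cases i
    · exact ⟨0, 1, 0, fun S _ => by simp [fill]⟩
    · exact ⟨0, 0, 1, fun S _ => by simp [fill]⟩
  | nil => exact ⟨supply κ .nil, 0, 0, fun S _ => by simp [fill]⟩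
  | ok => exact ⟨supply κ .ok, 0, 0, fun S _ => by simp [fill]⟩
  | out c d => exact ⟨supply κ (.out c d), 0, 0, fun S _ => by simp [fill]⟩
  | outThen c d K => exact ⟨outSupply κ d, 0, 0, fun S _ => by
      rcases κ with _ | k | v <;> simp [fill, supply]⟩
  | join I xs K => exact ⟨0, 0, 0, fun S _ => by simp [fill, supply]⟩
  | res a K ih =>
    obtain ⟨c, p, q, h⟩ := ih hK
    by_cases hκa : κ = .name (.free a)
    · subst hκa
      -- A restricted name is offered to nobody outside, whatever the holes contain.
      refine ⟨0, 0, 0, fun S hS => ?_⟩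
      simp [fill, supply_nu (closedAt_fill (show K.WellFormed from hK) hS)]
    · refine ⟨c, p, q, fun S hS => ?_⟩
      have hc := closedAt_fill (show K.WellFormed from hK) hS
      rw [← h S hS]
      change supply κ (.nu a (K.fill S)) = _
      rcases κ with _ | k | (b | i)
      · rw [supply_nu_ok hc]
      · rw [supply_nu_len hc]
      · rw [supply_nu hc, if_neg fun h => hκa (by rw [h])]
      · exact absurd hκ (Nat.not_lt_zero i)
  | par K K₂ ih ih₂ =>
    obtain ⟨c, p, q, h⟩ := ih hK.1
    obtain ⟨c', p', q', h'⟩ := ih₂ hK.2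
    refine ⟨c + c', p + p', q + q', fun S hS => ?_⟩
    simp only [fill, supply, h S hS, h' S hS]
    ring
  | ite s t K K₂ ih ih₂ =>
    by_cases hst : s = t
    · obtain ⟨c, p, q, h⟩ := ih hK.2.2.1
      exact ⟨c, p, q, fun S hS => by simpa [fill, supply, hst] using h S hS⟩
    · obtain ⟨c, p, q, h⟩ := ih₂ hK.2.2.2
      exact ⟨c, p, q, fun S hS => by simpa [fill, supply, hst] using h S hS⟩
  | rep K ih =>
    obtain ⟨c, p, q, h⟩ := ih hK
    refine ⟨⊤ * c, ⊤ * p, ⊤ * q, fun S hS => ?_⟩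
    simp only [fill, supply, h S hS]
    ring

end Ctx

/-- The observables that can matter in a context of `L`. -/
def Obs.Counts (L : Lang) : Obs → Prop
  | .name v => L.matching ≠ .NO ∧ v.ClosedAt 0
  | _ => True

theorem Obs.Counts.closedAt {L : Lang} {κ : Obs} (h : κ.Counts L) : κ.ClosedAt 0 := by
  rcases κ with _ | k | v
  · trivial
  · trivial
  · exact h.2

/-- The two processes supply the same. -/
def Similar (L : Lang) (P Q : Proc) : Prop := ∀ κ : Obs, κ.Counts L → supply κ P = supply κ Q

theorem Similar.fill {L : Lang} {K : Ctx 2} (hK : K.WellFormed) {S T : Fin 2 → Proc}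
    (hS : ∀ i, (S i).ClosedAt 0) (hT : ∀ i, (T i).ClosedAt 0) (h : ∀ i, Similar L (S i) (T i)) :
    Similar L (K.fill S) (K.fill T) := by
  intro κ hκ
  obtain ⟨c, p, q, hf⟩ := Ctx.exists_supply_fill hK hκ.closedAt
  rw [hf S hS, hf T hT, h 0 κ hκ, h 1 κ hκ]

theorem FiresIn.mono_counts {L : Lang} {P : Proc} (hP : L.Mem P) {e e' : Obs → ℕ∞}
    (he : ∀ κ : Obs, κ.Counts L → e κ ≤ e' κ) (h : FiresIn P e) : FiresIn P e' := by
  refine FiresIn.mono (L := L) (m := L.matching ≠ .NO) hP.1 ?_ (fun κ hκ => ?_) h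
  · by_cases hm : L.matching = .NO
    · exact Or.inr ⟨hm, hP.2⟩
    · exact Or.inl hm
  · rcases κ with _ | k | v
    · exact he _ trivial
    · exact he _ trivial
    · exact he _ ⟨hκ.1, hκ.2.1⟩

/-- If processes in the holes of a context are replaced by similar ones, all but one of them,
then the context still fires for at least one choice of the exception. -/
theorem FiresIn.fill_update {L : Lang} {K : Ctx 2} (hK : K.WellFormed)
    (hL : L.Admits (K.fill fun _ => .nil)) {S T : Fin 2 → Proc} (hS : ∀ i, L.Mem (S i))
    (hT : ∀ i, L.Mem (T i)) (hST : ∀ i, Similar L (S i) (T i)) {e e' : Obs → ℕ∞}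
    (he : ∀ κ : Obs, κ.Counts L → e κ ≤ e' κ) (h : FiresIn (K.fill S) e) :
    ∃ i, FiresIn (K.fill (Function.update T i (S i))) e' := by
  have hU : ∀ i j, L.Mem (Function.update T i (S i) j) := by
    intro i j
    by_cases hij : j = i
    · subst hij; simpa using hS j
    · simpa [hij] using hT j
  have hSU : ∀ i j, Similar L (S j) (Function.update T i (S i) j) := by
    intro i j
    by_cases hij : j = i
    · subst hij; rw [Function.update_self]; exact fun κ _ => rfl
    · simpa [hij] using hST j
  induction K generalizing e e' with
  | hole i =>
    -- The firing join lies inside hole `i`, whose contents must therefore be kept.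
    refine ⟨i, ?_⟩
    simp only [Ctx.fill, Function.update_self] at h ⊢
    exact h.mono_counts (hS i) he
  | nil | ok | out | outThen => exact h.elim
  | join I xs K =>
    -- The firing join belongs to the context, so either hole may be the exception.
    refine ⟨0, fun κ => ?_⟩
    by_cases h0 : demand κ I = 0
    · simp [h0]
    · refine (h κ).trans (he κ ?_)
      rcases κ with _ | k | v
      · trivial
      · trivial
      · exact ⟨fun hm => h0 (hL.1.demand_name hm v), (name_of_demand_ne_zero hK.1 h0).1⟩
  | res a K ih =>
    have hc := Ctx.closedAt_fill (show K.WellFormed from hK) fun i => (hS i).1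
    have hc' := fun i => Ctx.closedAt_fill (show K.WellFormed from hK) fun j => (hU i j).1
    rw [Ctx.fill, firesIn_nu hc] at h
    have he' : ∀ κ : Obs, κ.Counts L → envSet e a (supply (.name (.free a)) (K.fill S)) κ ≤
        envSet e' a (supply (.name (.free a)) (K.fill S)) κ := by
      intro κ hκ
      rcases κ with _ | k | (b | j)
      · exact he _ hκ
      · exact he _ hκ
      · by_cases hb : b = a
        · simp [envSet, hb]
        · simpa [envSet, hb] using he _ hκ
      · exact he _ hκ
    have hK' := Lang.Admits.of_close (xs := [a]) hL
    obtain ⟨i, hi⟩ := ih hK hK' he' h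
    refine ⟨i, (firesIn_nu (hc' i) a e').2 (hi.mono_counts
      ⟨hc' i, Ctx.admits_fill hK' fun j => (hU i j).2⟩ fun κ hκ => ?_)⟩
    rcases κ with _ | k | (b | j)
    · exact le_rfl
    · exact le_rfl
    · by_cases hb : b = a
      · subst hb
        -- The restricted name is served by the filled context itself, and exchanging similar
        -- contents does not change that supply.
        simp only [envSet, if_true]
        exact (Similar.fill (K := K) hK (fun i => (hS i).1) (fun j => (hU i j).1) (hSU i) _ hκ).le
      · simp [envSet, hb]
    · exact le_rfl
  | par K K₂ ih ih₂ =>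
    rcases h with h | h
    · obtain ⟨i, hi⟩ := ih hK.1 hL.1 he h
      exact ⟨i, Or.inl hi⟩
    · obtain ⟨i, hi⟩ := ih₂ hK.2 hL.2 he h
      exact ⟨i, Or.inr hi⟩
  | ite s t K K₂ ih ih₂ =>
    by_cases hst : s = t
    · obtain ⟨i, hi⟩ := ih hK.2.2.1 hL.1 he (by simpa [Ctx.fill, FiresIn, hst] using h)
      exact ⟨i, by simpa [Ctx.fill, FiresIn, hst] using hi⟩
    · obtain ⟨i, hi⟩ := ih₂ hK.2.2.2 hL.2 he (by simpa [Ctx.fill, FiresIn, hst] using h)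
      exact ⟨i, by simpa [Ctx.fill, FiresIn, hst] using hi⟩
  | rep K ih =>
    obtain ⟨i, hi⟩ := ih hK hL he h
    exact ⟨i, hi⟩

end Coord

namespace Coord

/-! ## Separation -/

/-- Suppose that `S` is stuck and its translation reduces. By soundness every reduct of the
translation reaches something equivalent to the translation again, as `S` itself is its only
derivative. That can reduce, by reduction sensitivity, so no reduct is final and the translation
diverges; but then `S` would diverge. -/
theorem Encoding.IsValid.not_red {L₁ L₂ : Lang} {E : Proc → Proc → Prop}
    (hE : IsReferenceEquivalence L₂ E) {e : Encoding} (he : e.IsValid L₁ L₂ E) {S : Proc}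
    (hS : L₁.Mem S) (hi : ∀ S', ¬ Red L₁ S S') : ∀ T, ¬ Red L₂ (e.tr S) T := by
  intro T hT
  have hSm := he.maps S hS
  have key : ∀ U, Reds L₂ (e.tr S) U → ∃ U', Red L₂ U U' := by
    intro U hU
    obtain ⟨S', hSS', T', hT', hE'⟩ := he.op_sound S U hS hU
    rcases Relation.ReflTransGen.cases_head hSS' with rfl | ⟨S'', h', -⟩
    · have hUm := Reds.mem hU hSm
      have hTm := Reds.mem hT' hUm
      obtain ⟨T'', hT''⟩ := hE.reduction_sensitive _ _ hSm hTm (hE.symm _ _ hTm hSm hE') ⟨T, hT⟩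
      rcases Relation.ReflTransGen.cases_head hT' with rfl | ⟨V, hV, -⟩
      · exact ⟨T'', hT''⟩
      · exact ⟨V, hV⟩
    · exact absurd h' (hi S'')
  choose! f hf using key
  have hr : ∀ n, Reds L₂ (e.tr S) (f^[n] (e.tr S)) := by
    intro n
    induction n with
    | zero => exact .refl
    | succ n ih =>
      rw [Function.iterate_succ_apply']
      exact ih.tail (hf _ ih)
  obtain ⟨g, hg0, hg⟩ := he.divergence_reflecting S hS ⟨fun n => f^[n] (e.tr S), rfl, fun n => by
    simp only [Function.iterate_succ_apply']
    exact hf _ (hr n)⟩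
  exact hi (g 1) (hg0 ▸ hg 0)

theorem Encoding.IsValid.inert {L₁ L₂ : Lang} {E : Proc → Proc → Prop}
    (hE : IsReferenceEquivalence L₂ E) {e : Encoding} (he : e.IsValid L₁ L₂ E) {S : Proc}
    (hS : L₁.Mem S) (hi : Inert L₁ S) : Inert L₂ (e.tr S) :=
  ⟨he.not_red hE hS hi.1, fun h => hi.2 ((he.success_sensitive S hS).2 h)⟩

/-- For simple languages inertness becomes a statement about counts alone, which the context lemmas
can handle. -/
theorem inert_iff {L : Lang} (hL : L.Simple) {P : Proc} (hP : L.Mem P) :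
    Inert L P ↔ ¬ Fires P ∧ supply .ok P = 0 := by
  constructor
  · intro h
    refine ⟨fun hf => ?_, ?_⟩
    · obtain ⟨P', h'⟩ := hf.exists_red hL hP
      exact h.1 P' h'
    · by_contra h0
      obtain ⟨R, hR⟩ := exists_structEq_ok hP h0
      exact h.2 ⟨P, R, .refl, hR⟩
  · intro ⟨h₁, h₂⟩
    refine ⟨fun P' h => h₁ h.fires, ?_⟩
    rintro ⟨Q, R, hPQ, hQ⟩
    rcases Relation.ReflTransGen.cases_head hPQ with rfl | ⟨P', h', -⟩
    · rw [hQ.supply_eq (κ := .ok) trivial] at h₂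
      simp [supply] at h₂
    · exact h₁ h'.fires

/-- The binary context for parallel composition of processes with the free names `N`. -/
theorem Encoding.IsValid.exists_par_context {L₁ L₂ : Lang} {E : Proc → Proc → Prop}
    {e : Encoding} (he : e.IsValid L₁ L₂ E) (N : Set ℕ) :
    ∃ K : Ctx 2, K.WellFormed ∧ L₂.Admits (K.fill fun _ => .nil) ∧
      ∀ P Q, L₁.Mem P → L₁.Mem Q → P.fn ∪ Q.fn = N →
        e.tr (.par P Q) = K.fill fun i => e.tr (![P, Q] i) := by
  obtain ⟨K, hK, h⟩ := he.compositional 2 _ .par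
    ⟨⟨trivial, trivial⟩, L₁.mem_nil.par L₁.mem_nil, fun i => by
      fin_cases i <;> simp [Ctx.occurrences]⟩ N
  refine ⟨K, hK.1, hK.2.1.2, fun P Q hP hQ hN => ?_⟩
  refine h ![P, Q] (fun i => by fin_cases i <;> simpa) ?_
  rw [← hN]
  ext x
  simp [Fin.exists_fin_two]

/-- There is no valid encoding of a language into a simple one, when in a successful parallel
composition each side can be replaced by one with a similar translation, such that the result
is inert. -/
theorem Encoding.IsValid.false_of_similar {L₁ L₂ : Lang} (hL : L₂.Simple)
    {E : Proc → Proc → Prop} (hE : IsReferenceEquivalence L₂ E) {e : Encoding}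
    (he : e.IsValid L₁ L₂ E) {A A' B B' : Proc} (hA : L₁.Mem A) (hA' : L₁.Mem A') (hB : L₁.Mem B)
    (hB' : L₁.Mem B') {N : Set ℕ} (hN : A.fn ∪ B.fn = N) (hN₁ : A'.fn ∪ B.fn = N)
    (hN₂ : A.fn ∪ B'.fn = N) (hs : Succeeds L₁ (.par A B)) (hi₁ : Inert L₁ (.par A' B))
    (hi₂ : Inert L₁ (.par A B')) (hsA : Similar L₂ (e.tr A) (e.tr A'))
    (hsB : Similar L₂ (e.tr B) (e.tr B')) : False := by
  -- The context may depend on the free names of the arguments; as these are `N` in all three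
  -- compositions, one context serves them all.
  obtain ⟨K, hK, hKL, hKf⟩ := he.exists_par_context N
  have hmem : ∀ {P Q : Proc}, L₁.Mem P → L₁.Mem Q → ∀ i : Fin 2, L₂.Mem (e.tr (![P, Q] i)) := by
    intro P Q hP hQ i
    fin_cases i
    · exact he.maps _ hP
    · exact he.maps _ hQ
  have hsim : ∀ {P Q P' Q' : Proc}, Similar L₂ (e.tr P) (e.tr P') → Similar L₂ (e.tr Q) (e.tr Q') →
      ∀ i : Fin 2, Similar L₂ (e.tr (![P, Q] i)) (e.tr (![P', Q'] i)) := by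
    intro P Q P' Q' hP hQ i
    fin_cases i
    · exact hP
    · exact hQ
  have h₁ := (inert_iff hL (he.maps _ (hA'.par hB))).1 (he.inert hE (hA'.par hB) hi₁)
  have h₂ := (inert_iff hL (he.maps _ (hA.par hB'))).1 (he.inert hE (hA.par hB') hi₂)
  have hne : ¬ Inert L₂ (e.tr (.par A B)) :=
    fun h => h.2 ((he.success_sensitive _ (hA.par hB)).1 hs)
  rw [inert_iff hL (he.maps _ (hA.par hB))] at hne
  apply hne
  have hs₁ : Similar L₂ (e.tr (.par A B)) (e.tr (.par A' B)) := by
    rw [hKf A B hA hB hN, hKf A' B hA' hB hN₁]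
    exact Similar.fill hK (fun i => (hmem hA hB i).1) (fun i => (hmem hA' hB i).1)
      (hsim hsA fun _ _ => rfl)
  -- Immediate success is excluded because `A' | B` offers equally much of it, namely none. What
  -- remains is to refute firing.
  refine ⟨fun hf => ?_, (hs₁ .ok trivial).trans h₁.2⟩
  have hs₂ : Similar L₂ (e.tr (.par A B)) (e.tr (.par A B')) := by
    rw [hKf A B hA hB hN, hKf A B' hA hB' hN₂]
    exact Similar.fill hK (fun i => (hmem hA hB i).1) (fun i => (hmem hA hB' i).1)
      (hsim (fun _ _ => rfl) hsB)
  -- It is not known in advance which hole will be the exception, so the environment is the minimum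
  -- of the supplies of the two possible outcomes.
  have hmax : ∀ κ : Obs, κ.Counts L₂ →
      supply κ (e.tr (.par A B)) ≤ min (supply κ (e.tr (.par A' B))) (supply κ (e.tr (.par A B'))) :=
    fun κ hκ => le_min (hs₁ κ hκ).le (hs₂ κ hκ).le
  unfold Fires at hf
  rw [hKf A B hA hB hN] at hf hmax
  obtain ⟨i, hi⟩ := FiresIn.fill_update hK hKL (hmem hA hB) (hmem hA' hB') (hsim hsA hsB) hmax hf
  -- Keeping `A` leads to the composition with `B'`, keeping `B` to the one with `A'`; both are
  -- inert.
  have hupd : ∀ i : Fin 2, Function.update (fun j => e.tr (![A', B'] j)) i (e.tr (![A, B] i)) =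
      fun j => e.tr ((if i = 0 then ![A, B'] else ![A', B]) j) := by
    intro i
    funext j
    fin_cases i <;> fin_cases j <;> rfl
  rw [hupd] at hi
  by_cases h0 : i = 0
  · rw [if_pos h0, ← hKf A B' hA hB' hN₂] at hi
    exact h₂.1 (hi.mono_counts (he.maps _ (hA.par hB')) fun κ _ => min_le_right _ _)
  · rw [if_neg h0, ← hKf A' B hA' hB hN₁] at hi
    exact h₁.1 (hi.mono_counts (he.maps _ (hA'.par hB)) fun κ _ => min_le_left _ _)

/-! ## Induced substitutions -/

/-- `σ'` is induced by `σ` through the renaming policy. -/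
def Encoding.Induces (e : Encoding) (σ σ' : ℕ → ℕ) : Prop :=
  (∀ a i, e.policy (σ a) i = σ' (e.policy a i)) ∧ ∀ b, (∀ a i, e.policy a i ≠ b) → σ' b = b

/-- Name invariance supplies a substitution for each process separately. Its values are forced on
the tuples of the policy and elsewhere, so it is the same for all processes. -/
theorem Encoding.Induces.unique {e : Encoding} {σ σ' σ'' : ℕ → ℕ} (h : e.Induces σ σ')
    (h' : e.Induces σ σ'') : σ' = σ'' := by
  funext b
  by_cases hb : ∀ a i, e.policy a i ≠ b
  · rw [h.2 b hb, h'.2 b hb]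
  · push Not at hb
    obtain ⟨a, i, rfl⟩ := hb
    rw [← h.1, h'.1]

theorem Encoding.Induces.involutive {e : Encoding} {σ σ' : ℕ → ℕ} (h : e.Induces σ σ')
    (hσ : Function.Involutive σ) : Function.Involutive σ' := by
  intro b
  by_cases hb : ∀ a i, e.policy a i ≠ b
  · rw [h.2 b hb, h.2 b hb]
  · push Not at hb
    obtain ⟨a, i, rfl⟩ := hb
    rw [← h.1, ← h.1, hσ a]

theorem Encoding.IsValid.exists_induced {L₁ L₂ : Lang} {E : Proc → Proc → Prop} {e : Encoding}
    (he : e.IsValid L₁ L₂ E) (a b : ℕ) :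
    ∃ σ', e.Induces (Equiv.swap a b) σ' ∧ Function.Involutive σ' ∧
      ∀ S, L₁.Mem S → e.tr (S.rename (Equiv.swap a b)) = (e.tr S).rename σ' := by
  have hfin : {c | Equiv.swap a b c ≠ c}.Finite := by
    refine (Set.toFinite {a, b}).subset fun c hc => ?_
    by_contra h
    simp only [Set.mem_insert_iff, Set.mem_singleton_iff, not_or] at h
    exact hc (Equiv.swap_apply_of_ne_of_ne h.1 h.2)
  -- Any process would do here; uniqueness makes the result valid for all of them.
  obtain ⟨σ', h₁, h₂, -⟩ := he.name_invariant .nil L₁.mem_nil _ hfin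
  have hσ' : e.Induces (Equiv.swap a b) σ' := ⟨h₁, h₂⟩
  refine ⟨σ', hσ', hσ'.involutive (Equiv.swap_apply_self a b), fun S hS => ?_⟩
  obtain ⟨σ'', h₁', h₂', h₃, -⟩ := he.name_invariant S hS _ hfin
  rw [h₃ (Equiv.injective _), hσ'.unique ⟨h₁', h₂'⟩]

/-! ### Supply under induced substitutions -/

theorem supply_rename {P : Proc} (hP : P.ClosedAt 0) {σ : ℕ → ℕ} (hσ : Function.Involutive σ)
    (a : ℕ) : supply (.name (.free a)) (P.rename σ) = supply (.name (.free (σ a))) P := by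
  have := supply_ren (isRenaming_renameMap σ) (injOn_renameMap hσ.injective 0) hP
    (κ := .name (.free (σ a))) trivial
  rwa [← Proc.rename_eq_ren, Obs.map, renameMap, hσ a] at this

theorem supply_rename_of_not_name {P : Proc} (hP : P.ClosedAt 0) {σ : ℕ → ℕ}
    (hσ : Function.Involutive σ) {κ : Obs} (hκ : ∀ v, κ ≠ .name v) :
    supply κ (P.rename σ) = supply κ P := by
  rw [Proc.rename_eq_ren]
  rcases κ with _ | k | v
  · exact supply_ren (isRenaming_renameMap σ) (injOn_renameMap hσ.injective 0) hP (κ := .ok) trivial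
  · exact supply_ren (isRenaming_renameMap σ) (injOn_renameMap hσ.injective 0) hP (κ := .len k)
      trivial
  · exact absurd rfl (hκ v)

/-- Without matching, the translations of a process and of its renaming are similar. -/
theorem Encoding.IsValid.similar_rename {L₁ L₂ : Lang} (hL : L₂.matching = .NO)
    {E : Proc → Proc → Prop} {e : Encoding} (he : e.IsValid L₁ L₂ E) {S : Proc} (hS : L₁.Mem S)
    (a b : ℕ) : Similar L₂ (e.tr S) (e.tr (S.rename (Equiv.swap a b))) := by
  obtain ⟨σ', -, hσ', h⟩ := he.exists_induced a b
  intro κ hκ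
  rw [h S hS, supply_rename_of_not_name (he.maps S hS).1 hσ']
  rintro v rfl
  exact hκ.1 hL

theorem mem_rename {L : Lang} {S : Proc} (hS : L.Mem S) (σ : ℕ → ℕ) : L.Mem (S.rename σ) := by
  refine ⟨Proc.closedAt_subst hS.1 fun m v hv => ?_, hS.2.subst (fun d v => ?_) 0⟩
  · rcases v with a | i
    · trivial
    · simpa [Name.ClosedAt, Term.ClosedAt] using hv
  · rcases v with a | i <;> exact L.okTerm_name _

/-- Swapping the names on one side of a pair of processes that differ by swaps of disjoint pairs
of names does not change the joint supply of their translations. -/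
theorem Encoding.IsValid.supply_add {L₁ L₂ : Lang} {E : Proc → Proc → Prop} {e : Encoding}
    (he : e.IsValid L₁ L₂ E) {S : Proc} (hS : L₁.Mem S) {a b m n : ℕ} (ham : a ≠ m) (han : a ≠ n)
    (hbm : b ≠ m) (hbn : b ≠ n) {κ : Obs} (hκ : κ.ClosedAt 0) :
    supply κ (e.tr S) +
        supply κ (e.tr ((S.rename (Equiv.swap a b)).rename (Equiv.swap m n))) =
      supply κ (e.tr (S.rename (Equiv.swap m n))) +
        supply κ (e.tr (S.rename (Equiv.swap a b))) := by
  obtain ⟨ρ, hρ, hρi, hρS⟩ := he.exists_induced a b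
  obtain ⟨τ, hτ, hτi, hτS⟩ := he.exists_induced m n
  have h₀ := (he.maps S hS).1
  have hm := mem_rename hS (Equiv.swap a b)
  have h₁ := (he.maps _ hm).1
  rw [hτS _ hm, hτS _ hS]
  rcases κ with _ | k | (v | i)
  · simp only [supply_rename_of_not_name h₁ hτi (κ := .ok) (by simp),
      supply_rename_of_not_name h₀ hτi (κ := .ok) (by simp)]
  · simp only [supply_rename_of_not_name h₁ hτi (κ := .len k) (by simp),
      supply_rename_of_not_name h₀ hτi (κ := .len k) (by simp)]
  · rw [supply_rename h₁ hτi, supply_rename h₀ hτi, hρS S hS, supply_rename h₀ hρi,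
      supply_rename h₀ hρi]
    -- No name is moved by both induced substitutions, even if tuples of the policy overlap: a name
    -- in the tuple of `m` or `n` is in the tuple of a name that the swap of `a, b` fixes, so `ρ`
    -- fixes it; any other name is fixed by `τ`.
    have key : ∀ v, τ v = v ∨ ρ v = v := by
      intro v
      by_cases hv : ∀ c i, e.policy c i ≠ v
      · exact Or.inl (hτ.2 v hv)
      · push Not at hv
        obtain ⟨c, i, rfl⟩ := hv
        by_cases hc : c = m ∨ c = n
        · right
          rw [← hρ.1, Equiv.swap_apply_of_ne_of_ne]
          · rintro rfl; tauto
          · rintro rfl; tauto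
        · left
          rw [not_or] at hc
          rw [← hτ.1, Equiv.swap_apply_of_ne_of_ne hc.1 hc.2]
    -- If `τ` fixes `v`, the two sums agree term by term. Otherwise `ρ` fixes both `v` and `τ v`,
    -- and the sums differ only in the order of their terms.
    by_cases hv : τ v = v
    · rw [hv]
    · rw [(key v).resolve_left hv, (key (τ v)).resolve_left fun h => hv (by rw [hτi v] at h; exact h.symm),
        add_comm]
  · exact absurd hκ (Nat.not_lt_zero i)

end Coord

namespace Coord

/-! ## The processes that separate -/

theorem Succeeds.of_structEq {L : Lang} {P Q : Proc} (h : StructEq L P Q) (hQ : Succeeds L Q) :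
    Succeeds L P := by
  obtain ⟨Q', R, hr, hs⟩ := hQ
  rcases Relation.ReflTransGen.cases_head hr with rfl | ⟨Q₁, h₁, h₂⟩
  · exact ⟨P, R, .refl, h.trans hs⟩
  · exact ⟨Q', R, .head (h₁.of_structEq h) h₂, hs⟩

/-- A monadic output on the channel `x`, without continuation. -/
def sendOn (α : Synchronism) (x y : ℕ) : Proc :=
  match α with
  | .A => .out (some (.name (.free x))) [.name (.free y)]
  | .S => .outThen (some (.name (.free x))) [.name (.free y)] .nil

/-- A monadic input on the channel `x`, followed by success. -/
def receiveOn (x : ℕ) (p : Option ℕ) : Proc :=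
  .join [⟨some (.name (.free x)), [patOf p]⟩] .ok

theorem fn_sendOn (α : Synchronism) (x y : ℕ) : (sendOn α x y).fn = {x, y} := by
  cases α <;> simp [sendOn, Proc.fn, Term.fn, Name.fn, Set.pair_comm]

theorem fn_receiveOn_none (x : ℕ) : (receiveOn x none).fn = {x} := by
  simp [receiveOn, Proc.fn, Inp.fn, Term.fn, Name.fn, Pat.fn, patOf]

theorem fn_receiveOn_some (x y : ℕ) : (receiveOn x (some y)).fn = {x, y} := by
  simp [receiveOn, Proc.fn, Inp.fn, Term.fn, Name.fn, Pat.fn, patOf, Set.pair_comm]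

theorem rename_sendOn (α : Synchronism) (x y : ℕ) (σ : ℕ → ℕ) :
    (sendOn α x y).rename σ = sendOn α (σ x) (σ y) := by
  cases α <;> rfl

theorem rename_receiveOn (x : ℕ) (p : Option ℕ) (σ : ℕ → ℕ) :
    (receiveOn x p).rename σ = receiveOn (σ x) (p.map σ) := by
  cases p <;> rfl

theorem mem_sendOn (α : Synchronism) (β : Arity) (δ : Matching) (ε : Coordination) (x y : ℕ) :
    Lang.Mem ⟨α, β, .C, δ, ε⟩ (sendOn α x y) := by
  have hout : Lang.OkOut ⟨α, β, .C, δ, ε⟩ (some (.name (.free x))) [.name (.free y)] := by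
    refine ⟨⟨_, rfl, Lang.okTerm_name _ _⟩, ?_, by simpa using Lang.okTerm_name _ _⟩
    cases β <;> simp [Lang.OkLength]
  cases α with
  | A => exact ⟨by simp [sendOn, Proc.ClosedAt, Term.ClosedAt, Name.ClosedAt], rfl, hout⟩
  | S => exact ⟨by simp [sendOn, Proc.ClosedAt, Term.ClosedAt, Name.ClosedAt], rfl, hout, trivial⟩

theorem mem_receiveOn (α : Synchronism) (β : Arity) {δ : Matching} (ε : Coordination) (x : ℕ)
    {p : Option ℕ} (hp : δ = .NO → p = none) :
    Lang.Mem ⟨α, β, .C, δ, ε⟩ (receiveOn x p) := by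
  refine ⟨?_, ⟨?_, ?_⟩, trivial⟩
  · cases p <;> simp [receiveOn, Proc.ClosedAt, Inp.ClosedAt, Pat.ClosedAt, Term.ClosedAt,
      Name.ClosedAt, patOf]
  · cases ε <;> simp
  · intro i hi
    obtain rfl := List.mem_singleton.1 hi
    refine ⟨⟨_, rfl, Lang.okTerm_name _ _⟩, ?_, ?_⟩
    · cases β <;> simp [Lang.OkLength]
    · cases δ with
      | NO => obtain rfl := hp rfl; simp [Lang.OkPat, patOf]
      | NM => cases p <;> simp [Lang.OkPat, patOf]
      | I => simp [Lang.OkPat]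

theorem succeeds_communication {α : Synchronism} {β : Arity} {δ : Matching} {ε : Coordination}
    {x y : ℕ} {p : Option ℕ} (hp : δ = .NO → p = none) (hpy : p = none ∨ p = some y) {R : Proc}
    (hR : Lang.Mem ⟨α, β, .C, δ, ε⟩ R) :
    Succeeds ⟨α, β, .C, δ, ε⟩ (.par (.par (sendOn α x y) (receiveOn x p)) R) := by
  have hs := mem_sendOn α β δ ε x y
  have hr := mem_receiveOn α β ε x hp
  obtain ⟨σ, hσ⟩ : ∃ σ, PolyMatch [.name (.free y)] [patOf p] σ := by
    rcases hpy with rfl | rfl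
    · exact ⟨_, .cons (.bind _) .nil⟩
    · exact ⟨_, .cons (.name _) .nil⟩
  obtain ⟨Ps, τ, hm⟩ : ∃ Ps τ, JoinMatch [sendOn α x y]
      [⟨some (.name (.free x)), [patOf p]⟩] Ps τ := by
    cases α with
    | A => exact ⟨_, _, .out hσ .nil⟩
    | S => exact ⟨_, _, .outThen hσ .nil⟩
  have hred := (Red.interact (Q := .ok) ((hs.par (Lang.mem_nil _)).par hr) hm).par R hR
  have hPs := (Lang.mem_par.1 (Lang.mem_par.1 hred.mem.2).1).1
  have hok := Lang.mem_ok ⟨α, β, .C, δ, ε⟩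
  refine Succeeds.of_structEq (((StructEq.par_nil hs).symm.par_left hr).par_left hR)
    ⟨_, .par (parList Ps) R, .single hred, ?_⟩
  exact (StructEq.par_assoc hPs hok hR).trans (((StructEq.par_comm hok hR).par_right hPs).trans
    (StructEq.par_assoc hPs hR hok).symm)

/-- Without matching, channels are not encodable in a dataspace, not even with joins. -/
theorem not_isValid_of_noMatching {α : Synchronism} {β : Arity} {ε ε' : Coordination}
    {E : Proc → Proc → Prop} (hE : IsReferenceEquivalence ⟨α, β, .D, .NO, ε'⟩ E) (e : Encoding) :
    ¬ e.IsValid ⟨α, β, .C, .NO, ε⟩ ⟨α, β, .D, .NO, ε'⟩ E := by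
  intro he
  have hs := fun x y => mem_sendOn α β .NO ε x y
  have hr := fun x => mem_receiveOn α β (δ := .NO) ε x (p := none) fun _ => rfl
  have hsim := he.similar_rename rfl (hs 0 1) 0 1
  have hsim' := he.similar_rename rfl (hr 0) 0 1
  rw [rename_sendOn] at hsim
  rw [rename_receiveOn] at hsim'
  simp only [Equiv.swap_apply_left, Equiv.swap_apply_right, Option.map_none] at hsim hsim'
  -- Each output carries the name of the other channel, which makes the free names of all three
  -- compositions equal to `{0, 1}`.
  refine he.false_of_similar ⟨rfl, Or.inl rfl⟩ hE (hs 0 1) (hs 1 0) (hr 0) (hr 1) (N := {0, 1})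
    ?_ ?_ ?_ ?_ ?_ ?_ hsim hsim'
  · rw [fn_sendOn, fn_receiveOn_none]; ext; simp
  · rw [fn_sendOn, fn_receiveOn_none]; ext; simp; tauto
  · rw [fn_sendOn, fn_receiveOn_none]; ext; simp
  · have := (hs 0 1).par (hr 0)
    exact (succeeds_communication (fun _ => rfl) (Or.inl rfl) (Lang.mem_nil _)).of_structEq
      (StructEq.par_nil this).symm
  · refine inert_of_live (w := fun x y => x = 1) (u := fun x p => x = 0) (by simp) ⟨?_, ?_⟩
    · cases α
      · exact ⟨1, 0, rfl, id, id, rfl, rfl⟩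
      · exact ⟨⟨1, 0, rfl, id, id, rfl, rfl⟩, trivial⟩
    · exact ⟨0, none, rfl, id, fun _ _ => id, rfl⟩
  · refine inert_of_live (w := fun x y => x = 0) (u := fun x p => x = 1) (by simp) ⟨?_, ?_⟩
    · cases α
      · exact ⟨0, 1, rfl, id, id, rfl, rfl⟩
      · exact ⟨⟨0, 1, rfl, id, id, rfl, rfl⟩, trivial⟩
    · exact ⟨1, none, rfl, id, fun _ _ => id, rfl⟩

/-! ### Separating pairs on four names -/

/-- A process that is equivalent to `0` and has the free names `0`, `1`, `2` and `3`. -/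
def idle : Proc :=
  .ite (.name (.free 0)) (.name (.free 1)) (.ite (.name (.free 2)) (.name (.free 3)) .nil .nil) .nil

theorem mem_idle (L : Lang) : L.Mem idle :=
  ⟨by simp [idle, Proc.ClosedAt, Term.ClosedAt, Name.ClosedAt], by simp [idle, Lang.Admits]⟩

theorem idle_structEq (L : Lang) : StructEq L idle .nil :=
  .ite_ne (by simp) (mem_idle L)

theorem fn_idle : idle.fn = {0, 1, 2, 3} := by
  ext
  simp [idle, Proc.fn, Term.fn, Name.fn]
  tauto

/-- `P` and `Q`, each in a left and in a right position of a parallel composition. -/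
def pair (P Q : Proc) : Proc := .par (.par idle P) (.par Q idle)

theorem fn_pair {P Q : Proc} (hP : P.fn ⊆ {0, 1, 2, 3}) (hQ : Q.fn ⊆ {0, 1, 2, 3}) :
    (pair P Q).fn = {0, 1, 2, 3} := by
  simp only [pair, Proc.fn, fn_idle]
  rw [Set.union_eq_left.2 hP, Set.union_eq_right.2 hQ, Set.union_self]

section

variable {L : Lang} {P Q : Proc}

theorem mem_pair (hP : L.Mem P) (hQ : L.Mem Q) : L.Mem (pair P Q) :=
  ((mem_idle L).par hP).par (hQ.par (mem_idle L))

theorem pair_structEq (hP : L.Mem P) (hQ : L.Mem Q) : StructEq L (pair P Q) (.par P Q) :=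
  StructEq.par (((idle_structEq L).par_left hP).trans (.nil_par hP))
    (((idle_structEq L).par_right hQ).trans (.par_nil hQ)) ((mem_idle L).par hP)
    (hQ.par (mem_idle L))

theorem live_pair {φ : ℕ → Proc → Prop} (hP : Live φ P) (hQ : Live φ Q) : Live φ (pair P Q) := by
  have : Live φ idle := by simp [idle, Live]
  exact ⟨⟨this, hP⟩, hQ, this⟩

end

/-- With `p` and `q` the coefficients of the left and right hole of a translated parallel
composition, `P` stands to the right inside the left part and `Q` to the left inside the right part,
so both get the coefficient `p * q` and only their sum matters. The copies of `idle` give all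
compositions involved the same free names, hence the same context. -/
theorem Encoding.IsValid.similar_pair {L₁ L₂ : Lang} {E : Proc → Proc → Prop} {e : Encoding}
    (he : e.IsValid L₁ L₂ E) {P Q P' Q' : Proc} (hP : L₁.Mem P) (hQ : L₁.Mem Q) (hP' : L₁.Mem P')
    (hQ' : L₁.Mem Q') (fP : P.fn ⊆ {0, 1, 2, 3}) (fQ : Q.fn ⊆ {0, 1, 2, 3})
    (fP' : P'.fn ⊆ {0, 1, 2, 3}) (fQ' : Q'.fn ⊆ {0, 1, 2, 3})
    (h : ∀ κ : Obs, κ.ClosedAt 0 → supply κ (e.tr P) + supply κ (e.tr Q) =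
      supply κ (e.tr P') + supply κ (e.tr Q')) :
    Similar L₂ (e.tr (pair P Q)) (e.tr (pair P' Q')) := by
  obtain ⟨K, hK, -, hKf⟩ := he.exists_par_context {0, 1, 2, 3}
  have hi := mem_idle L₁
  intro κ hκ
  obtain ⟨c, p, q, hf⟩ := Ctx.exists_supply_fill hK hκ.closedAt
  have hpar : ∀ P Q, L₁.Mem P → L₁.Mem Q → P.fn ∪ Q.fn = {0, 1, 2, 3} →
      supply κ (e.tr (.par P Q)) = c + p * supply κ (e.tr P) + q * supply κ (e.tr Q) := by
    intro P Q hP hQ hN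
    rw [hKf P Q hP hQ hN, hf]
    · rfl
    · intro i
      fin_cases i
      · exact (he.maps _ hP).1
      · exact (he.maps _ hQ).1
  have hpair : ∀ P Q, L₁.Mem P → L₁.Mem Q → P.fn ⊆ {0, 1, 2, 3} → Q.fn ⊆ {0, 1, 2, 3} →
      supply κ (e.tr (pair P Q)) = c + p * (c + p * supply κ (e.tr idle)) +
        q * (c + q * supply κ (e.tr idle)) + p * q * (supply κ (e.tr P) + supply κ (e.tr Q)) := by
    intro P Q hP hQ fP fQ
    rw [pair, hpar _ _ (hi.par hP) (hQ.par hi) (fn_pair fP fQ), hpar _ _ hi hP, hpar _ _ hQ hi]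
    · ring
    · rw [fn_idle, Set.union_eq_right.2 fQ]
    · rw [fn_idle, Set.union_eq_left.2 fP]
  rw [hpair P Q hP hQ fP fQ, hpair P' Q' hP' hQ' fP' fQ', h κ hκ.closedAt]

/-- In monadic languages with name matching, channels are not encodable in a dataspace, not even
with joins. -/
theorem not_isValid_of_monadic_nameMatching {α : Synchronism} {ε ε' : Coordination}
    {E : Proc → Proc → Prop} (hE : IsReferenceEquivalence ⟨α, .M, .D, .NM, ε'⟩ E) (e : Encoding) :
    ¬ e.IsValid ⟨α, .M, .C, .NM, ε⟩ ⟨α, .M, .D, .NM, ε'⟩ E := by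
  intro he
  have hs := fun x y => mem_sendOn α .M .NM ε x y
  have hr := fun x y => mem_receiveOn α .M (δ := .NM) ε x (p := some y) nofun
  have hsub : ∀ x y : ℕ, x < 4 → y < 4 → ({x, y} : Set ℕ) ⊆ {0, 1, 2, 3} := by
    rintro x y hx hy z (rfl | rfl) <;> simp only [Set.mem_insert_iff, Set.mem_singleton_iff] <;>
      omega
  have fs : ∀ x y : ℕ, x < 4 → y < 4 → (sendOn α x y).fn ⊆ {0, 1, 2, 3} := fun x y hx hy => by
    rw [fn_sendOn]; exact hsub x y hx hy
  have fr : ∀ x y : ℕ, x < 4 → y < 4 → (receiveOn x (some y)).fn ⊆ {0, 1, 2, 3} :=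
    fun x y hx hy => by rw [fn_receiveOn_some]; exact hsub x y hx hy
  have s01 : ∀ x, x ≠ 0 → x ≠ 1 → Equiv.swap 0 1 x = x := fun x => Equiv.swap_apply_of_ne_of_ne
  have s23 : ∀ x, x ≠ 2 → x ≠ 3 → Equiv.swap 2 3 x = x := fun x => Equiv.swap_apply_of_ne_of_ne
  have hss : Similar ⟨α, .M, .D, .NM, ε'⟩ (e.tr (pair (sendOn α 0 2) (sendOn α 1 3)))
      (e.tr (pair (sendOn α 0 3) (sendOn α 1 2))) := by
    refine he.similar_pair (hs _ _) (hs _ _) (hs _ _) (hs _ _) (fs _ _ (by simp) (by simp))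
      (fs _ _ (by simp) (by simp)) (fs _ _ (by simp) (by simp)) (fs _ _ (by simp) (by simp))
      fun κ hκ => ?_
    -- The output of `2` on `0` turns into that of `3` on `1` when both swaps are applied, and into
    -- the two crossed outputs when only one is.
    have := he.supply_add (hs 0 2) (a := 0) (b := 1) (m := 2) (n := 3) (by simp) (by simp)
      (by simp) (by simp) hκ
    simpa [rename_sendOn, s01, s23] using this
  have hrr : Similar ⟨α, .M, .D, .NM, ε'⟩ (e.tr (pair (receiveOn 0 (some 2)) (receiveOn 1 (some 3))))
      (e.tr (pair (receiveOn 0 (some 3)) (receiveOn 1 (some 2)))) := by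
    refine he.similar_pair (hr _ _) (hr _ _) (hr _ _) (hr _ _) (fr _ _ (by simp) (by simp))
      (fr _ _ (by simp) (by simp)) (fr _ _ (by simp) (by simp)) (fr _ _ (by simp) (by simp))
      fun κ hκ => ?_
    have := he.supply_add (hr 0 2) (a := 0) (b := 1) (m := 2) (n := 3) (by simp) (by simp)
      (by simp) (by simp) hκ
    simpa [rename_receiveOn, s01, s23] using this
  have ls : ∀ {w : ℕ → ℕ → Prop} {u : ℕ → Option ℕ → Prop} {x y : ℕ}, w x y →
      Live (fun _ => MonadicPrefix w u ∅) (sendOn α x y) := by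
    intro w u x y h
    cases α
    · exact ⟨x, y, h, id, id, rfl, rfl⟩
    · exact ⟨⟨x, y, h, id, id, rfl, rfl⟩, trivial⟩
  have lr : ∀ {w : ℕ → ℕ → Prop} {u : ℕ → Option ℕ → Prop} {x y : ℕ}, u x (some y) →
      Live (fun _ => MonadicPrefix w u ∅) (receiveOn x (some y)) :=
    fun {w u x y} h => ⟨x, some y, h, id, fun _ _ => id, rfl⟩
  have fS : ∀ {x y z t : ℕ}, x < 4 → y < 4 → z < 4 → t < 4 →
      (pair (sendOn α x y) (sendOn α z t)).fn = {0, 1, 2, 3} :=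
    fun hx hy hz ht => fn_pair (fs _ _ hx hy) (fs _ _ hz ht)
  have fR : ∀ {x y z t : ℕ}, x < 4 → y < 4 → z < 4 → t < 4 →
      (pair (receiveOn x (some y)) (receiveOn z (some t))).fn = {0, 1, 2, 3} :=
    fun hx hy hz ht => fn_pair (fr _ _ hx hy) (fr _ _ hz ht)
  have mS := fun x y z t => mem_pair (hs x y) (hs z t)
  have mR := fun x y z t => mem_pair (hr x y) (hr z t)
  -- Straight outputs communicate with straight inputs. If exactly one side is crossed, every
  -- channel carries the name that its input refuses.
  refine he.false_of_similar ⟨rfl, Or.inr ⟨rfl, rfl⟩⟩ hE (mS 0 2 1 3) (mS 0 3 1 2)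
    (mR 0 2 1 3) (mR 0 3 1 2) (N := {0, 1, 2, 3}) ?_ ?_ ?_ ?_ ?_ ?_ hss hrr
  · rw [fS, fR, Set.union_self] <;> simp
  · rw [fS, fR, Set.union_self] <;> simp
  · rw [fS, fR, Set.union_self] <;> simp
  · refine (succeeds_communication (δ := .NM) (x := 0) (y := 2) (p := some 2) nofun (Or.inr rfl)
      ((hs 1 3).par (hr 1 3))).of_structEq ?_
    exact ((pair_structEq (hs 0 2) (hs 1 3)).par (pair_structEq (hr 0 2) (hr 1 3)) (mS ..)
      (mR ..)).trans (.par_par_par_comm (hs 0 2) (hs 1 3) (hr 0 2) (hr 1 3))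
  · refine inert_of_live (w := fun x y => x = 0 ∧ y = 3 ∨ x = 1 ∧ y = 2)
      (u := fun x p => x = 0 ∧ p = some 2 ∨ x = 1 ∧ p = some 3) ?_
      ⟨live_pair (ls (by simp)) (ls (by simp)), live_pair (lr (by simp)) (lr (by simp))⟩
    rintro x y (⟨rfl, rfl⟩ | ⟨rfl, rfl⟩) <;> simp
  · refine inert_of_live (w := fun x y => x = 0 ∧ y = 2 ∨ x = 1 ∧ y = 3)
      (u := fun x p => x = 0 ∧ p = some 3 ∨ x = 1 ∧ p = some 2) ?_
      ⟨live_pair (ls (by simp)) (ls (by simp)), live_pair (lr (by simp)) (lr (by simp))⟩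
    rintro x y (⟨rfl, rfl⟩ | ⟨rfl, rfl⟩) <;> simp

end Coord

namespace Coord

/-! ## Translations of prefixes -/

/-- Substitution in the channel and the data of an output. -/
def substOut (f : Name → Term) (x : Option Term × List Term) : Option Term × List Term :=
  (x.1.map (Term.subst f), x.2.map (Term.subst f))

/-- A correspondence between the outputs and the inputs of two languages. -/
structure PrefixRel : Type where
  O : Option Term × List Term → Option Term × List Term → Prop
  I : Inp → Inp → Prop

/-- The laws that allow to translate processes along a correspondence. -/
structure PrefixRel.Lawful (R : PrefixRel) (L L' : Lang) : Prop where
  sync : L.sync = L'.sync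
  coord : L.coord = L'.coord
  uniqueO : ∀ {x y y'}, R.O x y → R.O x y' → y = y'
  uniqueI : ∀ {i j j'}, R.I i j → R.I i j' → j = j'
  substO : ∀ {x y} f, R.O x y → R.O (substOut f x) (substOut f y)
  substI : ∀ {i j} f, R.I i j → R.I (i.subst f) (j.subst f)
  of_renO : ∀ {x y'} (r : Name → Name), R.O (substOut (fun v => .name (r v)) x) y' → ∃ y, R.O x y
  of_renI : ∀ {i j'} (r : Name → Name), R.I (i.subst fun v => .name (r v)) j' → ∃ j, R.I i j
  closedO : ∀ {x y n}, R.O x y → ((∀ s ∈ x.1, s.ClosedAt n) ∧ ∀ t ∈ x.2, t.ClosedAt n) →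
    (∀ s ∈ y.1, s.ClosedAt n) ∧ ∀ t ∈ y.2, t.ClosedAt n
  closedI : ∀ {i j n}, R.I i j → i.ClosedAt n → j.ClosedAt n
  fnO : ∀ {x y}, R.O x y → ((⋃ s ∈ y.1, s.fn) ∪ ⋃ t ∈ y.2, t.fn) ⊆
    (⋃ s ∈ x.1, s.fn) ∪ ⋃ t ∈ x.2, t.fn
  fnI : ∀ {i j}, R.I i j → j.fn ⊆ i.fn
  okO : ∀ {x y}, R.O x y → L.OkOut x.1 x.2 → L'.OkOut y.1 y.2
  okI : ∀ {i j}, R.I i j → L.OkInp i → L'.OkInp j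
  binders : ∀ {i j}, R.I i j → j.binders = i.binders
  polyMatch : ∀ {c d c' d' ps j σ}, R.O (c, d) (c', d') → R.I ⟨c, ps⟩ j → PolyMatch d ps σ →
    j.chan = c' ∧ PolyMatch d' j.pats σ

namespace PrefixRel

/-- The converse correspondence. -/
def symm (R : PrefixRel) : PrefixRel := ⟨fun x y => R.O y x, fun i j => R.I j i⟩

variable (R : PrefixRel)

open Classical in
/-- The output that corresponds to an output. -/
noncomputable def mapO (x : Option Term × List Term) : Option Term × List Term :=
  if h : ∃ y, R.O x y then h.choose else x

open Classical in
/-- The input that corresponds to an input. -/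
noncomputable def mapI (i : Inp) : Inp := if h : ∃ j, R.I i j then h.choose else i

open Classical in
/-- Replace every prefix by the one that corresponds to it, and the processes guarded by other
prefixes by `0`. -/
noncomputable def map : Proc → Proc
  | .nil => .nil
  | .ok => .ok
  | .out c d => if ∃ y, R.O (c, d) y then .out (R.mapO (c, d)).1 (R.mapO (c, d)).2 else .nil
  | .outThen c d P =>
      if ∃ y, R.O (c, d) y then .outThen (R.mapO (c, d)).1 (R.mapO (c, d)).2 (map P) else .nil
  | .join I P => if ∀ i ∈ I, ∃ j, R.I i j then .join (I.map R.mapI) (map P) else .nil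
  | .res P => .res (map P)
  | .par P Q => .par (map P) (map Q)
  | .ite s t P Q => .ite s t (map P) (map Q)
  | .rep P => .rep (map P)

/-- All prefixes in the process correspond to others. -/
def Good : Proc → Prop
  | .nil => True
  | .ok => True
  | .out c d => ∃ y, R.O (c, d) y
  | .outThen c d P => (∃ y, R.O (c, d) y) ∧ Good P
  | .join I P => (∀ i ∈ I, ∃ j, R.I i j) ∧ Good P
  | .res P => Good P
  | .par P Q => Good P ∧ Good Q
  | .ite _ _ P Q => Good P ∧ Good Q
  | .rep P => Good P

/-- The prefix corresponds to another one, and if it is an input, then so does everything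
below it. -/
def GoodPrefix (_ : Set ℕ) : Proc → Prop
  | .out c d | .outThen c d _ => ∃ y, R.O (c, d) y
  | .join I P => (∀ i ∈ I, ∃ j, R.I i j) ∧ R.Good P
  | _ => True

/-- All prefixes that may become active correspond to others. -/
def LiveGood (P : Proc) : Prop := Live (fun _ => R.GoodPrefix ∅) P

variable {R} {L L' : Lang}

theorem exists_mapO {x y : Option Term × List Term} (h : R.O x y) : R.O x (R.mapO x) := by
  have h' : ∃ y, R.O x y := ⟨y, h⟩
  rw [mapO, dif_pos h']
  exact h'.choose_spec

theorem exists_mapI {i j : Inp} (h : R.I i j) : R.I i (R.mapI i) := by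
  have h' : ∃ y, R.I i y := ⟨j, h⟩
  rw [mapI, dif_pos h']
  exact h'.choose_spec

theorem Lawful.mapO_eq (hR : R.Lawful L L') {x y : Option Term × List Term} (h : R.O x y) :
    R.mapO x = y := hR.uniqueO (exists_mapO h) h

theorem Lawful.mapI_eq (hR : R.Lawful L L') {i j : Inp} (h : R.I i j) : R.mapI i = j :=
  hR.uniqueI (exists_mapI h) h

theorem Lawful.joinBinders_mapI (hR : R.Lawful L L') {I : List Inp}
    (h : ∀ i ∈ I, ∃ j, R.I i j) : joinBinders (I.map R.mapI) = joinBinders I := by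
  unfold joinBinders
  rw [List.map_map]
  congr 1
  refine List.map_congr_left fun i hi => ?_
  obtain ⟨j, hj⟩ := h i hi
  exact hR.binders (exists_mapI hj)

theorem Lawful.mapI_map_subst (hR : R.Lawful L L') {I : List Inp}
    (h : ∀ i ∈ I, ∃ j, R.I i j) (f : Name → Term) :
    (I.map (Inp.subst f)).map R.mapI = (I.map R.mapI).map (Inp.subst f) := by
  rw [List.map_map, List.map_map]
  refine List.map_congr_left fun i hi => ?_
  obtain ⟨j, hj⟩ := h i hi
  exact hR.mapI_eq (hR.substI f (exists_mapI hj))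

theorem Lawful.goodO_ren (hR : R.Lawful L L') (r : Name → Name) (c : Option Term) (d : List Term) :
    (∃ y, R.O (c.map (Term.subst fun v => .name (r v)), d.map (Term.subst fun v => .name (r v))) y) ↔
      ∃ y, R.O (c, d) y :=
  ⟨fun ⟨_, h⟩ => hR.of_renO (x := (c, d)) r h, fun ⟨_, h⟩ => ⟨_, hR.substO _ h⟩⟩

theorem Lawful.goodI_ren (hR : R.Lawful L L') (r : Name → Name) (I : List Inp) :
    (∀ i ∈ I.map (Inp.subst fun v => .name (r v)), ∃ j, R.I i j) ↔ ∀ i ∈ I, ∃ j, R.I i j := by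
  simp only [List.mem_map, forall_exists_index, and_imp, forall_apply_eq_imp_iff₂]
  exact forall₂_congr fun i _ =>
    ⟨fun ⟨_, h⟩ => hR.of_renI r h, fun ⟨_, h⟩ => ⟨_, hR.substI _ h⟩⟩

/-- Holds even for prefixes without a counterpart, because a renaming cannot give them one.
Substitution of terms might, which is why `map_subst` assumes `Good`. -/
theorem Lawful.map_ren (hR : R.Lawful L L') (r : ℕ → Name → Name) (d : ℕ) (P : Proc) :
    R.map (P.ren r d) = (R.map P).ren r d := by
  unfold Proc.ren
  induction P generalizing d with
  | nil | ok => rfl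
  | out c t =>
    by_cases h : ∃ y, R.O (c, t) y
    · obtain ⟨y, hy⟩ := h
      rw [Proc.subst, map, map, if_pos ((hR.goodO_ren (r d) c t).2 ⟨_, hy⟩), if_pos ⟨_, hy⟩,
        Proc.subst, hR.mapO_eq hy]
      rw [show (_, _) = substOut (fun v => .name (r d v)) (c, t) from rfl,
        hR.mapO_eq (hR.substO _ hy)]
      rfl
    · rw [Proc.subst, map, map, if_neg (mt (hR.goodO_ren (r d) c t).1 h), if_neg h]
      rfl
  | outThen c t P ih =>
    by_cases h : ∃ y, R.O (c, t) y
    · obtain ⟨y, hy⟩ := h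
      rw [Proc.subst, map, map, if_pos ((hR.goodO_ren (r d) c t).2 ⟨_, hy⟩), if_pos ⟨_, hy⟩,
        Proc.subst, hR.mapO_eq hy, ih]
      rw [show (_, _) = substOut (fun v => .name (r d v)) (c, t) from rfl,
        hR.mapO_eq (hR.substO _ hy)]
      rfl
    · rw [Proc.subst, map, map, if_neg (mt (hR.goodO_ren (r d) c t).1 h), if_neg h]
      rfl
  | join I P ih =>
    by_cases h : ∀ i ∈ I, ∃ j, R.I i j
    · rw [Proc.subst, map, map, if_pos ((hR.goodI_ren (r d) I).2 h), if_pos h, Proc.subst, ih,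
        hR.mapI_map_subst h, hR.joinBinders_mapI h]
    · rw [Proc.subst, map, map, if_neg (mt (hR.goodI_ren (r d) I).1 h), if_neg h]
      rfl
  | res P ih => simp only [Proc.subst, map, ih]
  | par P Q ihP ihQ => simp only [Proc.subst, map, ihP, ihQ]
  | ite s t P Q ihP ihQ => simp only [Proc.subst, map, ihP, ihQ]
  | rep P ih => simp only [Proc.subst, map, ih]

theorem Lawful.map_close (hR : R.Lawful L L') (xs : List ℕ) (P : Proc) :
    R.map (P.close xs) = (R.map P).close xs := by
  rw [Proc.close_eq_ren, Proc.close_eq_ren, hR.map_ren]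

theorem Lawful.map_nu (hR : R.Lawful L L') (a : ℕ) (P : Proc) :
    R.map (.nu a P) = .nu a (R.map P) := by
  rw [Proc.nu, Proc.nu, map, hR.map_close]

theorem Lawful.good_subst (hR : R.Lawful L L') {P : Proc} (h : R.Good P) (f : ℕ → Name → Term)
    (d : ℕ) : R.Good (P.subst f d) := by
  induction P generalizing d with
  | nil | ok => trivial
  | out c t => exact h.elim fun _ h => ⟨_, hR.substO (f d) h⟩
  | outThen c t P ih => exact ⟨h.1.elim fun _ h => ⟨_, hR.substO (f d) h⟩, ih h.2 d⟩
  | join I P ih =>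
    refine ⟨fun i hi => ?_, ih h.2 _⟩
    obtain ⟨i', hi', rfl⟩ := List.mem_map.1 hi
    exact (h.1 i' hi').elim fun _ h => ⟨_, hR.substI (f d) h⟩
  | res P ih => exact ih (show R.Good P from h) _
  | par P Q ihP ihQ => exact ⟨ihP h.1 d, ihQ h.2 d⟩
  | ite s t P Q ihP ihQ => exact ⟨ihP h.1 d, ihQ h.2 d⟩
  | rep P ih => exact ih (show R.Good P from h) _

theorem Lawful.map_subst (hR : R.Lawful L L') {P : Proc} (h : R.Good P) (f : ℕ → Name → Term)
    (d : ℕ) : R.map (P.subst f d) = (R.map P).subst f d := by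
  induction P generalizing d with
  | nil | ok => rfl
  | out c t =>
    obtain ⟨y, hy⟩ := h
    have hy' : R.O (c.map (Term.subst (f d)), t.map (Term.subst (f d))) _ := hR.substO (f d) hy
    rw [Proc.subst, map, map, if_pos ⟨_, hy'⟩, if_pos ⟨_, hy⟩, hR.mapO_eq hy, hR.mapO_eq hy']
    rfl
  | outThen c t P ih =>
    obtain ⟨⟨y, hy⟩, hP⟩ := h
    have hy' : R.O (c.map (Term.subst (f d)), t.map (Term.subst (f d))) _ := hR.substO (f d) hy
    rw [Proc.subst, map, map, if_pos ⟨_, hy'⟩, if_pos ⟨_, hy⟩, hR.mapO_eq hy, hR.mapO_eq hy',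
      ih hP]
    rfl
  | join I P ih =>
    have hI := h.1
    have h' : ∀ i ∈ I.map (Inp.subst (f d)), ∃ j, R.I i j :=
      (hR.good_subst (P := .join I P) h f d).1
    rw [Proc.subst, map, map, if_pos h', if_pos hI, Proc.subst, ih h.2, hR.mapI_map_subst hI,
      hR.joinBinders_mapI hI]
  | res P ih => simp only [Proc.subst, map, ih (show R.Good P from h)]
  | par P Q ihP ihQ => simp only [Proc.subst, map, ihP h.1, ihQ h.2]
  | ite s t P Q ihP ihQ => simp only [Proc.subst, map, ihP h.1, ihQ h.2]
  | rep P ih => simp only [Proc.subst, map, ih (show R.Good P from h)]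

theorem Lawful.good_ren (hR : R.Lawful L L') (r : ℕ → Name → Name) (d : ℕ) (P : Proc) :
    R.Good (P.ren r d) ↔ R.Good P := by
  refine ⟨fun h => ?_, fun h => hR.good_subst h _ _⟩
  induction P generalizing d with
  | nil | ok => trivial
  | out c t => exact (hR.goodO_ren (r d) c t).1 h
  | outThen c t P ih => exact ⟨(hR.goodO_ren (r d) c t).1 h.1, ih _ h.2⟩
  | join I P ih => exact ⟨(hR.goodI_ren (r d) I).1 h.1, ih _ h.2⟩
  | res P ih => exact ih (d + 1) h
  | par P Q ihP ihQ => exact ⟨ihP _ h.1, ihQ _ h.2⟩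
  | ite s t P Q ihP ihQ => exact ⟨ihP _ h.1, ihQ _ h.2⟩
  | rep P ih => exact ih d h

theorem Lawful.isPrefixFamily (hR : R.Lawful L L') : IsPrefixFamily R.GoodPrefix := by
  refine ⟨fun A a j X _ => ?_, fun A a X _ => by cases X <;> rfl⟩
  cases X with
  | out c d => exact hR.goodO_ren _ c d
  | outThen c d P => exact hR.goodO_ren _ c d
  | join I P => exact and_congr (hR.goodI_ren _ I) (hR.good_ren _ _ P)
  | _ => rfl

theorem liveGood_of_good {P : Proc} (h : R.Good P) : R.LiveGood P := by
  unfold LiveGood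
  induction P with
  | nil | ok | out | join => exact h
  | outThen c t P ih => exact ⟨h.1, ih h.2⟩
  | res P ih => exact ih h
  | par P Q ihP ihQ => exact ⟨ihP h.1, ihQ h.2⟩
  | ite s t P Q ihP ihQ =>
    by_cases hst : s = t
    · simpa only [Live, if_pos hst] using ihP h.1
    · simpa only [Live, if_neg hst] using ihQ h.2
  | rep P ih => exact ih h

theorem Lawful.closedAt_map (hR : R.Lawful L L') {n : ℕ} {P : Proc} (h : P.ClosedAt n) :
    (R.map P).ClosedAt n := by
  induction P generalizing n with
  | nil | ok => trivial
  | out c t =>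
    rw [map]
    split_ifs with hy
    · exact hR.closedO (exists_mapO hy.choose_spec) h
    · trivial
  | outThen c t P ih =>
    rw [map]
    split_ifs with hy
    · have := hR.closedO (exists_mapO hy.choose_spec) (n := n) ⟨h.1, h.2.1⟩
      exact ⟨this.1, this.2, ih h.2.2⟩
    · trivial
  | join I P ih =>
    rw [map]
    split_ifs with hy
    · refine ⟨fun i hi => ?_, ?_⟩
      · obtain ⟨i', hi', rfl⟩ := List.mem_map.1 hi
        obtain ⟨j, hj⟩ := hy i' hi'
        exact hR.closedI (exists_mapI hj) (h.1 i' hi')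
      · rw [hR.joinBinders_mapI hy]
        exact ih h.2
    · trivial
  | res P ih => exact ih (n := n + 1) h
  | par P Q ihP ihQ => exact ⟨ihP h.1, ihQ h.2⟩
  | ite s t P Q ihP ihQ => exact ⟨h.1, h.2.1, ihP h.2.2.1, ihQ h.2.2.2⟩
  | rep P ih => exact ih h

theorem Lawful.fn_map (hR : R.Lawful L L') (P : Proc) : (R.map P).fn ⊆ P.fn := by
  induction P with
  | nil | ok => exact subset_rfl
  | out c t =>
    rw [map]
    split_ifs with hy
    · exact hR.fnO (exists_mapO hy.choose_spec)
    · exact Set.empty_subset _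
  | outThen c t P ih =>
    rw [map]
    split_ifs with hy
    · exact Set.union_subset_union (hR.fnO (exists_mapO hy.choose_spec)) ih
    · exact Set.empty_subset _
  | join I P ih =>
    rw [map]
    split_ifs with hy
    · refine Set.union_subset_union (fun x hx => ?_) ih
      simp only [Set.mem_iUnion] at hx ⊢
      obtain ⟨i, hi, hx⟩ := hx
      obtain ⟨i', hi', rfl⟩ := List.mem_map.1 hi
      obtain ⟨j, hj⟩ := hy i' hi'
      exact ⟨i', hi', hR.fnI (exists_mapI hj) hx⟩
    · exact Set.empty_subset _
  | res P ih => exact ih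
  | par P Q ihP ihQ => exact Set.union_subset_union ihP ihQ
  | ite s t P Q ihP ihQ => exact Set.union_subset_union (Set.union_subset_union subset_rfl ihP) ihQ
  | rep P ih => exact ih

theorem Lawful.admits_map (hR : R.Lawful L L') {P : Proc} (h : L.Admits P) :
    L'.Admits (R.map P) := by
  induction P with
  | nil | ok => trivial
  | out c t =>
    rw [map]
    split_ifs with hy
    · exact ⟨hR.sync ▸ h.1, hR.okO (exists_mapO hy.choose_spec) h.2⟩
    · trivial
  | outThen c t P ih =>
    rw [map]
    split_ifs with hy
    · exact ⟨hR.sync ▸ h.1, hR.okO (exists_mapO hy.choose_spec) h.2.1, ih h.2.2⟩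
    · trivial
  | join I P ih =>
    rw [map]
    split_ifs with hy
    · refine ⟨⟨?_, fun i hi => ?_⟩, ih h.2⟩
      · have := h.1.1
        rw [← hR.coord]
        cases hc : L.coord <;> simpa [hc] using this
      · obtain ⟨i', hi', rfl⟩ := List.mem_map.1 hi
        obtain ⟨j, hj⟩ := hy i' hi'
        exact hR.okI (exists_mapI hj) (h.1.2 i' hi')
    · trivial
  | res P ih => exact ih h
  | par P Q ihP ihQ => exact ⟨ihP h.1, ihQ h.2⟩
  | ite s t P Q ihP ihQ => exact ⟨ihP h.1, ihQ h.2⟩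
  | rep P ih => exact ih h

theorem Lawful.mem_map (hR : R.Lawful L L') {P : Proc} (h : L.Mem P) : L'.Mem (R.map P) :=
  ⟨hR.closedAt_map h.1, hR.admits_map h.2⟩

/-- Equality is the outcome when the step takes place below an output without counterpart, since the
translation erases that output together with its continuation. -/
theorem Lawful.structEq_of_structStep (hR : R.Lawful L L') {P Q : Proc} (h : StructStep P Q) :
    StructStep (R.map P) (R.map Q) ∨ R.map P = R.map Q := by
  induction h with
  | par_nil P => exact .inl (.par_nil _)
  | par_comm P Q => exact .inl (.par_comm _ _)
  | par_assoc P Q S => exact .inl (.par_assoc _ _ _)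
  | ite_eq s P Q => exact .inl (.ite_eq _ _ _)
  | ite_ne s t P Q h => exact .inl (.ite_ne _ _ _ _ h)
  | nu_nil a => rw [hR.map_nu]; exact .inl (.nu_nil a)
  | nu_comm a b P hP =>
    simp only [hR.map_nu]
    exact .inl (.nu_comm a b _ (hR.closedAt_map hP))
  | par_nu a P Q hP hQ ha =>
    simp only [hR.map_nu, map]
    exact .inl (.par_nu a _ _ (hR.closedAt_map hP) (hR.closedAt_map hQ) fun h => ha (hR.fn_map P h))
  | rep P => exact .inl (.rep _)
  | congr_par_left Q _ ih => exact ih.imp (.congr_par_left _) (by simp only [map]; rintro h; rw [h])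
  | congr_par_right P _ ih =>
    exact ih.imp (.congr_par_right _) (by simp only [map]; rintro h; rw [h])
  | congr_nu a hP hQ _ ih =>
    simp only [hR.map_nu]
    exact ih.imp (.congr_nu a (hR.closedAt_map hP) (hR.closedAt_map hQ)) fun h => by rw [h]
  | congr_rep _ ih => exact ih.imp .congr_rep (by simp only [map]; rintro h; rw [h])
  | congr_ite_left s t Q _ ih =>
    exact ih.imp (.congr_ite_left _ _ _) (by simp only [map]; rintro h; rw [h])
  | congr_ite_right s t P _ ih =>
    exact ih.imp (.congr_ite_right _ _ _) (by simp only [map]; rintro h; rw [h])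
  | congr_outThen c d _ ih =>
    simp only [map]
    split_ifs
    · exact ih.imp (.congr_outThen _ _) fun h => by rw [h]
    · exact .inr rfl

theorem Lawful.structEq_map (hR : R.Lawful L L') {P Q : Proc} (h : StructEq L P Q) :
    StructEq L' (R.map P) (R.map Q) := by
  induction h with
  | rel P Q h =>
    rcases hR.structEq_of_structStep h.2.2 with h' | h'
    · exact .of_step (hR.mem_map h.1) (hR.mem_map h.2.1) h'
    · rw [h']
      exact .refl _ _
  | refl => exact .refl _ _
  | symm _ _ _ ih => exact ih.symm
  | trans _ _ _ _ _ ih₁ ih₂ => exact ih₁.trans ih₂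

theorem map_parList (Ps : List Proc) : R.map (parList Ps) = parList (Ps.map R.map) := by
  induction Ps with
  | nil => rfl
  | cons P Ps ih => exact congrArg (Proc.par (R.map P)) ih

theorem liveGood_parList {Ps : List Proc} :
    R.LiveGood (parList Ps) ↔ ∀ P ∈ Ps, R.LiveGood P := by
  induction Ps with
  | nil => simp [parList, LiveGood, Live]
  | cons P Ps ih =>
    rw [List.forall_mem_cons, ← ih]
    rfl

/-- The translated prefixes match with the very same `σ`, so the continuation of the join is
instantiated identically on both sides. -/
theorem Lawful.joinMatch_map (hR : R.Lawful L L') {Os : List Proc} {I : List Inp}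
    {Ps : List Proc} {σ : List Term} (h : JoinMatch Os I Ps σ) (hO : ∀ O ∈ Os, R.LiveGood O)
    (hI : ∀ i ∈ I, ∃ j, R.I i j) :
    JoinMatch (Os.map R.map) (I.map R.mapI) (Ps.map R.map) σ ∧ ∀ P ∈ Ps, R.LiveGood P := by
  induction h with
  | nil => exact ⟨.nil, by simp⟩
  | @out c d ps Os I Ps σ τ hm _ ih =>
    obtain ⟨ih₁, ih₂⟩ := ih (fun O h => hO O (by simp [h])) fun i h => hI i (by simp [h])
    obtain ⟨⟨c', d'⟩, hy⟩ : ∃ y, R.O (c, d) y := hO _ List.mem_cons_self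
    obtain ⟨⟨c'', ps'⟩, hj⟩ := hI _ List.mem_cons_self
    obtain ⟨h₁, h₂⟩ := hR.polyMatch hy hj hm
    obtain rfl : c'' = c' := h₁
    refine ⟨?_, ih₂⟩
    rw [List.map_cons, List.map_cons, map, if_pos ⟨_, hy⟩, hR.mapO_eq hy, hR.mapI_eq hj]
    exact .out h₂ ih₁
  | @outThen c d P ps Os I Ps σ τ hm _ ih =>
    obtain ⟨ih₁, ih₂⟩ := ih (fun O h => hO O (by simp [h])) fun i h => hI i (by simp [h])
    obtain ⟨⟨⟨c', d'⟩, hy⟩, hP⟩ : (∃ y, R.O (c, d) y) ∧ R.LiveGood P := hO _ List.mem_cons_self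
    obtain ⟨⟨c'', ps'⟩, hj⟩ := hI _ List.mem_cons_self
    obtain ⟨h₁, h₂⟩ := hR.polyMatch hy hj hm
    obtain rfl : c'' = c' := h₁
    refine ⟨?_, by simpa using ⟨hP, ih₂⟩⟩
    rw [List.map_cons, List.map_cons, map, if_pos ⟨_, hy⟩, hR.mapO_eq hy, hR.mapI_eq hj]
    exact .outThen h₂ ih₁

/-- Structural equivalence may introduce a conditional with an arbitrary dead branch, so `Good` is
not invariant under it. `LiveGood` is, because it ignores dead branches. -/
theorem Lawful.liveGood_iff (hR : R.Lawful L L') {L₀ : Lang} {P Q : Proc} (h : StructEq L₀ P Q) :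
    R.LiveGood P ↔ R.LiveGood Q :=
  hR.isPrefixFamily.live_iff_of_structEq (fun _ _ _ _ _ => Iff.rfl) h ∅

theorem Lawful.liveGood_nu (hR : R.Lawful L L') {P : Proc} (hP : P.ClosedAt 0) (a : ℕ) :
    R.LiveGood (.nu a P) ↔ R.LiveGood P := by
  refine (hR.isPrefixFamily.live_nu hP a ∅).trans (live_congr hP fun _ X _ _ => ?_)
  cases X <;> rfl

/-- Below an input conditionals are still undecided, so `GoodPrefix` demands full `Good` there; this
makes the translation commute with the instantiation and keeps the result live-good. -/
theorem Lawful.red_map (hR : R.Lawful L L') {P P' : Proc} (h : Red L P P') (hP : R.LiveGood P) :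
    Red L' (R.map P) (R.map P') ∧ R.LiveGood P' := by
  induction h with
  | @interact Os I Q Ps σ hm h =>
    obtain ⟨hO, hI, hQ⟩ := hP
    obtain ⟨h₁, h₂⟩ := hR.joinMatch_map h (liveGood_parList.1 hO) hI
    have hm' := hR.mem_map hm
    have hj : R.map (.join I Q) = .join (I.map R.mapI) (R.map Q) := by rw [map, if_pos hI]
    refine ⟨?_, liveGood_parList.2 h₂, liveGood_of_good (hR.good_subst hQ _ _)⟩
    rw [map, hj, map_parList] at hm'
    change Red L' (.par (R.map (parList Os)) (R.map (.join I Q)))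
      (.par (R.map (parList Ps)) (R.map (Q.inst σ)))
    rw [hj, map_parList, map_parList, Proc.inst, hR.map_subst hQ]
    exact .interact hm' h₁
  | par Q hQ _ ih =>
    obtain ⟨ih₁, ih₂⟩ := ih hP.1
    exact ⟨.par _ (hR.mem_map hQ) ih₁, ih₂, hP.2⟩
  | nu a h ih =>
    obtain ⟨ih₁, ih₂⟩ := ih ((hR.liveGood_nu h.mem.1.1 a).1 hP)
    rw [hR.map_nu, hR.map_nu]
    exact ⟨.nu a ih₁, (hR.liveGood_nu h.mem.2.1 a).2 ih₂⟩
  | struct h₁ _ h₂ ih =>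
    obtain ⟨ih₁, ih₂⟩ := ih ((hR.liveGood_iff h₁).1 hP)
    exact ⟨.struct (hR.structEq_map h₁) ih₁ (hR.structEq_map h₂), (hR.liveGood_iff h₂).1 ih₂⟩

theorem Lawful.reds_map (hR : R.Lawful L L') {P P' : Proc} (h : Reds L P P') (hP : R.LiveGood P) :
    Reds L' (R.map P) (R.map P') ∧ R.LiveGood P' := by
  induction h with
  | refl => exact ⟨.refl, hP⟩
  | tail _ h ih =>
    obtain ⟨h₁, h₂⟩ := hR.red_map h ih.2
    exact ⟨ih.1.tail h₁, h₂⟩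

theorem Lawful.succeeds_map (hR : R.Lawful L L') {P : Proc} (h : Succeeds L P)
    (hP : R.LiveGood P) : Succeeds L' (R.map P) := by
  obtain ⟨Q, S, h₁, h₂⟩ := h
  exact ⟨R.map Q, R.map S, (hR.reds_map h₁ hP).1, hR.structEq_map h₂⟩

theorem Lawful.diverges_map (hR : R.Lawful L L') {P : Proc} (h : Diverges L P)
    (hP : R.LiveGood P) : Diverges L' (R.map P) := by
  obtain ⟨f, rfl, hf⟩ := h
  have hg : ∀ n, R.LiveGood (f n) := by
    intro n
    induction n with
    | zero => exact hP
    | succ n ih => exact (hR.red_map (hf n) ih).2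
  exact ⟨fun n => R.map (f n), rfl, fun n => (hR.red_map (hf n) (hg n)).1⟩

end PrefixRel

end Coord

namespace Coord

/-! ## Encodings from translations of prefixes -/

namespace PrefixRel

variable {R : PrefixRel} {L L' : Lang}

/-- Every prefix of the language corresponds to some prefix. -/
def Total (R : PrefixRel) (L : Lang) : Prop :=
  (∀ x, L.OkOut x.1 x.2 → ∃ y, R.O x y) ∧ ∀ i, L.OkInp i → ∃ j, R.I i j

theorem Total.good (hT : R.Total L) {P : Proc} (h : L.Admits P) : R.Good P := by
  induction P with
  | nil | ok => trivial
  | out c d => exact hT.1 (c, d) h.2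
  | outThen c d P ih => exact ⟨hT.1 (c, d) h.2.1, ih h.2.2⟩
  | join I P ih => exact ⟨fun i hi => hT.2 i (h.1.2 i hi), ih h.2⟩
  | res P ih => exact ih h
  | par P Q ihP ihQ => exact ⟨ihP h.1, ihQ h.2⟩
  | ite s t P Q ihP ihQ => exact ⟨ihP h.1, ihQ h.2⟩
  | rep P ih => exact ih h

theorem map_out {c : Option Term} {d : List Term} {y : Option Term × List Term} (h : R.O (c, d) y) :
    R.map (.out c d) = .out (R.mapO (c, d)).1 (R.mapO (c, d)).2 := by
  rw [map, if_pos ⟨_, h⟩]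

theorem map_outThen {c : Option Term} {d : List Term} {y : Option Term × List Term} (h : R.O (c, d) y) (P : Proc) :
    R.map (.outThen c d P) = .outThen (R.mapO (c, d)).1 (R.mapO (c, d)).2 (R.map P) := by
  rw [map, if_pos ⟨_, h⟩]

theorem map_join {I : List Inp} (h : ∀ i ∈ I, ∃ j, R.I i j) (P : Proc) :
    R.map (.join I P) = .join (I.map R.mapI) (R.map P) := by
  rw [map, if_pos h]

theorem symm_I_of_mem_map {I : List Inp} (h : ∀ i ∈ I, ∃ j, R.I i j) :
    ∀ j ∈ I.map R.mapI, ∃ i, R.symm.I j i := by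
  intro j hj
  obtain ⟨i, hi, rfl⟩ := List.mem_map.1 hj
  exact (h i hi).elim fun _ h => ⟨i, exists_mapI h⟩

theorem Lawful.symm_mapI_map (hS : R.symm.Lawful L' L) {I : List Inp}
    (h : ∀ i ∈ I, ∃ j, R.I i j) : (I.map R.mapI).map R.symm.mapI = I := by
  rw [List.map_map]
  refine (List.map_congr_left fun i hi => ?_).trans I.map_id
  exact (h i hi).elim fun _ h => hS.mapI_eq (exists_mapI h)

theorem Lawful.symm_mapO (hS : R.symm.Lawful L' L) {x y : Option Term × List Term}
    (h : R.O x y) : R.symm.mapO (R.mapO x) = x := hS.mapO_eq (exists_mapO h)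

/-- On processes all of whose prefixes have counterparts the round trip is exact, by uniqueness of
the converse correspondence. -/
theorem Lawful.symm_map_map (hS : R.symm.Lawful L' L) {P : Proc} (h : R.Good P) :
    R.symm.Good (R.map P) ∧ R.symm.map (R.map P) = P := by
  induction P with
  | nil | ok => exact ⟨trivial, rfl⟩
  | out c d =>
    obtain ⟨y, hy⟩ := h
    have hy' : R.symm.O (R.mapO (c, d)) (c, d) := exists_mapO hy
    rw [map_out hy, map_out (R := R.symm) (c := (R.mapO (c, d)).1) (d := (R.mapO (c, d)).2) hy', hS.symm_mapO hy]
    exact ⟨⟨_, hy'⟩, rfl⟩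
  | outThen c d P ih =>
    obtain ⟨⟨y, hy⟩, h⟩ := h
    have hy' : R.symm.O (R.mapO (c, d)) (c, d) := exists_mapO hy
    rw [map_outThen hy, map_outThen (R := R.symm) (c := (R.mapO (c, d)).1) (d := (R.mapO (c, d)).2) hy', hS.symm_mapO hy, (ih h).2]
    exact ⟨⟨⟨_, hy'⟩, (ih h).1⟩, rfl⟩
  | join I P ih =>
    have hI := symm_I_of_mem_map h.1
    rw [map_join h.1, map_join hI, hS.symm_mapI_map h.1, (ih h.2).2]
    exact ⟨⟨hI, (ih h.2).1⟩, rfl⟩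
  | res P ih => exact ⟨(ih h).1, congrArg _ (ih h).2⟩
  | par P Q ihP ihQ =>
    exact ⟨⟨(ihP h.1).1, (ihQ h.2).1⟩, congrArg₂ _ (ihP h.1).2 (ihQ h.2).2⟩
  | ite s t P Q ihP ihQ =>
    exact ⟨⟨(ihP h.1).1, (ihQ h.2).1⟩, congrArg₂ _ (ihP h.1).2 (ihQ h.2).2⟩
  | rep P ih => exact ⟨(ih h).1, congrArg _ (ih h).2⟩

/-- For reducts of translations the round trip holds only up to `≡`: dead branches may contain
prefixes without counterpart, which are lost. Deciding the conditional before and after removes the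
difference. -/
theorem Lawful.structEq_map_map (hR : R.Lawful L L') (hS : R.symm.Lawful L' L) (n : ℕ) :
    ∀ {P : Proc}, P.size ≤ n → L'.Mem P → R.symm.LiveGood P →
      StructEq L' P (R.map (R.symm.map P)) := by
  induction n with
  | zero => intro P h; cases P <;> simp [Proc.size] at h
  | succ n ih =>
    intro P hn hP h
    have hM : ∀ {P}, L'.Mem P → L'.Mem (R.map (R.symm.map P)) := fun h => hR.mem_map (hS.mem_map h)
    cases P with
    | nil | ok => exact .refl _ _
    | out c d =>
      have h' : R.symm.Good (.out c d) := h
      have he : R.map (R.symm.map _) = _ := (hR.symm_map_map (R := R.symm) h').2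
      rw [he]
      exact .refl _ _
    | join I P =>
      have h' : R.symm.Good (.join I P) := h
      have he : R.map (R.symm.map _) = _ := (hR.symm_map_map (R := R.symm) h').2
      rw [he]
      exact .refl _ _
    | outThen c d P =>
      obtain ⟨⟨y, hy⟩, h⟩ : (∃ y, R.symm.O (c, d) y) ∧ R.symm.LiveGood P := h
      have hP' : L'.Mem P := ⟨hP.1.2.2, hP.2.2.2⟩
      have hy' : R.O (R.symm.mapO (c, d)) (c, d) := exists_mapO hy
      rw [map_outThen hy, map_outThen (c := (R.symm.mapO (c, d)).1)
        (d := (R.symm.mapO (c, d)).2) hy', hR.mapO_eq hy']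
      exact StructEq.map (L := L') (.outThen c d)
        (fun Q hQ => ⟨⟨hP.1.1, hP.1.2.1, hQ.1⟩, hP.2.1, hP.2.2.1, hQ.2⟩)
        (fun _ _ _ _ => .congr_outThen c d) (ih (by simp [Proc.size] at hn; omega) hP' h)
    | res P =>
      obtain ⟨a, P', -, he, hP', hs⟩ := hP.exists_nu Set.finite_empty
      rw [he] at h ⊢
      rw [hS.map_nu, hR.map_nu]
      exact (ih (by simp [Proc.size] at hn; omega) hP' ((hS.liveGood_nu hP'.1 a).1 h)).nu a
    | par P Q =>
      obtain ⟨h₁, h₂⟩ := Lang.mem_par.1 hP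
      simp [Proc.size] at hn
      exact .par (ih (by omega) h₁ h.1) (ih (by omega) h₂ h.2) h₁ h₂
    | ite s t P Q =>
      simp [Proc.size] at hn
      have h₁ : L'.Mem P := ⟨hP.1.2.2.1, hP.2.1⟩
      have h₂ : L'.Mem Q := ⟨hP.1.2.2.2, hP.2.2⟩
      by_cases hst : s = t
      · subst hst
        have h' : R.symm.LiveGood P := by simpa only [LiveGood, Live, if_true] using h
        exact (StructEq.ite_eq s hP).trans
          ((ih (by omega) h₁ h').trans (StructEq.ite_eq s (hM hP)).symm)
      · have h' : R.symm.LiveGood Q := by simpa only [LiveGood, Live, if_neg hst] using h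
        exact (StructEq.ite_ne hst hP).trans
          ((ih (by omega) h₂ h').trans (StructEq.ite_ne hst (hM hP)).symm)
    | rep P =>
      simp [Proc.size] at hn
      exact .rep (ih (by omega) ⟨hP.1, hP.2⟩ h)

/-- The translation is homomorphic, so a context is translated like a process, independently of what
fills it. -/
theorem Lawful.exists_ctx (hR : R.Lawful L L') (hT : R.Total L) {k : ℕ} {K : Ctx k}
    (hW : K.WellFormed) (hA : L.Admits (K.fill fun _ => .nil)) :
    ∃ K' : Ctx k, K'.WellFormed ∧ (∀ i, K'.occurrences i = K.occurrences i) ∧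
      ∀ S, R.map (K.fill S) = K'.fill fun i => R.map (S i) := by
  induction K with
  | hole i => exact ⟨.hole i, trivial, fun _ => rfl, fun _ => rfl⟩
  | nil => exact ⟨.nil, trivial, fun _ => rfl, fun _ => rfl⟩
  | ok => exact ⟨.ok, trivial, fun _ => rfl, fun _ => rfl⟩
  | out c d =>
    obtain ⟨y, hy⟩ := hT.1 (c, d) hA.2
    exact ⟨.out (R.mapO (c, d)).1 (R.mapO (c, d)).2, hR.closedO (exists_mapO hy) hW, fun _ => rfl,
      fun _ => map_out hy⟩
  | outThen c d K ih =>
    obtain ⟨y, hy⟩ := hT.1 (c, d) hA.2.1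
    obtain ⟨K', h₁, h₂, h₃⟩ := ih hW.2.2 hA.2.2
    have := hR.closedO (exists_mapO hy) (n := 0) ⟨hW.1, hW.2.1⟩
    refine ⟨.outThen (R.mapO (c, d)).1 (R.mapO (c, d)).2 K', ⟨this.1, this.2, h₁⟩, h₂, fun S => ?_⟩
    rw [Ctx.fill, map_outThen hy, h₃, Ctx.fill]
  | join I xs K ih =>
    have hI : ∀ i ∈ I, ∃ j, R.I i j := fun i hi => hT.2 i (hA.1.2 i hi)
    obtain ⟨K', h₁, h₂, h₃⟩ := ih hW.2.2.2 (Lang.Admits.of_close hA.2)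
    refine ⟨.join (I.map R.mapI) xs K', ⟨fun i hi => ?_, hW.2.1, ?_, h₁⟩, h₂, fun S => ?_⟩
    · obtain ⟨i', hi', rfl⟩ := List.mem_map.1 hi
      obtain ⟨j, hj⟩ := hI i' hi'
      exact hR.closedI (exists_mapI hj) (hW.1 i' hi')
    · rw [hR.joinBinders_mapI hI]
      exact hW.2.2.1
    · rw [Ctx.fill, map_join hI, hR.map_close, h₃, Ctx.fill]
  | res a K ih =>
    obtain ⟨K', h₁, h₂, h₃⟩ := ih hW (Lang.Admits.of_close (xs := [a]) hA)
    refine ⟨.res a K', h₁, h₂, fun S => ?_⟩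
    rw [Ctx.fill, hR.map_nu, h₃, Ctx.fill]
  | par K₁ K₂ ih₁ ih₂ =>
    obtain ⟨K₁', h₁, h₂, h₃⟩ := ih₁ hW.1 hA.1
    obtain ⟨K₂', h₁', h₂', h₃'⟩ := ih₂ hW.2 hA.2
    exact ⟨.par K₁' K₂', ⟨h₁, h₁'⟩, fun i => congrArg₂ (· + ·) (h₂ i) (h₂' i),
      fun S => congrArg₂ _ (h₃ S) (h₃' S)⟩
  | ite s t K₁ K₂ ih₁ ih₂ =>
    obtain ⟨K₁', h₁, h₂, h₃⟩ := ih₁ hW.2.2.1 hA.1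
    obtain ⟨K₂', h₁', h₂', h₃'⟩ := ih₂ hW.2.2.2 hA.2
    exact ⟨.ite s t K₁' K₂', ⟨hW.1, hW.2.1, h₁, h₁'⟩, fun i => congrArg₂ (· + ·) (h₂ i) (h₂' i),
      fun S => congrArg₂ _ (h₃ S) (h₃' S)⟩
  | rep K ih =>
    obtain ⟨K', h₁, h₂, h₃⟩ := ih hW hA
    exact ⟨.rep K', h₁, h₂, fun S => congrArg _ (h₃ S)⟩

/-- A translation of prefixes extends to an encoding that does not change the names. -/
noncomputable def encoding (R : PrefixRel) : Encoding := ⟨R.map, 1, one_pos, fun a _ => a⟩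

/-- Completeness transports computations forwards. Soundness, divergence and success in the target
are transported backwards along the converse correspondence, starting from the exact round trip. -/
theorem Lawful.isValid_encoding (hR : R.Lawful L L') (hS : R.symm.Lawful L' L) (hT : R.Total L)
    {E : Proc → Proc → Prop} (hE : IsReferenceEquivalence L' E) :
    R.encoding.IsValid L L' E where
  maps _ h := hR.mem_map h
  compositional k op _ hop N := by
    obtain ⟨K, h₁, h₂, h₃⟩ := hR.exists_ctx hT hop.1 hop.2.1.2
    refine ⟨K, ⟨h₁, ?_, fun i => (h₂ i).trans (hop.2.2 i)⟩, fun S _ _ => h₃ S⟩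
    exact h₃ (fun _ => .nil) ▸ hR.mem_map hop.2.1
  name_invariant S hS σ _ := by
    have h : R.map (S.rename σ) = (R.map S).rename σ := by
      rw [Proc.rename_eq_ren, Proc.rename_eq_ren, hR.map_ren]
    refine ⟨σ, fun _ _ => rfl, fun b hb => absurd rfl (hb b ⟨0, one_pos⟩), fun _ => h, fun _ => ?_⟩
    change E (R.map (S.rename σ)) _
    rw [h]
    exact hE.refl _ (mem_rename (hR.mem_map hS) σ)
  op_complete S S' hS h :=
    ⟨R.map S', (hR.reds_map h (liveGood_of_good (hT.good hS.2))).1,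
      hE.refl _ (hR.mem_map (h.mem hS))⟩
  op_sound S T hM h := by
    obtain ⟨hg, he⟩ := hS.symm_map_map (hT.good hM.2)
    obtain ⟨h₁, h₂⟩ := hS.reds_map h (liveGood_of_good hg)
    have hm := h.mem (hR.mem_map hM)
    -- No further target steps are needed: pulling `T` back and translating again already gives `T`
    -- up to `≡`.
    refine ⟨R.symm.map T, he ▸ h₁, T, .refl, hE.of_structEq _ _ hm
      (hR.mem_map (hS.mem_map hm)) (hR.structEq_map_map hS _ le_rfl hm h₂)⟩
  divergence_reflecting S hM h := by
    obtain ⟨hg, he⟩ := hS.symm_map_map (hT.good hM.2)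
    exact he ▸ hS.diverges_map h (liveGood_of_good hg)
  success_sensitive S hM := by
    obtain ⟨hg, he⟩ := hS.symm_map_map (hT.good hM.2)
    exact ⟨fun h => hR.succeeds_map h (liveGood_of_good (hT.good hM.2)),
      fun h => he ▸ hS.succeeds_map h (liveGood_of_good hg)⟩

end PrefixRel

end Coord

namespace Coord

/-! ## Channels as data -/

theorem Term.toPat_injective : Function.Injective Term.toPat := by
  intro s
  induction s with
  | name v => rintro (w | ⟨t₁, t₂⟩) h <;> simp_all [Term.toPat]
  | comp s₁ s₂ ih₁ ih₂ =>
    rintro (w | ⟨t₁, t₂⟩) h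
    · simp [Term.toPat] at h
    · simp only [Term.toPat, Pat.comp.injEq] at h
      rw [ih₁ h.1, ih₂ h.2]

/-- A renaming keeps binding names binding, so a pattern that only matches after it only matched
before. -/
theorem Pat.exists_eq_toPat (r : Name → Name) {p : Pat} {t : Term}
    (h : p.subst (fun v => .name (r v)) = t.toPat) : ∃ s : Term, p = s.toPat := by
  induction p generalizing t with
  | bind => cases t <;> simp [Pat.subst, Term.toPat] at h
  | nameMatch v => exact ⟨.name v, rfl⟩
  | comp p q ihp ihq =>
    cases t with
    | name v => simp [Pat.subst, Term.toPat] at h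
    | comp t₁ t₂ =>
      simp only [Pat.subst, Term.toPat, Pat.comp.injEq] at h
      obtain ⟨s₁, rfl⟩ := ihp h.1
      obtain ⟨s₂, rfl⟩ := ihq h.2
      exact ⟨.comp s₁ s₂, rfl⟩

theorem TermMatch.toPat (t : Term) : TermMatch t t.toPat [] := by
  induction t with
  | name v => exact .name v
  | comp s t ihs iht => exact .comp ihs iht

theorem TermMatch.eq_of_toPat {t s : Term} {σ : List Term} (h : TermMatch t s.toPat σ) :
    t = s ∧ σ = [] := by
  induction s generalizing t σ with
  | name v => cases h; exact ⟨rfl, rfl⟩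
  | comp s₁ s₂ ih₁ ih₂ =>
    cases h with
    | comp h₁ h₂ =>
      obtain ⟨rfl, rfl⟩ := ih₁ h₁
      obtain ⟨rfl, rfl⟩ := ih₂ h₂
      exact ⟨rfl, rfl⟩

/-- Here matching becomes indispensable: the receiver must be allowed to test the channel. -/
theorem Lang.okPat_toPat {L : Lang} (hL : L.matching ≠ .NO) {t : Term} :
    L.OkPat t.toPat ↔ L.OkTerm t := by
  unfold Lang.OkPat Lang.OkTerm
  cases t <;> cases h : L.matching <;> simp_all [Term.toPat]

namespace PrefixRel

/-- The channel becomes the first datum. -/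
def polyadic : PrefixRel where
  O x y := ∃ s d, x = (some s, d) ∧ y = (none, s :: d)
  I i j := ∃ s ps, i = ⟨some s, ps⟩ ∧ j = ⟨none, s.toPat :: ps⟩

/-- The channel is joined to the datum. -/
def monadic : PrefixRel where
  O x y := ∃ s t, x = (some s, [t]) ∧ y = (none, [.comp s t])
  I i j := ∃ s p, i = ⟨some s, [p]⟩ ∧ j = ⟨none, [.comp s.toPat p]⟩

variable (α : Synchronism) (ε : Coordination) {δ : Matching}

theorem lawful_polyadic (hδ : δ ≠ .NO) :
    polyadic.Lawful ⟨α, .P, .C, δ, ε⟩ ⟨α, .P, .D, δ, ε⟩ where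
  sync := rfl
  coord := rfl
  uniqueO := by rintro _ _ _ ⟨s, d, rfl, rfl⟩ ⟨s', d', h, rfl⟩; simp_all
  uniqueI := by rintro _ _ _ ⟨s, d, rfl, rfl⟩ ⟨s', d', h, rfl⟩; simp_all
  substO := by rintro _ _ f ⟨s, d, rfl, rfl⟩; exact ⟨s.subst f, _, rfl, rfl⟩
  substI := by
    rintro _ _ f ⟨s, d, rfl, rfl⟩
    exact ⟨s.subst f, _, rfl, by simp [Inp.subst, Term.toPat_subst]⟩
  of_renO := by
    rintro ⟨_ | s, d⟩ _ r ⟨_, _, h, _⟩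
    · simp [substOut] at h
    · exact ⟨_, s, d, rfl, rfl⟩
  of_renI := by
    rintro ⟨_ | s, d⟩ _ r ⟨_, _, h, _⟩
    · simp [Inp.subst] at h
    · exact ⟨_, s, d, rfl, rfl⟩
  closedO := by rintro _ _ n ⟨s, d, rfl, rfl⟩ h; simpa using h
  closedI := by
    rintro _ _ n ⟨s, d, rfl, rfl⟩ h
    simpa [Inp.ClosedAt, Term.toPat_closedAt] using h
  fnO := by rintro _ _ ⟨s, d, rfl, rfl⟩; simp
  fnI := by rintro _ _ ⟨s, d, rfl, rfl⟩; simp [Inp.fn, Term.fn_toPat]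
  okO := by
    rintro _ _ ⟨s, d, rfl, rfl⟩ ⟨⟨s', h, hs⟩, _, hd⟩
    obtain rfl : s = s' := Option.some.inj h
    exact ⟨rfl, trivial, List.forall_mem_cons.2 ⟨hs, hd⟩⟩
  okI := by
    rintro _ _ ⟨s, d, rfl, rfl⟩ ⟨⟨s', h, hs⟩, _, hd⟩
    obtain rfl : s = s' := Option.some.inj h
    exact ⟨rfl, trivial, List.forall_mem_cons.2 ⟨(Lang.okPat_toPat hδ).2 hs, hd⟩⟩
  binders := by rintro _ _ ⟨s, d, rfl, rfl⟩; simp [Inp.binders, Term.binders_toPat]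
  polyMatch := by
    rintro _ _ _ _ _ _ σ ⟨s, d, h₁, h₂⟩ ⟨s', ps, h₃, rfl⟩ h
    simp_all only [Prod.mk.injEq, Inp.mk.injEq, Option.some.injEq]
    obtain ⟨rfl, rfl⟩ := h₃
    -- Matching the channel against its own pattern contributes the empty substitution.
    exact ⟨trivial, .cons (.toPat _) h⟩

theorem lawful_polyadic_symm (hδ : δ ≠ .NO) :
    polyadic.symm.Lawful ⟨α, .P, .D, δ, ε⟩ ⟨α, .P, .C, δ, ε⟩ where
  sync := rfl
  coord := rfl
  uniqueO := by rintro _ _ _ ⟨s, d, rfl, rfl⟩ ⟨s', d', rfl, h⟩; simp_all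
  uniqueI := by
    rintro _ _ _ ⟨s, d, rfl, rfl⟩ ⟨s', d', rfl, h⟩
    simp_all [Term.toPat_injective.eq_iff]
  substO f h := (lawful_polyadic α ε hδ).substO f h
  substI f h := (lawful_polyadic α ε hδ).substI f h
  of_renO := by
    -- Only nonempty tuples come from a channel output; the empty tuple of the dataspace has no
    -- counterpart.
    rintro ⟨_ | s, _ | ⟨t, d⟩⟩ _ r ⟨_, _, _, h⟩
    all_goals try simp [substOut] at h
    exact ⟨_, t, d, rfl, rfl⟩
  of_renI := by
    rintro ⟨_ | s, _ | ⟨p, ps⟩⟩ _ r ⟨_, _, _, h⟩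
    all_goals try simp [Inp.subst] at h
    obtain ⟨s, rfl⟩ := Pat.exists_eq_toPat r h.1
    exact ⟨_, s, ps, rfl, rfl⟩
  closedO := by rintro _ _ n ⟨s, d, rfl, rfl⟩ h; simpa using h
  closedI := by
    rintro _ _ n ⟨s, d, rfl, rfl⟩ h
    simpa [Inp.ClosedAt, Term.toPat_closedAt] using h
  fnO := by rintro _ _ ⟨s, d, rfl, rfl⟩; simp
  fnI := by rintro _ _ ⟨s, d, rfl, rfl⟩; simp [Inp.fn, Term.fn_toPat]
  okO := by
    rintro _ _ ⟨s, d, rfl, rfl⟩ ⟨_, _, hd⟩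
    exact ⟨⟨s, rfl, hd s (by simp)⟩, trivial, fun t ht => hd t (by simp [ht])⟩
  okI := by
    rintro _ _ ⟨s, d, rfl, rfl⟩ ⟨_, _, hd⟩
    exact ⟨⟨s, rfl, (Lang.okPat_toPat hδ).1 (hd _ List.mem_cons_self)⟩, trivial,
      fun t ht => hd t (List.mem_cons_of_mem _ ht)⟩
  binders h := ((lawful_polyadic α ε hδ).binders h).symm
  polyMatch := by
    rintro _ _ _ _ _ _ σ ⟨s, d, h₁, h₂⟩ ⟨s', ps, rfl, h₃⟩ h
    simp_all only [Prod.mk.injEq, Inp.mk.injEq]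
    cases h with
    | cons h h' =>
      obtain ⟨rfl, rfl⟩ := h.eq_of_toPat
      exact ⟨rfl, h'⟩

theorem total_polyadic : polyadic.Total ⟨α, .P, .C, δ, ε⟩ := by
  constructor
  · rintro ⟨_, d⟩ ⟨⟨s, rfl, _⟩, _⟩
    exact ⟨_, s, d, rfl, rfl⟩
  · rintro ⟨_, ps⟩ ⟨⟨s, rfl, _⟩, _⟩
    exact ⟨_, s, ps, rfl, rfl⟩

theorem lawful_monadic : monadic.Lawful ⟨α, .M, .C, .I, ε⟩ ⟨α, .M, .D, .I, ε⟩ where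
  sync := rfl
  coord := rfl
  uniqueO := by rintro _ _ _ ⟨s, d, rfl, rfl⟩ ⟨s', d', h, rfl⟩; simp_all
  uniqueI := by rintro _ _ _ ⟨s, d, rfl, rfl⟩ ⟨s', d', h, rfl⟩; simp_all
  substO := by rintro _ _ f ⟨s, d, rfl, rfl⟩; exact ⟨s.subst f, _, rfl, rfl⟩
  substI := by
    rintro _ _ f ⟨s, d, rfl, rfl⟩
    exact ⟨s.subst f, _, rfl, by simp [Inp.subst, Pat.subst, Term.toPat_subst]⟩
  of_renO := by
    rintro ⟨_ | s, _ | ⟨t, _ | _⟩⟩ _ r ⟨_, _, h, _⟩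
    all_goals try simp [substOut] at h
    exact ⟨_, s, t, rfl, rfl⟩
  of_renI := by
    rintro ⟨_ | s, _ | ⟨p, _ | _⟩⟩ _ r ⟨_, _, h, _⟩
    all_goals try simp [Inp.subst] at h
    exact ⟨_, s, p, rfl, rfl⟩
  closedO := by rintro _ _ n ⟨s, d, rfl, rfl⟩ h; simpa [Term.ClosedAt] using h
  closedI := by
    rintro _ _ n ⟨s, d, rfl, rfl⟩ h
    simpa [Inp.ClosedAt, Pat.ClosedAt, Term.toPat_closedAt] using h
  fnO := by rintro _ _ ⟨s, d, rfl, rfl⟩; simp [Term.fn]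
  fnI := by rintro _ _ ⟨s, d, rfl, rfl⟩; simp [Inp.fn, Pat.fn, Term.fn_toPat]
  okO := by rintro _ _ ⟨s, d, rfl, rfl⟩ _; exact ⟨rfl, rfl, fun _ _ => trivial⟩
  okI := by rintro _ _ ⟨s, d, rfl, rfl⟩ _; exact ⟨rfl, rfl, fun _ _ => trivial⟩
  binders := by rintro _ _ ⟨s, d, rfl, rfl⟩; simp [Inp.binders, Pat.binders, Term.binders_toPat]
  polyMatch := by
    rintro _ _ _ _ _ _ σ ⟨s, d, h₁, h₂⟩ ⟨s', p, h₃, rfl⟩ h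
    simp_all only [Prod.mk.injEq, Inp.mk.injEq, Option.some.injEq]
    obtain ⟨rfl, rfl⟩ := h₃
    cases h with
    | cons h h' => exact ⟨trivial, .cons (.comp (.toPat _) h) h'⟩

theorem lawful_monadic_symm : monadic.symm.Lawful ⟨α, .M, .D, .I, ε⟩ ⟨α, .M, .C, .I, ε⟩ where
  sync := rfl
  coord := rfl
  uniqueO := by rintro _ _ _ ⟨s, d, rfl, rfl⟩ ⟨s', d', rfl, h⟩; simp_all
  uniqueI := by
    rintro _ _ _ ⟨s, d, rfl, rfl⟩ ⟨s', d', rfl, h⟩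
    simp_all [Term.toPat_injective.eq_iff]
  substO f h := (lawful_monadic α ε).substO f h
  substI f h := (lawful_monadic α ε).substI f h
  of_renO := by
    rintro ⟨_ | s, _ | ⟨_ | ⟨s, t⟩, _ | _⟩⟩ _ r ⟨_, _, _, h⟩
    all_goals try simp [substOut, Term.subst] at h
    exact ⟨_, s, t, rfl, rfl⟩
  of_renI := by
    rintro ⟨_ | s, _ | ⟨_ | _ | ⟨p, q⟩, _ | _⟩⟩ _ r ⟨_, _, _, h⟩
    all_goals try simp [Inp.subst, Pat.subst, Term.toPat] at h
    obtain ⟨s, rfl⟩ := Pat.exists_eq_toPat r h.1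
    exact ⟨_, s, q, rfl, rfl⟩
  closedO := by rintro _ _ n ⟨s, d, rfl, rfl⟩ h; simpa [Term.ClosedAt] using h
  closedI := by
    rintro _ _ n ⟨s, d, rfl, rfl⟩ h
    simpa [Inp.ClosedAt, Pat.ClosedAt, Term.toPat_closedAt] using h
  fnO := by rintro _ _ ⟨s, d, rfl, rfl⟩; simp [Term.fn]
  fnI := by rintro _ _ ⟨s, d, rfl, rfl⟩; simp [Inp.fn, Pat.fn, Term.fn_toPat]
  okO := by rintro _ _ ⟨s, d, rfl, rfl⟩ _; exact ⟨⟨s, rfl, trivial⟩, rfl, fun _ _ => trivial⟩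
  okI := by rintro _ _ ⟨s, d, rfl, rfl⟩ _; exact ⟨⟨s, rfl, trivial⟩, rfl, fun _ _ => trivial⟩
  binders h := ((lawful_monadic α ε).binders h).symm
  polyMatch := by
    rintro _ _ _ _ _ _ σ ⟨s, d, h₁, h₂⟩ ⟨s', p, rfl, h₃⟩ h
    simp_all only [Prod.mk.injEq, Inp.mk.injEq]
    cases h with
    | cons h h' =>
      cases h with
      | comp h h'' =>
        obtain ⟨rfl, rfl⟩ := h.eq_of_toPat
        exact ⟨rfl, .cons h'' h'⟩

theorem total_monadic : monadic.Total ⟨α, .M, .C, .I, ε⟩ := by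
  constructor
  · rintro ⟨_, d⟩ ⟨⟨s, rfl, _⟩, h, _⟩
    obtain ⟨t, rfl⟩ := List.length_eq_one_iff.1 h
    exact ⟨_, s, t, rfl, rfl⟩
  · rintro ⟨_, ps⟩ ⟨⟨s, rfl, _⟩, h, _⟩
    obtain ⟨p, rfl⟩ := List.length_eq_one_iff.1 h
    exact ⟨_, s, p, rfl, rfl⟩

end PrefixRel

theorem exists_isValid_polyadic (α : Synchronism) (ε : Coordination) {δ : Matching} (hδ : δ ≠ .NO)
    {E : Proc → Proc → Prop} (hE : IsReferenceEquivalence ⟨α, .P, .D, δ, ε⟩ E) :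
    ∃ e : Encoding, e.IsValid ⟨α, .P, .C, δ, ε⟩ ⟨α, .P, .D, δ, ε⟩ E :=
  ⟨_, (PrefixRel.lawful_polyadic α ε hδ).isValid_encoding (PrefixRel.lawful_polyadic_symm α ε hδ)
    (PrefixRel.total_polyadic α ε) hE⟩

theorem exists_isValid_intensional (α : Synchronism) (ε : Coordination)
    {E : Proc → Proc → Prop} (hE : IsReferenceEquivalence ⟨α, .M, .D, .I, ε⟩ E) :
    ∃ e : Encoding, e.IsValid ⟨α, .M, .C, .I, ε⟩ ⟨α, .M, .D, .I, ε⟩ E :=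
  ⟨_, (PrefixRel.lawful_monadic α ε).isValid_encoding (PrefixRel.lawful_monadic_symm α ε)
    (PrefixRel.total_monadic α ε) hE⟩

end Coord

theorem mainTheorem10 (E : Coord.Lang → Coord.Proc → Coord.Proc → Prop)
    (hE : ∀ L, Coord.IsReferenceEquivalence L (E L))
    (α : Coord.Synchronism) (β : Coord.Arity) (δ : Coord.Matching)
    (h : ¬ ∃ e : Coord.Encoding,
      e.IsValid ⟨α, β, .C, δ, .B⟩ ⟨α, β, .D, δ, .B⟩ (E ⟨α, β, .D, δ, .B⟩)) :
    ∀ ε : Coord.Coordination, ¬ ∃ e : Coord.Encoding,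
      e.IsValid ⟨α, β, .C, δ, ε⟩ ⟨α, β, .D, δ, .J⟩ (E ⟨α, β, .D, δ, .J⟩) := by
  rintro ε ⟨e, he⟩
  cases δ with
  | NO => exact Coord.not_isValid_of_noMatching (hE _) e he
  | NM =>
    cases β with
    | M => exact Coord.not_isValid_of_monadic_nameMatching (hE _) e he
    -- From here on a binary encoding exists, contrary to the hypothesis.
    | P => exact h (Coord.exists_isValid_polyadic α .B (δ := .NM) nofun (hE _))
  | I =>
    cases β with
    | M => exact h (Coord.exists_isValid_intensional α .B (hE _))
    | P => exact h (Coord.exists_isValid_polyadic α .B (δ := .I) nofun (hE _))
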